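/- **System.** Types are generated by type variables, $A\Rightarrow B$, $\forall X.A$, $1$, $0$, $A\times B$, $A+B$, $\mu X.A$, $\nu X.A$, and terms are the Church-style terms of System F with the usual constructors for products, sums, $1$, $0$, together with $\mathsf{in}_A,\mathsf{fold}_A,\mathsf{out}_A,\mathsf{unfold}_A$. In $\mathsf{\Lambda 2p}^*_{\mu\nu}$ only those types are admitted in which $\mu X.A$, $\nu X.A$ are formed only when $X$ occurs only positively in $A$, and in which every universal type has (at least) one of the two forms $$\text{(a)}\ \ \forall X.\big\langle\forall\vec Y_k.\langle A_{jk}\rangle_j\Rightarrow X\big\rangle_k\Rightarrow B,\qquad\qquad \text{(b)}\ \ \forall X.\big\langle\forall\vec Y_j.X\Rightarrow A_j\big\rangle_j\Rightarrow B,$$ where in (a) $X$ occurs only positively in the $A_{jk}$ and in $B$, and in (b) $X$ occurs only positively in the $A_j$ and only negatively in $B$. Here $\langle A_i\rangle_{i}\Rightarrow B$ stands for $A_{1}\Rightarrow\dots\Rightarrow A_{n}\Rightarrow B$, all lists may be empty, and $A\langle E\rangle$ stands for $A[E/X]$. For $A$ with $X$ only positive, a term $t[x]:E\vdash F$ induces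 $\Phi_A(t)[x]:A\langle E\rangle\vdash A\langle F\rangle$ (the usual functorial action, by induction on $A$), and $\Phi_A(t)[x]:A\langle F\rangle\vdash A\langle E\rangle$ if $X$ is only negative in $A$. **$\varepsilon$-theory.** $\simeq_\varepsilon$ is the least congruent equational theory on well-typed terms of $\mathsf{\Lambda 2p}^*_{\mu\nu}$, in arbitrary contexts, that is closed under the $\beta$- and $\eta$-rules (for $\mu$ and $\nu$: the computation rules of $\mathsf{fold}$ and $\mathsf{unfold}$ and their uniqueness) and under the following two rules, for terms $v[x]:E\vdash F$. For $t$ of a type (a) and $e_k:\forall\vec Y_k.\langle A_{jk}\langle E\rangle\rangle_j\Rightarrow E$, $f_k:\forall\vec Y_k.\langle A_{jk}\langle F\rangle\rangle_j\Rightarrow F$: if $v[e_k\vec Y_k\langle z_j\rangle_j]\simeq f_k\vec Y_k\langle\Phi_{A_{jk}}(v)[z_j]\rangle_j$ for all $k$, then $\Phi_B(v)[t\,E\,\langle e_k\rangle_k]\simeq t\,F\,\langle f_k\rangle_k$. For $t$ of a type (b) and $e_j:\forall\vec Y_j.E\Rightarrow A_j\langle E\rangle$, $f_j:\forall\vec Y_j.F\Rightarrow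 A_j\langle F\rangle$: if $\Phi_{A_j}(v)[e_j\vec Y_j x]\simeq f_j\vec Y_j\,v[x]$ for all $j$, then $\Phi_B(v)[t\,F\,\langle f_j\rangle_j]\simeq t\,E\,\langle e_j\rangle_j$. **Theorem.** Write $\exists\vec Y.A$ for $\forall Z.(\forall\vec Y.A\Rightarrow Z)\Rightarrow Z$; finite sums and products $\sum_k,\prod_j$ are iterated binary ones (the empty ones are $0$ and $1$, those of one type are this type), with injections $\mathsf{in}_k$, tuples $\langle t_j\rangle_j$, projections $\pi_j$ and case distinction $\delta$. (1) ($\equiv_{X+}$) Let $\forall X.\langle\forall\vec Y_k.\langle A_{jk}\rangle_j\Rightarrow X\rangle_k\Rightarrow B$ be a type of $\mathsf{\Lambda 2p}^*_{\mu\nu}$ with $X$ only positive in the $A_{jk}$ and in $B$. Let $T=\sum_k\exists\vec Y_k.\prod_jA_{jk}$, and let $\alpha=\mu X.T$ if $X$ occurs in some $A_{jk}$, and $\alpha=T$ otherwise; suppose that $\alpha$ is a type of $\mathsf{\Lambda 2p}^*_{\mu\nu}$. Put $$\hat a_k=\Lambda\vec Y_k.\lambda\langle z_j\rangle_j.\,\mathsf{in}_T\big(\mathsf{in}_k(\Lambda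 Z.\lambda f.f\,\vec Y_k\,\langle z_j\rangle_j)\big),\qquad b[x]=\delta\big(x,\big\langle z.\ z\,X\,(\Lambda\vec Y_k.\lambda y.\,f_k\,\vec Y_k\,\langle\pi_j y\rangle_j)\big\rangle_k\big).$$ Then the terms $$s[x]=x\,\alpha\,\langle\hat a_k\rangle_k,\qquad t[x]=\Lambda X.\lambda\langle f_k\rangle_k.\,\Phi_B\big(\mathsf{fold}_T(\lambda x.b[x])\,x\big)$$ (without $\mathsf{in}_T$ and $\mathsf{fold}_T$ if $\alpha=T$) are typable in $\mathsf{\Lambda 2p}^*_{\mu\nu}$ as $$s:\ \forall X.\big\langle\forall\vec Y_k.\langle A_{jk}\rangle_j\Rightarrow X\big\rangle_k\Rightarrow B\ \vdash\ B[\alpha/X],\qquad t:\ B[\alpha/X]\ \vdash\ \forall X.\big\langle\forall\vec Y_k.\langle A_{jk}\rangle_j\Rightarrow X\big\rangle_k\Rightarrow B,$$ and $s[t[x]]\simeq_\varepsilon x$ and $t[s[x]]\simeq_\varepsilon x$. (2) ($\equiv_{X-}$) Let $\forall X.\langle\forall\vec Y_j.X\Rightarrow A_j\rangle_j\Rightarrow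 B$ be a type of $\mathsf{\Lambda 2p}^*_{\mu\nu}$ with $X$ only positive in the $A_j$ and only negative in $B$. Let $U=\prod_j\forall\vec Y_j.A_j$, and let $\beta=\nu X.U$ if $X$ occurs in some $A_j$, and $\beta=U$ otherwise; suppose that $\beta$ is a type of $\mathsf{\Lambda 2p}^*_{\mu\nu}$. Put $\hat c_j=\Lambda\vec Y_j.\lambda x.\,\pi_j(\mathsf{out}_U\,x)\,\vec Y_j$ and $d=\lambda z.\langle\Lambda\vec Y_j.f_j\,\vec Y_j\,z\rangle_j$. Then the terms $$u[x]=x\,\beta\,\langle\hat c_j\rangle_j,\qquad v[x]=\Lambda X.\lambda\langle f_j\rangle_j.\,\Phi_B\big(\mathsf{unfold}_U(d)\,x\big)$$ (without $\mathsf{out}_U$ and $\mathsf{unfold}_U$ if $\beta=U$) are typable in $\mathsf{\Lambda 2p}^*_{\mu\nu}$ as $$u:\ \forall X.\big\langle\forall\vec Y_j.X\Rightarrow A_j\big\rangle_j\Rightarrow B\ \vdash\ B[\beta/X],\qquad v:\ B[\beta/X]\ \vdash\ \forall X.\big\langle\forall\vec Y_j.X\Rightarrow A_j\big\rangle_j\Rightarrow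 B,$$ and $u[v[x]]\simeq_\varepsilon x$ and $v[u[x]]\simeq_\varepsilon x$. (3) If all the $\vec Y_j$ are the same list $\vec Y$, then (2) also holds with $U=\forall\vec Y.\prod_jA_j$, $\hat c_j=\Lambda\vec Y.\lambda x.\,\pi_j(\mathsf{out}_U\,x\,\vec Y)$ and $d=\lambda z.\Lambda\vec Y.\langle f_j\,\vec Y\,z\rangle_j$. -/

import Mathlib

/-! The type system `Λ2p*_{μν}`, its `ε`-theory, and the terms realizing the Yoneda type
isomorphisms.  Type variables and term variables are de Bruijn indices; "context `Γ, x`" means that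
`x` is the index `0` and the variables of `Γ` are shifted by one. -/

namespace Yoneda

/-! ### Types -/

/-- Types: variables, `A ⇒ B`, `∀X.A`, `1`, `0`, `A × B`, `A + B`, `μX.A`, `νX.A`. The binders
`all`, `mu`, `nu` bind the type variable `0` of their body. -/
inductive Ty : Type
  | var (n : ℕ)
  | arr (A B : Ty)
  | all (A : Ty)
  | one
  | zero
  | prod (A B : Ty)
  | sum (A B : Ty)
  | mu (A : Ty)
  | nu (A : Ty)

/-- Lifting a renaming under one binder. -/
def upr (ρ : ℕ → ℕ) : ℕ → ℕ
  | 0 => 0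
  | n + 1 => ρ n + 1

namespace Ty

def rename : Ty → (ℕ → ℕ) → Ty
  | var n, ρ => var (ρ n)
  | arr A B, ρ => arr (A.rename ρ) (B.rename ρ)
  | all A, ρ => all (A.rename (upr ρ))
  | one, _ => one
  | zero, _ => zero
  | prod A B, ρ => prod (A.rename ρ) (B.rename ρ)
  | sum A B, ρ => sum (A.rename ρ) (B.rename ρ)
  | mu A, ρ => mu (A.rename (upr ρ))
  | nu A, ρ => nu (A.rename (upr ρ))

/-- Weakening by `m` type variables. -/
def shift (m : ℕ) (A : Ty) : Ty := A.rename (fun n => n + m)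

/-- The substitution `0 ↦ A`, `n + 1 ↦ σ n`. -/
def scons (A : Ty) (σ : ℕ → Ty) : ℕ → Ty
  | 0 => A
  | n + 1 => σ n

/-- Lifting a substitution under one binder. -/
def up (σ : ℕ → Ty) : ℕ → Ty := scons (var 0) (fun n => (σ n).shift 1)

/-- Simultaneous capture-avoiding substitution. -/
def subst : Ty → (ℕ → Ty) → Ty
  | var n, σ => σ n
  | arr A B, σ => arr (A.subst σ) (B.subst σ)
  | all A, σ => all (A.subst (up σ))
  | one, _ => one
  | zero, _ => zero
  | prod A B, σ => prod (A.subst σ) (B.subst σ)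
  | sum A B, σ => sum (A.subst σ) (B.subst σ)
  | mu A, σ => mu (A.subst (up σ))
  | nu A, σ => nu (A.subst (up σ))

/-- The substitution `[E/X]` for the variable `X` that has index `m`, i.e. below `m` further
binders `Y₁, …, Yₘ`; the type `E` does not depend on `Y₁, …, Yₘ`. -/
def single (m : ℕ) (E : Ty) : ℕ → Ty := up^[m] (scons E var)

/-- `A[E/X]` where `X` is the variable `0`. -/
def inst (A E : Ty) : Ty := A.subst (single 0 E)

/-- `OnlySign true i A`: all occurrences of the variable `i` in `A` are positive;
`OnlySign false i A`: all of them are negative. -/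
def OnlySign : Bool → ℕ → Ty → Prop
  | b, i, var n => n = i → b = true
  | b, i, arr A B => OnlySign (!b) i A ∧ OnlySign b i B
  | b, i, all A => OnlySign b (i + 1) A
  | _, _, one => True
  | _, _, zero => True
  | b, i, prod A B => OnlySign b i A ∧ OnlySign b i B
  | b, i, sum A B => OnlySign b i A ∧ OnlySign b i B
  | b, i, mu A => OnlySign b (i + 1) A
  | b, i, nu A => OnlySign b (i + 1) A

def Pos (i : ℕ) (A : Ty) : Prop := OnlySign true i A

def Neg (i : ℕ) (A : Ty) : Prop := OnlySign false i A

/-- Does the variable `i` occur free in `A`? -/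
def occ : ℕ → Ty → Bool
  | i, var n => n == i
  | i, arr A B => occ i A || occ i B
  | i, all A => occ (i + 1) A
  | _, one => false
  | _, zero => false
  | i, prod A B => occ i A || occ i B
  | i, sum A B => occ i A || occ i B
  | i, mu A => occ (i + 1) A
  | i, nu A => occ (i + 1) A

/-- `∀Y₁ … Yₘ. A`; in `A` the variable `Yᵢ` has index `m - i`. -/
def allN : ℕ → Ty → Ty
  | 0, A => A
  | m + 1, A => all (allN m A)

/-- `⟨Aᵢ⟩ᵢ ⇒ B`, that is `A₁ ⇒ … ⇒ Aₖ ⇒ B`. -/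
def arrows (As : List Ty) (B : Ty) : Ty := As.foldr arr B

/-- `∏ⱼ Aⱼ`, equal to `1` for the empty list and to `A` for a list with one element `A`. -/
def prodN : List Ty → Ty
  | [] => one
  | [A] => A
  | A :: B :: L => prod A (prodN (B :: L))

/-- `∑ₖ Aₖ`, equal to `0` for the empty list and to `A` for a list with one element `A`. -/
def sumN : List Ty → Ty
  | [] => zero
  | [A] => A
  | A :: B :: L => sum A (sumN (B :: L))

/-- The type `∀Y₁ … Yₘ. (A ⇒ Z)`, in a context ending with the variable `Z`. -/
def exPrem (m : ℕ) (A : Ty) : Ty := allN m (arr (A.rename (upr^[m] Nat.succ)) (var m))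

/-- `∃Y₁ … Yₘ. A := ∀Z. (∀Y₁ … Yₘ. A ⇒ Z) ⇒ Z`. -/
def ex (m : ℕ) (A : Ty) : Ty := all (arr (exPrem m A) (var 0))

/-- `∀Y₁ … Yₘ. ⟨Aⱼ⟩ⱼ ⇒ X`, given by `p = (m, ⟨Aⱼ⟩ⱼ)`, in a context ending with `X`. The types `Aⱼ`
live in the context `X, Y₁, …, Yₘ`, so `X` has index `m` in them. -/
def premL (p : ℕ × List Ty) : Ty := allN p.1 (arrows p.2 (var p.1))

/-- `∀Y₁ … Yₘ. X ⇒ A`, given by `q = (m, A)`, in a context ending with `X`. -/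
def premR (q : ℕ × Ty) : Ty := allN q.1 (arr (var q.1) q.2)

/-- `∀X. ⟨∀Y⃗ₖ. ⟨Aⱼₖ⟩ⱼ ⇒ X⟩ₖ ⇒ B`, where `Ps` lists the pairs `(|Y⃗ₖ|, ⟨Aⱼₖ⟩ⱼ)`. -/
def univL (Ps : List (ℕ × List Ty)) (B : Ty) : Ty := all (arrows (Ps.map premL) B)

/-- `∀X. ⟨∀Y⃗ⱼ. X ⇒ Aⱼ⟩ⱼ ⇒ B`, where `Qs` lists the pairs `(|Y⃗ⱼ|, Aⱼ)`. -/
def univR (Qs : List (ℕ × Ty)) (B : Ty) : Ty := all (arrows (Qs.map premR) B)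

/-- `X` occurs only positively in every `Aⱼₖ` and in `B`. -/
def SignL (Ps : List (ℕ × List Ty)) (B : Ty) : Prop :=
  (∀ p ∈ Ps, ∀ A ∈ p.2, Pos p.1 A) ∧ Pos 0 B

/-- `X` occurs only positively in every `Aⱼ` (so only negatively in
`∀X. ⟨∀Y⃗ⱼ. X ⇒ Aⱼ⟩ⱼ ⇒ B` as far as these occurrences are concerned) and only negatively in `B`. -/
def SignR (Qs : List (ℕ × Ty)) (B : Ty) : Prop :=
  (∀ q ∈ Qs, Pos q.1 q.2) ∧ Neg 0 B

/-- The types of `Λ2p*_{μν}`: fixpoints are taken of positive types only, and every universal type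
has one of the two forms `∀X. ⟨∀Y⃗ₖ. ⟨Aⱼₖ⟩ⱼ ⇒ X⟩ₖ ⇒ B`, `∀X. ⟨∀Y⃗ⱼ. X ⇒ Aⱼ⟩ⱼ ⇒ B`. -/
def Adm : Ty → Prop
  | var _ => True
  | arr A B => Adm A ∧ Adm B
  | all A => Adm A ∧
      ((∃ Ps B, all A = univL Ps B ∧ SignL Ps B) ∨ (∃ Qs B, all A = univR Qs B ∧ SignR Qs B))
  | one => True
  | zero => True
  | prod A B => Adm A ∧ Adm B
  | sum A B => Adm A ∧ Adm B
  | mu A => Adm A ∧ Pos 0 A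
  | nu A => Adm A ∧ Pos 0 A

end Ty

/-! ### Terms -/

/-- Church-style terms. `inl B t : A + B` for `t : A`, `inr A t : A + B` for `t : B`;
`case C t u v` is `δ_C(t, y.u, y.v)`; `abort C t` is `ξ_C t`; `inm`, `foldm`, `outn`, `unfoldn` are
`in_A`, `fold_A`, `out_A`, `unfold_A`, where the annotation `A` has the fixpoint variable as its
variable `0`. -/
inductive Tm : Type
  | var (n : ℕ)
  | lam (A : Ty) (t : Tm)
  | app (t u : Tm)
  | tlam (t : Tm)
  | tapp (t : Tm) (A : Ty)
  | pair (t u : Tm)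
  | fst (t : Tm)
  | snd (t : Tm)
  | star
  | inl (B : Ty) (t : Tm)
  | inr (A : Ty) (t : Tm)
  | case (C : Ty) (t u v : Tm)
  | abort (C : Ty) (t : Tm)
  | inm (A : Ty) (t : Tm)
  | foldm (A : Ty) (t : Tm)
  | outn (A : Ty) (t : Tm)
  | unfoldn (A : Ty) (t : Tm)

namespace Tm

/-- Substitution of types for the type variables of a term. -/
def tsubst : Tm → (ℕ → Ty) → Tm
  | var n, _ => var n
  | lam A t, σ => lam (A.subst σ) (t.tsubst σ)
  | app t u, σ => app (t.tsubst σ) (u.tsubst σ)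
  | tlam t, σ => tlam (t.tsubst (Ty.up σ))
  | tapp t A, σ => tapp (t.tsubst σ) (A.subst σ)
  | pair t u, σ => pair (t.tsubst σ) (u.tsubst σ)
  | fst t, σ => fst (t.tsubst σ)
  | snd t, σ => snd (t.tsubst σ)
  | star, _ => star
  | inl B t, σ => inl (B.subst σ) (t.tsubst σ)
  | inr A t, σ => inr (A.subst σ) (t.tsubst σ)
  | case C t u v, σ => case (C.subst σ) (t.tsubst σ) (u.tsubst σ) (v.tsubst σ)
  | abort C t, σ => abort (C.subst σ) (t.tsubst σ)
  | inm A t, σ => inm (A.subst (Ty.up σ)) (t.tsubst σ)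
  | foldm A t, σ => foldm (A.subst (Ty.up σ)) (t.tsubst σ)
  | outn A t, σ => outn (A.subst (Ty.up σ)) (t.tsubst σ)
  | unfoldn A t, σ => unfoldn (A.subst (Ty.up σ)) (t.tsubst σ)

/-- Weakening of a term by `m` type variables. -/
def tshift (m : ℕ) (t : Tm) : Tm := t.tsubst (fun n => Ty.var (n + m))

/-- `t[A/X]` where `X` is the type variable `0`. -/
def tinst (t : Tm) (A : Ty) : Tm := t.tsubst (Ty.single 0 A)

/-- Renaming of term variables. -/
def rename : Tm → (ℕ → ℕ) → Tm
  | var n, ρ => var (ρ n)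
  | lam A t, ρ => lam A (t.rename (upr ρ))
  | app t u, ρ => app (t.rename ρ) (u.rename ρ)
  | tlam t, ρ => tlam (t.rename ρ)
  | tapp t A, ρ => tapp (t.rename ρ) A
  | pair t u, ρ => pair (t.rename ρ) (u.rename ρ)
  | fst t, ρ => fst (t.rename ρ)
  | snd t, ρ => snd (t.rename ρ)
  | star, _ => star
  | inl B t, ρ => inl B (t.rename ρ)
  | inr A t, ρ => inr A (t.rename ρ)
  | case C t u v, ρ => case C (t.rename ρ) (u.rename (upr ρ)) (v.rename (upr ρ))
  | abort C t, ρ => abort C (t.rename ρ)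
  | inm A t, ρ => inm A (t.rename ρ)
  | foldm A t, ρ => foldm A (t.rename ρ)
  | outn A t, ρ => outn A (t.rename ρ)
  | unfoldn A t, ρ => unfoldn A (t.rename ρ)

/-- Weakening of a term by `k` term variables. -/
def shift (k : ℕ) (t : Tm) : Tm := t.rename (fun n => n + k)

def scons (t : Tm) (σ : ℕ → Tm) : ℕ → Tm
  | 0 => t
  | n + 1 => σ n

def up (σ : ℕ → Tm) : ℕ → Tm := scons (var 0) (fun n => (σ n).shift 1)

/-- Simultaneous capture-avoiding substitution of terms for term variables. -/
def subst : Tm → (ℕ → Tm) → Tm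
  | var n, σ => σ n
  | lam A t, σ => lam A (t.subst (up σ))
  | app t u, σ => app (t.subst σ) (u.subst σ)
  | tlam t, σ => tlam (t.subst (fun n => (σ n).tshift 1))
  | tapp t A, σ => tapp (t.subst σ) A
  | pair t u, σ => pair (t.subst σ) (u.subst σ)
  | fst t, σ => fst (t.subst σ)
  | snd t, σ => snd (t.subst σ)
  | star, _ => star
  | inl B t, σ => inl B (t.subst σ)
  | inr A t, σ => inr A (t.subst σ)
  | case C t u v, σ => case C (t.subst σ) (u.subst (up σ)) (v.subst (up σ))
  | abort C t, σ => abort C (t.subst σ)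
  | inm A t, σ => inm A (t.subst σ)
  | foldm A t, σ => foldm A (t.subst σ)
  | outn A t, σ => outn A (t.subst σ)
  | unfoldn A t, σ => unfoldn A (t.subst σ)

/-- For `t[x]` in context `Γ, x` and `a` in a context extending `Γ` by `k` variables, `t.plug k a`
is `t[a]`, in the context of `a`. -/
def plug (t : Tm) (k : ℕ) (a : Tm) : Tm := t.subst (scons a (fun n => var (n + k)))

/-- `t u₁ … uₙ`. -/
def apps (t : Tm) (us : List Tm) : Tm := us.foldl app t

/-- `t Y₁ … Yₘ`, where `Y₁, …, Yₘ` are the last `m` type variables of the context. -/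
def tappVars (t : Tm) (m : ℕ) : Tm := ((List.range m).reverse.map Ty.var).foldl tapp t

/-- The list `⟨x₁, …, xₙ⟩` of the last `n` term variables of the context. -/
def vars (n : ℕ) : List Tm := (List.range n).reverse.map var

/-- `λx₁ … λxₙ. t` with `xᵢ : Aᵢ`. -/
def lams (As : List Ty) (t : Tm) : Tm := As.foldr lam t

/-- `ΛY₁ … Yₘ. t`. -/
def tlamN : ℕ → Tm → Tm
  | 0, t => t
  | m + 1, t => tlam (tlamN m t)

/-- Tuples, with type `∏ⱼ Aⱼ`. -/
def tuple : List Tm → Tm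
  | [] => star
  | [t] => t
  | t :: u :: ts => pair t (tuple (u :: ts))

/-- `proj n j t` is the component of index `j < n` (counting from `0`) of the `n`-tuple `t`. -/
def proj : ℕ → ℕ → Tm → Tm
  | 0, _, t => t
  | 1, _, t => t
  | _ + 2, 0, t => fst t
  | n + 2, j + 1, t => proj (n + 1) j (snd t)

/-- `inj As k t` is the injection of index `k` (counting from `0`) into `∑ As`. -/
def inj : List Ty → ℕ → Tm → Tm
  | [], _, t => t
  | [_], _, t => t
  | _ :: B :: L, 0, t => inl (Ty.sumN (B :: L)) t
  | A :: B :: L, k + 1, t => inr A (inj (B :: L) k t)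

/-- The generalized sum destructor: `caseN C ⟨z.uₖ⟩ₖ 0 t` is `δ(t, ⟨z.uₖ⟩ₖ) : C`. The branches live in
`Γ, z` and `t` in an extension of `Γ` by `d` variables. -/
def caseN (C : Ty) : List Tm → ℕ → Tm → Tm
  | [], _, t => abort C t
  | [u], d, t => u.plug d t
  | u :: v :: us, d, t => case C t (u.plug (d + 1) (var 0)) (caseN C (v :: us) (d + 1) (var 0))

/-- The functorial action `Φ^X_A(t)` of a type `A` in its variable `X` of index `i`, at the
substitutions `σ`, `τ` for the variables of `A`, which agree except at `X`. The result is a term in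
context `Γ, x : A[σ]`, of type `A[τ]`. Here `t` is in context `Γ, x : σ(X)` and has type `τ(X)` if
`X` is positive in `A`; it is in context `Γ, x : τ(X)` and has type `σ(X)` if `X` is negative
in `A`. -/
def fmap : Ty → ℕ → (ℕ → Ty) → (ℕ → Ty) → Tm → Tm
  | .var n, i, _, _, t => if n = i then t else var 0
  | .arr C D, i, σ, τ, t =>
      lam (C.subst τ)
        ((fmap D i σ τ t).plug 2 (app (var 1) ((fmap C i τ σ t).plug 2 (var 0))))
  | .all C, i, σ, τ, t =>
      tlam ((fmap C (i + 1) (Ty.up σ) (Ty.up τ) (t.tshift 1)).plug 1 (tapp (var 0) (Ty.var 0)))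
  | .one, _, _, _, _ => var 0
  | .zero, _, _, _, _ => var 0
  | .prod C D, i, σ, τ, t =>
      pair ((fmap C i σ τ t).plug 1 (fst (var 0))) ((fmap D i σ τ t).plug 1 (snd (var 0)))
  | .sum C D, i, σ, τ, t =>
      case (.sum (C.subst τ) (D.subst τ)) (var 0)
        (inl (D.subst τ) ((fmap C i σ τ t).plug 2 (var 0)))
        (inr (C.subst τ) ((fmap D i σ τ t).plug 2 (var 0)))
  | .mu C, i, σ, τ, t =>
      let M := Ty.mu (C.subst (Ty.up τ))
      app (foldm (C.subst (Ty.up σ)) (lam (C.subst (Ty.scons M σ))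
        (inm (C.subst (Ty.up τ))
          ((fmap C (i + 1) (Ty.scons M σ) (Ty.scons M τ) t).plug 2 (var 0))))) (var 0)
  | .nu C, i, σ, τ, t =>
      let N := Ty.nu (C.subst (Ty.up σ))
      app (unfoldn (C.subst (Ty.up τ)) (lam N
        ((fmap C (i + 1) (Ty.scons N σ) (Ty.scons N τ) t).plug 2
          (outn (C.subst (Ty.up σ)) (var 0))))) (var 0)

/-- `Φ^X_A(t)` from `A[E/X]` to `A[F/X]`, where `X` is the variable of index `m` of `A`, preceded
by `Y₁, …, Yₘ`; the types `E`, `F` and the term `t` do not depend on `Y₁, …, Yₘ`. -/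
def act (A : Ty) (m : ℕ) (E F : Ty) (t : Tm) : Tm :=
  fmap A m (Ty.single m E) (Ty.single m F) (t.tshift m)

end Tm

open Ty Tm

/-! ### Typing -/

/-- Weakening of a context by `m` type variables. -/
def shiftC (m : ℕ) (Γ : List Ty) : List Ty := Γ.map (Ty.shift m)

/-- The judgement `Γ ⊢ t : A` of `Λ2p*_{μν}`; all types are types of `Λ2p*_{μν}`. -/
inductive HasType : List Ty → Tm → Ty → Prop
  | var {Γ n A} : Γ[n]? = some A → A.Adm → HasType Γ (.var n) A
  | lam {Γ t A B} : A.Adm → HasType (A :: Γ) t B → HasType Γ (.lam A t) (.arr A B)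
  | app {Γ t u A B} : HasType Γ t (.arr A B) → HasType Γ u A → HasType Γ (.app t u) B
  | tlam {Γ t A} : (Ty.all A).Adm → HasType (shiftC 1 Γ) t A → HasType Γ (.tlam t) (.all A)
  | tapp {Γ t A B} : HasType Γ t (.all A) → B.Adm → HasType Γ (.tapp t B) (A.inst B)
  | pair {Γ t u A B} : HasType Γ t A → HasType Γ u B → HasType Γ (.pair t u) (.prod A B)
  | fst {Γ t A B} : HasType Γ t (.prod A B) → HasType Γ (.fst t) A
  | snd {Γ t A B} : HasType Γ t (.prod A B) → HasType Γ (.snd t) B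
  | star {Γ} : HasType Γ .star .one
  | inl {Γ t A B} : B.Adm → HasType Γ t A → HasType Γ (.inl B t) (.sum A B)
  | inr {Γ t A B} : A.Adm → HasType Γ t B → HasType Γ (.inr A t) (.sum A B)
  | case {Γ t u v A B C} : HasType Γ t (.sum A B) → HasType (A :: Γ) u C →
      HasType (B :: Γ) v C → HasType Γ (.case C t u v) C
  | abort {Γ t C} : C.Adm → HasType Γ t .zero → HasType Γ (.abort C t) C
  | inm {Γ t A} : (Ty.mu A).Adm → HasType Γ t (A.inst (.mu A)) → HasType Γ (.inm A t) (.mu A)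
  | foldm {Γ t A B} : (Ty.mu A).Adm → HasType Γ t (.arr (A.inst B) B) →
      HasType Γ (.foldm A t) (.arr (.mu A) B)
  | outn {Γ t A} : HasType Γ t (.nu A) → HasType Γ (.outn A t) (A.inst (.nu A))
  | unfoldn {Γ t A B} : (Ty.nu A).Adm → HasType Γ t (.arr B (A.inst B)) →
      HasType Γ (.unfoldn A t) (.arr B (.nu A))

/-! ### The `ε`-theory -/

/-- The judgement `Γ ⊢ t ≃ u : A` of the `ε`-theory of `Λ2p*_{μν}`: the least congruent equational
theory on well-typed terms closed under the `β`-, `η`- and `ε`-rules. -/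
inductive EpsEq : List Ty → Tm → Tm → Ty → Prop
  -- equivalence
  | refl {Γ t A} : HasType Γ t A → EpsEq Γ t t A
  | symm {Γ t u A} : EpsEq Γ t u A → EpsEq Γ u t A
  | trans {Γ t u v A} : EpsEq Γ t u A → EpsEq Γ u v A → EpsEq Γ t v A
  -- congruence
  | lam {Γ t t' A B} : A.Adm → EpsEq (A :: Γ) t t' B →
      EpsEq Γ (.lam A t) (.lam A t') (.arr A B)
  | app {Γ t t' u u' A B} : EpsEq Γ t t' (.arr A B) → EpsEq Γ u u' A →
      EpsEq Γ (.app t u) (.app t' u') B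
  | tlam {Γ t t' A} : (Ty.all A).Adm → EpsEq (shiftC 1 Γ) t t' A →
      EpsEq Γ (.tlam t) (.tlam t') (.all A)
  | tapp {Γ t t' A B} : EpsEq Γ t t' (.all A) → B.Adm →
      EpsEq Γ (.tapp t B) (.tapp t' B) (A.inst B)
  | pair {Γ t t' u u' A B} : EpsEq Γ t t' A → EpsEq Γ u u' B →
      EpsEq Γ (.pair t u) (.pair t' u') (.prod A B)
  | fst {Γ t t' A B} : EpsEq Γ t t' (.prod A B) → EpsEq Γ (.fst t) (.fst t') A
  | snd {Γ t t' A B} : EpsEq Γ t t' (.prod A B) → EpsEq Γ (.snd t) (.snd t') B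
  | inl {Γ t t' A B} : B.Adm → EpsEq Γ t t' A → EpsEq Γ (.inl B t) (.inl B t') (.sum A B)
  | inr {Γ t t' A B} : A.Adm → EpsEq Γ t t' B → EpsEq Γ (.inr A t) (.inr A t') (.sum A B)
  | case {Γ t t' u u' v v' A B C} : EpsEq Γ t t' (.sum A B) → EpsEq (A :: Γ) u u' C →
      EpsEq (B :: Γ) v v' C → EpsEq Γ (.case C t u v) (.case C t' u' v') C
  | abort {Γ t t' C} : C.Adm → EpsEq Γ t t' .zero → EpsEq Γ (.abort C t) (.abort C t') C
  | inm {Γ t t' A} : (Ty.mu A).Adm → EpsEq Γ t t' (A.inst (.mu A)) →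
      EpsEq Γ (.inm A t) (.inm A t') (.mu A)
  | foldm {Γ t t' A B} : (Ty.mu A).Adm → EpsEq Γ t t' (.arr (A.inst B) B) →
      EpsEq Γ (.foldm A t) (.foldm A t') (.arr (.mu A) B)
  | outn {Γ t t' A} : EpsEq Γ t t' (.nu A) → EpsEq Γ (.outn A t) (.outn A t') (A.inst (.nu A))
  | unfoldn {Γ t t' A B} : (Ty.nu A).Adm → EpsEq Γ t t' (.arr B (A.inst B)) →
      EpsEq Γ (.unfoldn A t) (.unfoldn A t') (.arr B (.nu A))
  -- β-rules
  | beta {Γ t u A B} : HasType (A :: Γ) t B → HasType Γ u A →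
      EpsEq Γ (.app (.lam A t) u) (t.plug 0 u) B
  | tbeta {Γ t A B} : HasType Γ (.tlam t) (.all A) → B.Adm →
      EpsEq Γ (.tapp (.tlam t) B) (t.tinst B) (A.inst B)
  | fst_beta {Γ t u A B} : HasType Γ t A → HasType Γ u B → EpsEq Γ (.fst (.pair t u)) t A
  | snd_beta {Γ t u A B} : HasType Γ t A → HasType Γ u B → EpsEq Γ (.snd (.pair t u)) u B
  | inl_beta {Γ t u v A B C} : B.Adm → HasType Γ t A → HasType (A :: Γ) u C →
      HasType (B :: Γ) v C → EpsEq Γ (.case C (.inl B t) u v) (u.plug 0 t) C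
  | inr_beta {Γ t u v A B C} : A.Adm → HasType Γ t B → HasType (A :: Γ) u C →
      HasType (B :: Γ) v C → EpsEq Γ (.case C (.inr A t) u v) (v.plug 0 t) C
  | mu_beta {Γ t u A B} : (Ty.mu A).Adm → HasType Γ t (.arr (A.inst B) B) →
      HasType Γ u (A.inst (.mu A)) →
      EpsEq Γ (.app (.foldm A t) (.inm A u))
        (.app t ((act A 0 (.mu A) B (.app ((foldm A t).shift 1) (.var 0))).plug 0 u)) B
  | nu_beta {Γ t u A B} : (Ty.nu A).Adm → HasType Γ t (.arr B (A.inst B)) → HasType Γ u B →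
      EpsEq Γ (.outn A (.app (.unfoldn A t) u))
        ((act A 0 B (.nu A) (.app ((unfoldn A t).shift 1) (.var 0))).plug 0 (.app t u))
        (A.inst (.nu A))
  -- η-rules
  | eta {Γ t A B} : HasType Γ t (.arr A B) →
      EpsEq Γ t (.lam A (.app (t.shift 1) (.var 0))) (.arr A B)
  | teta {Γ t A} : HasType Γ t (.all A) →
      EpsEq Γ t (.tlam (.tapp (t.tshift 1) (.var 0))) (.all A)
  | prod_eta {Γ t A B} : HasType Γ t (.prod A B) →
      EpsEq Γ t (.pair (.fst t) (.snd t)) (.prod A B)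
  | one_eta {Γ t} : HasType Γ t .one → EpsEq Γ t .star .one
  | sum_eta {Γ t u A B C} : HasType Γ t (.sum A B) → HasType (Ty.sum A B :: Γ) u C →
      EpsEq Γ (u.plug 0 t)
        (.case C t (u.plug 1 (.inl B (.var 0))) (u.plug 1 (.inr A (.var 0)))) C
  | zero_eta {Γ t u A} : HasType Γ t .zero → HasType (Ty.zero :: Γ) u A →
      EpsEq Γ (u.plug 0 t) (.abort A t) A
  | mu_eta {Γ t u A C} : (Ty.mu A).Adm → HasType Γ u (.arr (A.inst C) C) →
      HasType (Ty.mu A :: Γ) t C →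
      EpsEq (A.inst (.mu A) :: Γ) (t.plug 1 (.inm A (.var 0)))
        (.app (u.shift 1) (act A 0 (.mu A) C t)) C →
      EpsEq (Ty.mu A :: Γ) t (.app ((foldm A u).shift 1) (.var 0)) C
  | nu_eta {Γ t u A C} : HasType Γ u (.arr C (A.inst C)) → HasType (C :: Γ) t (.nu A) →
      EpsEq (C :: Γ) ((act A 0 C (.nu A) t).plug 1 (.app (u.shift 1) (.var 0)))
        (.outn A t) (A.inst (.nu A)) →
      EpsEq (C :: Γ) t (.app ((unfoldn A u).shift 1) (.var 0)) (.nu A)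
  -- the ε-rule of `∀X. ⟨∀Y⃗ₖ. ⟨Aⱼₖ⟩ⱼ ⇒ X⟩ₖ ⇒ B`:
  -- from `v[eₖ Y⃗ₖ ⟨zⱼ⟩ⱼ] ≃ fₖ Y⃗ₖ ⟨Φ_{Aⱼₖ}(v)[zⱼ]⟩ⱼ` for all `k`
  -- (in context `Γ, ⟨zⱼ : Aⱼₖ[E]⟩ⱼ`, with `Y⃗ₖ` fresh)
  -- infer `Φ_B(v)[t E ⟨eₖ⟩ₖ] ≃ t F ⟨fₖ⟩ₖ`
  | epsL {Γ} (Ps : List (ℕ × List Ty)) (B E F : Ty) (t v : Tm) (e f : Fin Ps.length → Tm) :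
      SignL Ps B → E.Adm → F.Adm →
      HasType Γ t (univL Ps B) → HasType (E :: Γ) v F →
      (∀ k, HasType Γ (e k) ((premL (Ps.get k)).inst E)) →
      (∀ k, HasType Γ (f k) ((premL (Ps.get k)).inst F)) →
      (∀ k, let m := (Ps.get k).1
        let As := (Ps.get k).2
        let J := As.length
        EpsEq ((As.map fun A => A.subst (single m E)).reverse ++ shiftC m Γ)
          ((v.tshift m).plug J (apps (tappVars (((e k).tshift m).shift J) m) (vars J)))
          (apps (tappVars (((f k).tshift m).shift J) m)
            (List.zipWith (fun A z => (act A m E F v).plug J z) As (vars J)))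
          (F.shift m)) →
      EpsEq Γ ((act B 0 E F v).plug 0 (apps (.tapp t E) (List.ofFn e)))
        (apps (.tapp t F) (List.ofFn f)) (B.inst F)
  -- the ε-rule of `∀X. ⟨∀Y⃗ⱼ. X ⇒ Aⱼ⟩ⱼ ⇒ B`:
  -- from `Φ_{Aⱼ}(v)[eⱼ Y⃗ⱼ x] ≃ fⱼ Y⃗ⱼ v[x]` for all `j` (in context `Γ, x : E`, with `Y⃗ⱼ` fresh)
  -- infer `Φ_B(v)[t F ⟨fⱼ⟩ⱼ] ≃ t E ⟨eⱼ⟩ⱼ`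
  | epsR {Γ} (Qs : List (ℕ × Ty)) (B E F : Ty) (t v : Tm) (e f : Fin Qs.length → Tm) :
      SignR Qs B → E.Adm → F.Adm →
      HasType Γ t (univR Qs B) → HasType (E :: Γ) v F →
      (∀ j, HasType Γ (e j) ((premR (Qs.get j)).inst E)) →
      (∀ j, HasType Γ (f j) ((premR (Qs.get j)).inst F)) →
      (∀ j, let m := (Qs.get j).1
        let A := (Qs.get j).2
        EpsEq (E.shift m :: shiftC m Γ)
          ((act A m E F v).plug 1 (.app (tappVars (((e j).tshift m).shift 1) m) (.var 0)))
          (.app (tappVars (((f j).tshift m).shift 1) m) (v.tshift m))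
          (A.subst (single m F))) →
      EpsEq Γ ((act B 0 F E v).plug 0 (apps (.tapp t F) (List.ofFn f)))
        (apps (.tapp t E) (List.ofFn e)) (B.inst E)

/-- `s[x] : A ⊢ B` and `t[x] : B ⊢ A` are mutually inverse up to the `ε`-theory. -/
structure IsEpsIso (A B : Ty) (s t : Tm) : Prop where
  s_type : HasType [A] s B
  t_type : HasType [B] t A
  s_t : EpsEq [B] (s.plug 1 t) (.var 0) B
  t_s : EpsEq [A] (t.plug 1 s) (.var 0) A

/-! ### The schema `≡_{X+}` -/

/-- `T⟨X⟩ = ∑ₖ ∃Y⃗ₖ. ∏ⱼ Aⱼₖ`, in a context ending with `X`; the list of its summands. -/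
def summands (Ps : List (ℕ × List Ty)) : List Ty := Ps.map fun p => ex p.1 (prodN p.2)

def tyT (Ps : List (ℕ × List Ty)) : Ty := sumN (summands Ps)

/-- `X` occurs in some of the `Aⱼₖ`. -/
def occL (Ps : List (ℕ × List Ty)) : Bool := Ps.any fun p => p.2.any fun A => occ p.1 A

/-- `α = {μX.} T⟨X⟩`: the binder `μX.` is there only if `X` occurs in some of the `Aⱼₖ`. Otherwise
`α` is `T`, in which the variable `X`, which does not occur, has to be removed from the context (by
the substitution of an arbitrary type for it). -/
def alpha (Ps : List (ℕ × List Ty)) : Ty :=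
  if occL Ps then .mu (tyT Ps) else (tyT Ps).inst .one

/-- `pack[Y₁, …, Yₘ](t) = ΛZ. λf. f Y₁ … Yₘ t : ∃Y₁ … Yₘ. A`, where `t : A` and the witnesses are the
last `m` type variables of the context; `P` is `A` with its variables `Y₁, …, Yₘ` bound apart. -/
def pack (m : ℕ) (P : Ty) (t : Tm) : Tm :=
  .tlam (.lam (exPrem m P)
    (.app (((List.range m).reverse.map fun i => Ty.var (i + 1)).foldl .tapp (.var 0))
      ((t.tshift 1).shift 1)))

/-- `âₖ = ΛY⃗ₖ. λ⟨zⱼ⟩ⱼ. in_T (inₖ (pack[Y⃗ₖ] ⟨zⱼ⟩ⱼ)) : ∀Y⃗ₖ. ⟨Aⱼₖ[α/X]⟩ⱼ ⇒ α`, without `in_T` if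
`α` is without `μX.` -/
def aHat (Ps : List (ℕ × List Ty)) (k : Fin Ps.length) : Tm :=
  let m := (Ps.get k).1
  let As := (Ps.get k).2
  let P := ((prodN As).subst (single m (alpha Ps))).rename (upr^[m] (fun n => n + m))
  let a := inj ((summands Ps).map fun S => (S.inst (alpha Ps)).shift m) k
    (pack m P (tuple (vars As.length)))
  tlamN m (lams (As.map fun A => A.subst (single m (alpha Ps)))
    (if occL Ps then .inm ((tyT Ps).rename (upr fun n => n + m)) a else a))

/-- `s[x] = x α ⟨âₖ⟩ₖ`. -/
def sTerm (Ps : List (ℕ × List Ty)) : Tm :=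
  apps (.tapp (.var 0) (alpha Ps)) (List.ofFn (aHat Ps))

/-- `λx. b[x, X] : T⟨X⟩ ⇒ X` in context `Γ, ⟨fₖ : ∀Y⃗ₖ. ⟨Aⱼₖ⟩ⱼ ⇒ X⟩ₖ` followed by one more variable,
with `b[x, X] = δ(x, ⟨z. z X (ΛY⃗ₖ. λy. fₖ Y⃗ₖ ⟨πⱼ y⟩ⱼ)⟩ₖ)`. -/
def bTerm (Ps : List (ℕ × List Ty)) : Tm :=
  .lam (tyT Ps) (caseN (.var 0) (List.ofFn fun k : Fin Ps.length =>
    let m := (Ps.get k).1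
    let As := (Ps.get k).2
    .app (.tapp (.var 0) (.var 0))
      (tlamN m (.lam (prodN As)
        (apps (tappVars (.var (Ps.length - 1 - k + 4)) m)
          ((List.range As.length).map fun j => proj As.length j (.var 0)))))) 0 (.var 0))

/-- `t[x] = ΛX. λ⟨fₖ⟩ₖ. Φ^X_B(fold_T(λx. b[x, X]) x)`, with `λx. b[x, X]` in place of
`fold_T(λx. b[x, X])` if `α` is without `μX.` -/
def tTerm (Ps : List (ℕ × List Ty)) (B : Ty) : Tm :=
  let v := Tm.app
    (if occL Ps then .foldm ((tyT Ps).rename (upr Nat.succ)) (bTerm Ps) else bTerm Ps) (.var 0)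
  .tlam (lams (Ps.map premL)
    ((fmap B 0 (Ty.scons ((alpha Ps).shift 1) fun n => .var (n + 1)) Ty.var v).plug 0
      (.var Ps.length)))

/-! ### The schema `≡_{X-}` -/

/-- `X` occurs in some of the `Aⱼ`. -/
def occR (Qs : List (ℕ × Ty)) : Bool := Qs.any fun q => occ q.1 q.2

/-- `β = {νX.} U⟨X⟩`: the binder `νX.` is there only if `X` occurs in some of the `Aⱼ`. -/
def beta (Qs : List (ℕ × Ty)) (U : Ty) : Ty := if occR Qs then .nu U else U.inst .one

/-- `out_U x` for `x : β`, under `m` more type variables; it is `x` if `β` is without `νX.` -/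
def outB (Qs : List (ℕ × Ty)) (U : Ty) (m : ℕ) (x : Tm) : Tm :=
  if occR Qs then .outn (U.rename (upr fun n => n + m)) x else x

/-- `u[x] = x β ⟨ĉⱼ⟩ⱼ`. -/
def uTerm (Qs : List (ℕ × Ty)) (U : Ty) (cHat : Fin Qs.length → Tm) : Tm :=
  apps (.tapp (.var 0) (beta Qs U)) (List.ofFn cHat)

/-- `v[x] = ΛX. λ⟨fⱼ⟩ⱼ. Φ^X_B(unfold_U(d) x)`, with `d` in place of `unfold_U(d)` if `β` is without
`νX.`; here `d : X ⇒ U⟨X⟩` in context `Γ, ⟨fⱼ : ∀Y⃗ⱼ. X ⇒ Aⱼ⟩ⱼ` followed by one more variable. -/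
def vTerm (Qs : List (ℕ × Ty)) (U : Ty) (d : Tm) (B : Ty) : Tm :=
  let v := Tm.app (if occR Qs then .unfoldn (U.rename (upr Nat.succ)) d else d) (.var 0)
  .tlam (lams (Qs.map premR)
    ((fmap B 0 (Ty.scons ((beta Qs U).shift 1) fun n => .var (n + 1)) Ty.var v).plug 0
      (.var Qs.length)))

/-- `U⟨X⟩ = ∏ⱼ ∀Y⃗ⱼ. Aⱼ`, each `Aⱼ` under its own quantifiers. -/
def tyU (Qs : List (ℕ × Ty)) : Ty := prodN (Qs.map fun q => allN q.1 q.2)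

/-- `ĉⱼ = ΛY⃗ⱼ. λx. (πⱼ (out_U x)) Y⃗ⱼ : ∀Y⃗ⱼ. β ⇒ Aⱼ[β/X]`. -/
def cHat (Qs : List (ℕ × Ty)) (j : Fin Qs.length) : Tm :=
  let m := (Qs.get j).1
  tlamN m (.lam ((beta Qs (tyU Qs)).shift m)
    (tappVars (proj Qs.length j (outB Qs (tyU Qs) m (.var 0))) m))

/-- `d = λz. ⟨ΛY⃗ⱼ. fⱼ Y⃗ⱼ z⟩ⱼ : X ⇒ U⟨X⟩`. -/
def dTerm (Qs : List (ℕ × Ty)) : Tm :=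
  .lam (.var 0) (tuple (List.ofFn fun j : Fin Qs.length =>
    tlamN (Qs.get j).1
      (.app (tappVars (.var (Qs.length - 1 - j + 2)) (Qs.get j).1) (.var 0))))

/-- The list of pairs `(m, Aⱼ)`, for types `Aⱼ` under common quantifiers `∀Y₁ … Yₘ`. -/
def common (m : ℕ) (As : List Ty) : List (ℕ × Ty) := As.map fun A => (m, A)

/-- `U⟨X⟩ = ∀Y₁ … Yₘ. ∏ⱼ Aⱼ`, the `Aⱼ` under common quantifiers. -/
def tyUc (m : ℕ) (As : List Ty) : Ty := allN m (prodN As)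

/-- `ĉⱼ = ΛY⃗. λx. πⱼ ((out_U x) Y⃗) : ∀Y⃗. β ⇒ Aⱼ[β/X]`. -/
def cHatc (m : ℕ) (As : List Ty) (j : Fin (common m As).length) : Tm :=
  tlamN m (.lam ((beta (common m As) (tyUc m As)).shift m)
    (proj As.length j (tappVars (outB (common m As) (tyUc m As) m (.var 0)) m)))

/-- `d = λz. ΛY⃗. ⟨fⱼ Y⃗ z⟩ⱼ : X ⇒ U⟨X⟩`. -/
def dTermc (m : ℕ) (As : List Ty) : Tm :=
  .lam (.var 0) (tlamN m (tuple (List.ofFn fun j : Fin As.length =>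
    .app (tappVars (.var (As.length - 1 - j + 2)) m) (.var 0))))

end Yoneda

namespace Yoneda

/-! Both schemas are instances of the Yoneda lemma. The premises `∀Y⃗ₖ. ⟨Aⱼₖ⟩ⱼ ⇒ X` amount to one
algebra `T⟨X⟩ ⇒ X`, and the ε-rule says that an inhabitant of the universal type is a family natural
along algebra homomorphisms. Such a family is determined by its value at the initial algebra `α`
with the constructors `âₖ`, because `fold_T(λx. b[x])` is a homomorphism from `α` to any given
algebra. Dually, the premises `∀Y⃗ⱼ. X ⇒ Aⱼ` amount to one coalgebra `X ⇒ U⟨X⟩`; as `B` is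
contravariant, the value at the terminal coalgebra `β` is carried to every other coalgebra by
`unfold_U(d)`. If `X` does not occur in the premises, the functor is constant and is its own
fixpoint.

`isEpsIso_of` isolates what has to be checked in both schemas. In one composite, β-reduction leaves
`Φ_B(v[α, e⃗]) x`, so `v[α, e⃗]` has to be the identity and `Φ_B` has to preserve identities. In the
other composite, after η-expansion, the equation needed is `Φ_B(v)[x α e⃗] ≃ x X f⃗`. This is the
conclusion of an ε-rule, whose premise says that `v` is a homomorphism.

The identity law `fmap_id` is proved by induction on the type. At a fixpoint the uniqueness rule
speaks of the body with its parameters already substituted, and this body acts on the parameter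
types in a variable which they do not contain. So the identity law is needed for weakened types of
arbitrary size, which the induction cannot supply. `fmap_shift_one` obtains it from polymorphism:
`fold_Z(λx.x)(in_Z z) ≃ z` holds for a type variable `Z`, hence, by generalising and instantiating
`Z`, for every type `D`; but the computation rule identifies the same term with the action of the
constant functor `D`. `fmap_subst_ty` compares the action of a substituted type with that of the
original type and carries the law over, giving `fmap_of_occ_false` and then `fmap_id`.

The existential quantifier is only encoded, but its encoding has the form (a), so that the ε-rule
yields its uniqueness principle `ex_eta`. Together with uniqueness of case distinction (`caseN_eta`)
and surjectivity of tuples (`tuple_proj`) it shows that `b` at the constructors is `in_T`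
(`elimTm_aHat`), so its fold is the identity (`foldVar_aHat`). That the fold is a homomorphism
(`ElimData.comm`) follows from the computation rule `ElimData.foldTm_inTm`: the action passes
through injections, packages and tuples down to the `Aⱼₖ`.

For the second schema, the forms `∏ⱼ ∀Y⃗ⱼ. Aⱼ` and `∀Y⃗. ∏ⱼ Aⱼ` of `U` enter only through
`Selectors`: natural, jointly monic maps `U⟨X⟩ → Aⱼ` with a tupling operation. Joint monicity gives
the identity (`Selectors.unfoldVar_cTm`), naturality gives the homomorphism property
(`Selectors.act_unfoldVar`). -/

theorem iter_upr_lt (ρ : ℕ → ℕ) {m n : ℕ} (h : n < m) : upr^[m] ρ n = n := by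
  induction m generalizing n with
  | zero => omega
  | succ m ih =>
    rw [Function.iterate_succ_apply']
    cases n with
    | zero => rfl
    | succ n => simp only [upr]; rw [ih (by omega)]

theorem iter_upr_add (ρ : ℕ → ℕ) (m n : ℕ) : upr^[m] ρ (n + m) = ρ n + m := by
  induction m with
  | zero => rfl
  | succ m ih => rw [Function.iterate_succ_apply', ← add_assoc]; simp only [upr]; rw [ih]; rfl

namespace Ty

/-! ### Substitution of types -/

theorem up_var : up var = var := by
  funext n; cases n <;> rfl

theorem up_ren (ρ : ℕ → ℕ) : up (fun n => var (ρ n)) = fun n => var (upr ρ n) := by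
  funext n; cases n <;> rfl

theorem rename_eq_subst (A : Ty) (ρ : ℕ → ℕ) : A.rename ρ = A.subst (fun n => var (ρ n)) := by
  induction A generalizing ρ <;> simp_all [rename, subst, up_ren]

theorem subst_var (A : Ty) : A.subst var = A := by
  induction A <;> simp_all [subst, up_var]

theorem up_comp_upr (σ : ℕ → Ty) (ρ : ℕ → ℕ) :
    (fun n => up σ (upr ρ n)) = up (fun n => σ (ρ n)) := by
  funext n; cases n <;> rfl

theorem rename_subst (A : Ty) (ρ : ℕ → ℕ) (σ : ℕ → Ty) :
    (A.rename ρ).subst σ = A.subst (fun n => σ (ρ n)) := by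
  induction A generalizing ρ σ <;> simp_all [rename, subst, up_comp_upr]

theorem rename_rename (A : Ty) (ρ ρ' : ℕ → ℕ) :
    (A.rename ρ).rename ρ' = A.rename (fun n => ρ' (ρ n)) := by
  rw [rename_eq_subst (A.rename ρ), rename_subst, rename_eq_subst]

theorem up_rename (σ : ℕ → Ty) (ρ : ℕ → ℕ) :
    (fun n => (up σ n).rename (upr ρ)) = up (fun n => (σ n).rename ρ) := by
  funext n
  cases n with
  | zero => rfl
  | succ n => simp [up, scons, shift, rename_rename, upr]

theorem subst_rename (A : Ty) (σ : ℕ → Ty) (ρ : ℕ → ℕ) :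
    (A.subst σ).rename ρ = A.subst (fun n => (σ n).rename ρ) := by
  induction A generalizing ρ σ <;> simp_all [rename, subst, up_rename]

theorem up_comp (σ τ : ℕ → Ty) :
    (fun n => (up σ n).subst (up τ)) = up (fun n => (σ n).subst τ) := by
  funext n
  cases n with
  | zero => rfl
  | succ n => simp [up, scons, shift, rename_subst, subst_rename]

theorem subst_subst (A : Ty) (σ τ : ℕ → Ty) :
    (A.subst σ).subst τ = A.subst (fun n => (σ n).subst τ) := by
  induction A generalizing σ τ <;> simp_all [subst, up_comp]

theorem shift_zero (A : Ty) : A.shift 0 = A := by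
  rw [shift, rename_eq_subst]; exact subst_var A

theorem shift_shift (A : Ty) (m n : ℕ) : (A.shift m).shift n = A.shift (m + n) := by
  simp only [shift, rename_rename, add_assoc]

theorem shift_subst (A : Ty) (m : ℕ) (σ : ℕ → Ty) :
    (A.shift m).subst σ = A.subst (fun n => σ (n + m)) := rename_subst A _ σ

theorem shift_scons (A B : Ty) (σ : ℕ → Ty) : (A.shift 1).subst (scons B σ) = A.subst σ :=
  rename_subst A _ _

theorem up_scons (σ τ : ℕ → Ty) (B : Ty) :
    (fun n => (up σ n).subst (scons B τ)) = scons B (fun n => (σ n).subst τ) := by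
  funext n
  cases n with
  | zero => rfl
  | succ n => simp only [up, scons, shift_scons]

theorem scons_comp (σ τ : ℕ → Ty) (B : Ty) :
    (fun n => (scons B σ n).subst τ) = scons (B.subst τ) (fun n => (σ n).subst τ) := by
  funext n; cases n <;> rfl

theorem subst_up_scons (A B : Ty) (σ τ : ℕ → Ty) :
    (A.subst (up σ)).subst (scons B τ) = A.subst (scons B (fun n => (σ n).subst τ)) := by
  rw [subst_subst, up_scons]

theorem subst_up_inst (A B : Ty) (σ : ℕ → Ty) :
    (A.subst (up σ)).inst B = A.subst (scons B σ) := by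
  simp only [inst, single, Function.iterate_zero, id, subst_up_scons, subst_var]

theorem inst_eq (A B : Ty) : A.inst B = A.subst (scons B var) := rfl

theorem inst_subst (A B : Ty) (σ : ℕ → Ty) :
    (A.inst B).subst σ = (A.subst (up σ)).inst (B.subst σ) := by
  rw [subst_up_inst, inst_eq, subst_subst, scons_comp]; rfl

theorem shift_subst_up (A : Ty) (σ : ℕ → Ty) : (A.shift 1).subst (up σ) = (A.subst σ).shift 1 := by
  simp [shift, rename_subst, subst_rename, up, scons]

theorem shift_inst (A B : Ty) : (A.shift 1).inst B = A := by
  rw [inst_eq, shift_scons, subst_var]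

theorem iter_up_lt (σ : ℕ → Ty) {m n : ℕ} (h : n < m) : up^[m] σ n = var n := by
  induction m generalizing n with
  | zero => omega
  | succ m ih =>
    rw [Function.iterate_succ_apply']
    cases n with
    | zero => rfl
    | succ n => simp only [up, scons] at ih ⊢; rw [ih (by omega)]; rfl

theorem iter_up_add (σ : ℕ → Ty) (m n : ℕ) : up^[m] σ (n + m) = (σ n).shift m := by
  induction m with
  | zero => simp [shift_zero]
  | succ m ih =>
    rw [Function.iterate_succ_apply', ← add_assoc]; simp only [up, scons] at ih ⊢
    rw [ih, shift_shift]

theorem iter_up_self (σ : ℕ → Ty) (m : ℕ) : up^[m] σ m = (σ 0).shift m := by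
  simpa using iter_up_add σ m 0

theorem iter_up_ren (ρ : ℕ → ℕ) (m : ℕ) :
    up^[m] (fun n => var (ρ n)) = fun n => var (upr^[m] ρ n) := by
  induction m with
  | zero => rfl
  | succ m ih => rw [Function.iterate_succ_apply', ih, up_ren, Function.iterate_succ_apply']

theorem iter_up_comp (σ τ : ℕ → Ty) (m : ℕ) :
    (fun n => (up^[m] σ n).subst (up^[m] τ)) = up^[m] (fun n => (σ n).subst τ) := by
  induction m with
  | zero => rfl
  | succ m ih => simp only [Function.iterate_succ_apply', up_comp, ih]

theorem iter_up_comp_upr (σ : ℕ → Ty) (ρ : ℕ → ℕ) (m : ℕ) :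
    (fun n => up^[m] σ (upr^[m] ρ n)) = up^[m] (fun n => σ (ρ n)) := by
  induction m with
  | zero => rfl
  | succ m ih => simp only [Function.iterate_succ_apply', up_comp_upr, ih]

theorem iter_up_var (m : ℕ) : up^[m] var = var := by
  induction m with
  | zero => rfl
  | succ m ih => rw [Function.iterate_succ_apply', ih, up_var]

/-- The substitution of a list of types for the last variables of the context. -/
def sconsL (Cs : List Ty) (σ : ℕ → Ty) : ℕ → Ty := Cs.foldl (fun σ C => scons C σ) σ

/-- The variables opened by the lifting are exactly those that the list fills, so the lifting
disappears. This links the presentation by `up` and `single` with the one by lists of arguments. -/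
theorem iter_up_sconsL (Cs : List Ty) (σ τ : ℕ → Ty) :
    (fun n => (up^[Cs.length] σ n).subst (sconsL Cs τ)) = sconsL Cs (fun n => (σ n).subst τ) := by
  induction Cs generalizing σ τ with
  | nil => rfl
  | cons C Cs ih =>
    simp only [List.length_cons, Function.iterate_succ_apply, sconsL, List.foldl_cons] at ih ⊢
    rw [ih, up_scons]

theorem sconsL_add (Cs : List Ty) (σ : ℕ → Ty) (n : ℕ) : sconsL Cs σ (n + Cs.length) = σ n := by
  induction Cs generalizing σ n with
  | nil => rfl
  | cons C Cs ih =>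
    simp only [List.length_cons, sconsL, List.foldl_cons] at ih ⊢
    rw [show n + (Cs.length + 1) = (n + 1) + Cs.length by omega, ih]; rfl

theorem sconsL_comp (Cs : List Ty) (σ τ : ℕ → Ty) :
    (fun n => (sconsL Cs σ n).subst τ) =
      sconsL (Cs.map fun C => C.subst τ) (fun n => (σ n).subst τ) := by
  induction Cs generalizing σ with
  | nil => rfl
  | cons C Cs ih => simp only [sconsL, List.foldl_cons, List.map_cons] at ih ⊢; rw [ih, scons_comp]

/-- The last `m` type variables of the context, the first one first. -/
def tvars (m : ℕ) : List Ty := (List.range m).reverse.map var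

theorem tvars_succ (m : ℕ) : tvars (m + 1) = var m :: tvars m := by
  simp [tvars, List.range_succ]

theorem length_tvars (m : ℕ) : (tvars m).length = m := by simp [tvars]

theorem sconsL_tvars (m : ℕ) (σ : ℕ → Ty) (n : ℕ) :
    sconsL (tvars m) σ n = if n < m then var n else σ (n - m) := by
  induction m generalizing σ n with
  | zero => rfl
  | succ m ih =>
    rw [tvars_succ]; simp only [sconsL, List.foldl_cons] at ih ⊢
    rw [ih]
    rcases lt_trichotomy n m with h | h | h
    · rw [if_pos h, if_pos (by omega)]
    · subst h; simp [scons]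
    · rw [if_neg (by omega), if_neg (by omega)]
      obtain ⟨k, rfl⟩ : ∃ k, n = m + 1 + k := ⟨n - (m + 1), by omega⟩
      rw [show m + 1 + k - m = k + 1 by omega, show m + 1 + k - (m + 1) = k by omega]; rfl

/-- Weakening past `Y⃗` leaves the bound copies of `Y⃗` in place, and these are filled with the free
ones. Hence applying a weakened term of type `∀Y⃗. A` to `Y⃗` returns the type `A` unchanged. -/
theorem sconsL_tvars_shift (m : ℕ) : sconsL (tvars m) (fun n => var (n + m)) = var := by
  funext n; rw [sconsL_tvars]
  split
  · rfl
  · congr 1; omega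

theorem single_lt (E : Ty) {m n : ℕ} (h : n < m) : single m E n = var n := iter_up_lt _ h

theorem single_self (E : Ty) (m : ℕ) : single m E m = E.shift m := iter_up_self _ m

theorem single_gt (E : Ty) {m n : ℕ} (h : m < n) : single m E n = var (n - 1) := by
  obtain ⟨k, rfl⟩ : ∃ k, n = (k + 1) + m := ⟨n - m - 1, by omega⟩
  rw [single, iter_up_add]; simp only [scons, shift, rename]; congr 1; omega

theorem single_zero (E : Ty) : single 0 E = scons E var := rfl

theorem single_ne (E F : Ty) {m n : ℕ} (h : n ≠ m) : single m E n = single m F n := by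
  rcases lt_or_gt_of_ne h with h | h
  · rw [single_lt _ h, single_lt _ h]
  · rw [single_gt _ h, single_gt _ h]

theorem single_sconsL (E : Ty) (Cs : List Ty) (σ : ℕ → Ty) :
    (fun n => (single Cs.length E n).subst (sconsL Cs σ)) = sconsL Cs (scons (E.subst σ) σ) := by
  rw [single, iter_up_sconsL, scons_comp]; rfl

theorem single_comp_iter_up (E : Ty) (m : ℕ) (σ : ℕ → Ty) :
    (fun n => (single m E n).subst (up^[m] σ)) = up^[m] (scons (E.subst σ) σ) := by
  rw [single, iter_up_comp, scons_comp]; rfl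

/-- The exponent is `m + 1` because a premise lives under `X` as well as under its `m` quantifiers;
instantiating `X` afterwards amounts to putting `E` at the head of `σ`. -/
theorem iter_up_succ_single (E : Ty) (m : ℕ) (σ : ℕ → Ty) :
    (fun n => (up^[m + 1] σ n).subst (single m E)) = up^[m] (scons E σ) := by
  rw [single, Function.iterate_succ_apply, iter_up_comp, up_scons]; simp only [subst_var]

/-! ### Occurrences and signs -/

theorem subst_congr {A : Ty} {σ τ : ℕ → Ty} (h : ∀ n, occ n A = true → σ n = τ n) :
    A.subst σ = A.subst τ := by
  induction A generalizing σ τ with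
  | var n => exact h n (by simp [occ])
  | one => rfl
  | zero => rfl
  | arr A B ihA ihB | prod A B ihA ihB | sum A B ihA ihB =>
    simp only [subst]
    rw [ihA fun n hn => h n (by simp [occ, hn]), ihB fun n hn => h n (by simp [occ, hn])]
  | all A ih | mu A ih | nu A ih =>
    simp only [subst]; rw [ih]
    rintro (_ | n) hn
    · rfl
    · simp only [up, scons]; rw [h n (by simpa [occ] using hn)]

theorem OnlySign.of_occ_false {b : Bool} {i : ℕ} {A : Ty} (h : occ i A = false) :
    OnlySign b i A := by
  induction A generalizing b i with
  | var n => intro hn; simp [occ, hn] at h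
  | one => trivial
  | zero => trivial
  | arr A B ihA ihB | prod A B ihA ihB | sum A B ihA ihB =>
    simp only [occ, Bool.or_eq_false_iff] at h
    exact ⟨ihA h.1, ihB h.2⟩
  | all A ih | mu A ih | nu A ih => exact ih h

theorem occ_rename {A : Ty} {i j : ℕ} {ρ : ℕ → ℕ} (h : ∀ n, ρ n = j ↔ n = i) :
    occ j (A.rename ρ) = occ i A := by
  induction A generalizing i j ρ with
  | var n => simp [rename, occ, h]
  | one => rfl
  | zero => rfl
  | arr A B ihA ihB | prod A B ihA ihB | sum A B ihA ihB =>
    simp only [rename, occ]; rw [ihA h, ihB h]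
  | all A ih | mu A ih | nu A ih =>
    simp only [rename, occ]; apply ih
    rintro (_ | n) <;> simp [upr, h]

theorem occ_rename_false {A : Ty} {j : ℕ} {ρ : ℕ → ℕ} (h : ∀ n, ρ n ≠ j) :
    occ j (A.rename ρ) = false := by
  induction A generalizing j ρ with
  | var n => simp [rename, occ, h]
  | one => rfl
  | zero => rfl
  | arr A B ihA ihB | prod A B ihA ihB | sum A B ihA ihB =>
    simp only [rename, occ]; rw [ihA h, ihB h]; rfl
  | all A ih | mu A ih | nu A ih =>
    simp only [rename, occ]; apply ih
    rintro (_ | n) <;> simp [upr, h]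

theorem occ_shift_one (A : Ty) : occ 0 (A.shift 1) = false := occ_rename_false (by simp)

theorem occ_shift_succ (A : Ty) (j : ℕ) : occ (j + 1) (A.shift 1) = occ j A :=
  occ_rename (by simp)

theorem occ_subst {A : Ty} {i j : ℕ} {σ : ℕ → Ty} (h : ∀ n, occ j (σ n) = (n == i)) :
    occ j (A.subst σ) = occ i A := by
  induction A generalizing i j σ with
  | var n => simp [subst, occ, h]
  | one => rfl
  | zero => rfl
  | arr A B ihA ihB | prod A B ihA ihB | sum A B ihA ihB =>
    simp only [subst, occ]; rw [ihA h, ihB h]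
  | all A ih | mu A ih | nu A ih =>
    simp only [subst, occ]; apply ih
    rintro (_ | n)
    · simp [up, scons, occ]
    · simp only [up, scons, occ_shift_succ, h]; simp

theorem OnlySign.subst {b : Bool} {A : Ty} {i j : ℕ} {σ : ℕ → Ty} (hA : OnlySign b i A)
    (hi : σ i = var j) (h : ∀ n, n ≠ i → occ j (σ n) = false) : OnlySign b j (A.subst σ) := by
  induction A generalizing b i j σ with
  | var n =>
    by_cases hn : n = i
    · subst hn; simp only [Ty.subst, hi]; intro; exact hA rfl
    · exact of_occ_false (h n hn)
  | one => trivial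
  | zero => trivial
  | arr A B ihA ihB | prod A B ihA ihB | sum A B ihA ihB =>
    exact ⟨ihA hA.1 hi h, ihB hA.2 hi h⟩
  | all A ih | mu A ih | nu A ih =>
    refine ih (i := i + 1) hA (by simp [up, scons, hi, shift, rename]) ?_
    rintro (_ | n) hn
    · simp [up, scons, occ]
    · simp only [up, scons, occ_shift_succ]; exact h n (by omega)

theorem OnlySign.rename {b : Bool} {A : Ty} {i j : ℕ} {ρ : ℕ → ℕ} (hA : OnlySign b i A)
    (h : ∀ n, ρ n = j ↔ n = i) : OnlySign b j (A.rename ρ) := by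
  rw [rename_eq_subst]
  exact hA.subst (by rw [(h i).2 rfl]) fun n hn => by simp [occ, h, hn]

/-- The values of `σ` are shifted past all `m + 1` binders and cannot mention the variable `m`; only
that variable itself does. This is why signs of a bound variable survive every substitution. -/
theorem occ_iter_up (σ : ℕ → Ty) (m n : ℕ) : occ m (up^[m + 1] σ n) = (n == m) := by
  rcases lt_trichotomy n m with h | h | h
  · rw [iter_up_lt _ (by omega)]; simp [occ]
  · subst h; rw [iter_up_lt _ (by omega)]; simp [occ]
  · obtain ⟨k, rfl⟩ : ∃ k, n = k + (m + 1) := ⟨n - m - 1, by omega⟩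
    rw [iter_up_add, shift, occ_rename_false (fun n => by omega), eq_comm, beq_eq_false_iff_ne]
    omega

theorem occ_subst_iter_up (A : Ty) (m : ℕ) (σ : ℕ → Ty) :
    occ m (A.subst (up^[m + 1] σ)) = occ m A := occ_subst (occ_iter_up σ m)

theorem OnlySign.subst_iter_up {b : Bool} {A : Ty} {m : ℕ} (h : OnlySign b m A) (σ : ℕ → Ty) :
    OnlySign b m (A.subst (up^[m + 1] σ)) :=
  h.subst (iter_up_lt _ (by omega)) fun n hn => by rw [occ_iter_up]; simpa using hn

/-! ### Iterated type formers -/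

theorem allN_subst (m : ℕ) (A : Ty) (σ : ℕ → Ty) :
    (allN m A).subst σ = allN m (A.subst (up^[m] σ)) := by
  induction m generalizing σ with
  | zero => rfl
  | succ m ih => simp only [allN, subst, ih, Function.iterate_succ_apply]

theorem arrows_subst (As : List Ty) (B : Ty) (σ : ℕ → Ty) :
    (arrows As B).subst σ = arrows (As.map fun A => A.subst σ) (B.subst σ) := by
  induction As with
  | nil => rfl
  | cons A As ih => simp only [arrows, List.foldr_cons, subst, List.map_cons] at ih ⊢; rw [ih]

theorem prodN_subst (As : List Ty) (σ : ℕ → Ty) :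
    (prodN As).subst σ = prodN (As.map fun A => A.subst σ) := by
  fun_induction prodN As <;> simp_all [prodN, subst]

theorem sumN_subst (As : List Ty) (σ : ℕ → Ty) :
    (sumN As).subst σ = sumN (As.map fun A => A.subst σ) := by
  fun_induction sumN As <;> simp_all [sumN, subst]

theorem occ_allN (i m : ℕ) (A : Ty) : occ i (allN m A) = occ (i + m) A := by
  induction m generalizing i with
  | zero => rfl
  | succ m ih => simp only [allN, occ, ih]; congr 1; omega

theorem occ_prodN (i : ℕ) (As : List Ty) : occ i (prodN As) = As.any (occ i) := by
  fun_induction prodN As <;> simp_all [occ]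

theorem occ_sumN (i : ℕ) (As : List Ty) : occ i (sumN As) = As.any (occ i) := by
  fun_induction sumN As <;> simp_all [occ]

theorem exPrem_subst (m : ℕ) (A : Ty) (σ : ℕ → Ty) :
    (exPrem m A).subst (up σ) = exPrem m (A.subst (up^[m] σ)) := by
  simp only [exPrem, allN_subst, subst, iter_up_self, rename_subst, subst_rename]
  congr 3
  swap
  · simp [up, scons, shift, rename]
  funext n
  rw [← Function.iterate_succ_apply]
  rcases lt_or_ge n m with h | h
  · rw [iter_upr_lt _ h, iter_up_lt _ h, iter_up_lt _ (by omega)]; simp [rename, iter_upr_lt _ h]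
  · obtain ⟨k, rfl⟩ := Nat.exists_eq_add_of_le' h
    rw [iter_upr_add, iter_up_add, show (Nat.succ k) + m = k + (m + 1) by omega, iter_up_add]
    simp only [shift, rename_rename, iter_upr_add]; congr 1; funext n; omega

theorem exPrem_inst (m : ℕ) (A G : Ty) : (exPrem m A).inst G = allN m (arr A (G.shift m)) := by
  simp only [exPrem, inst, allN_subst, subst, rename_subst, single, Function.iterate_zero, id,
    iter_up_self, scons]
  rw [iter_up_comp_upr]
  simp only [scons]
  rw [show (fun n => var n) = var from rfl, iter_up_var, subst_var]

theorem ex_subst (m : ℕ) (A : Ty) (σ : ℕ → Ty) : (ex m A).subst σ = ex m (A.subst (up^[m] σ)) := by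
  simp only [ex, subst, exPrem_subst]; rfl

theorem occ_ex (i m : ℕ) (A : Ty) : occ i (ex m A) = occ (i + m) A := by
  simp only [ex, exPrem, occ, occ_allN]
  rw [occ_rename (i := i + m)]
  · simp
  · intro n
    rcases lt_or_ge n m with h | h
    · rw [iter_upr_lt _ h]; omega
    · obtain ⟨k, rfl⟩ := Nat.exists_eq_add_of_le' h
      rw [iter_upr_add]; omega

/-- Substitution for the free variables of a premise `∀Y⃗. ⟨Aⱼ⟩ⱼ ⇒ X`. -/
def subL (σ : ℕ → Ty) (p : ℕ × List Ty) : ℕ × List Ty :=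
  (p.1, p.2.map fun A => A.subst (up^[p.1 + 1] σ))

/-- Substitution for the free variables of a premise `∀Y⃗. X ⇒ A`. -/
def subR (σ : ℕ → Ty) (q : ℕ × Ty) : ℕ × Ty := (q.1, q.2.subst (up^[q.1 + 1] σ))

theorem premL_subst (p : ℕ × List Ty) (σ : ℕ → Ty) :
    (premL p).subst σ =
      allN p.1 (arrows (p.2.map fun A => A.subst (up^[p.1] σ)) ((σ 0).shift p.1)) := by
  simp only [premL, allN_subst, arrows_subst, subst, iter_up_self]

theorem premL_inst (p : ℕ × List Ty) (E : Ty) :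
    (premL p).inst E =
      allN p.1 (arrows (p.2.map fun A => A.subst (single p.1 E)) (E.shift p.1)) :=
  premL_subst p _

theorem premL_subst_up (p : ℕ × List Ty) (σ : ℕ → Ty) :
    (premL p).subst (up σ) = premL (subL σ p) := by
  rw [premL_subst]
  simp [premL, subL, up, scons, shift, rename, Function.iterate_succ_apply]

theorem premR_subst (q : ℕ × Ty) (σ : ℕ → Ty) :
    (premR q).subst σ = allN q.1 (arr ((σ 0).shift q.1) (q.2.subst (up^[q.1] σ))) := by
  simp only [premR, allN_subst, subst, iter_up_self]

theorem premR_subst_up (q : ℕ × Ty) (σ : ℕ → Ty) :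
    (premR q).subst (up σ) = premR (subR σ q) := by
  rw [premR_subst]
  simp [premR, subR, up, scons, shift, rename, Function.iterate_succ_apply]

theorem univL_subst (Ps : List (ℕ × List Ty)) (B : Ty) (σ : ℕ → Ty) :
    (univL Ps B).subst σ = univL (Ps.map (subL σ)) (B.subst (up σ)) := by
  simp only [univL, subst, arrows_subst, List.map_map]
  congr 2
  exact List.map_congr_left fun p _ => premL_subst_up p σ

theorem univR_subst (Qs : List (ℕ × Ty)) (B : Ty) (σ : ℕ → Ty) :
    (univR Qs B).subst σ = univR (Qs.map (subR σ)) (B.subst (up σ)) := by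
  simp only [univR, subst, arrows_subst, List.map_map]
  congr 2
  exact List.map_congr_left fun p _ => premR_subst_up p σ

theorem SignL.subst {Ps : List (ℕ × List Ty)} {B : Ty} (h : SignL Ps B) (σ : ℕ → Ty) :
    SignL (Ps.map (subL σ)) (B.subst (up σ)) := by
  refine ⟨fun p hp A hA => ?_, OnlySign.subst_iter_up (m := 0) h.2 σ⟩
  obtain ⟨p, hp', rfl⟩ := List.mem_map.1 hp
  obtain ⟨A, hA', rfl⟩ := List.mem_map.1 hA
  exact (h.1 p hp' A hA').subst_iter_up σ

theorem SignR.subst {Qs : List (ℕ × Ty)} {B : Ty} (h : SignR Qs B) (σ : ℕ → Ty) :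
    SignR (Qs.map (subR σ)) (B.subst (up σ)) := by
  refine ⟨fun q hq => ?_, OnlySign.subst_iter_up (m := 0) h.2 σ⟩
  obtain ⟨q, hq', rfl⟩ := List.mem_map.1 hq
  exact (h.1 q hq').subst_iter_up σ

/-! ### Admissible types -/

/-- A substitution keeps both shapes of universal types: it maps premises to premises with the same
quantifiers, and since `X` is bound no substituted type can add an occurrence of it with the wrong
sign. -/
theorem Adm.subst {A : Ty} {σ : ℕ → Ty} (hA : A.Adm) (h : ∀ n, (σ n).Adm) : (A.subst σ).Adm := by
  -- Renamings come first: going under a binder shifts the values of a substitution, so the general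
  -- case needs admissibility of renamed types.
  have ren : ∀ (A : Ty) (ρ : ℕ → ℕ), A.Adm → (A.rename ρ).Adm := by
    intro A
    induction A with
    | var n => intros; trivial
    | one => intros; trivial
    | zero => intros; trivial
    | arr A B ihA ihB | prod A B ihA ihB | sum A B ihA ihB =>
      exact fun ρ hA => ⟨ihA ρ hA.1, ihB ρ hA.2⟩
    | mu A ih | nu A ih =>
      exact fun ρ hA => ⟨ih _ hA.1, OnlySign.rename hA.2 (by rintro (_ | n) <;> simp [upr])⟩
    | all A ih =>
      rintro ρ ⟨hA, h⟩
      refine ⟨ih _ hA, ?_⟩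
      have e : Ty.all (A.rename (upr ρ)) = (Ty.all A).subst (fun n => Ty.var (ρ n)) := by
        rw [← rename_eq_subst]; rfl
      rw [e]
      rcases h with ⟨Ps, B, h, hs⟩ | ⟨Qs, B, h, hs⟩
      · exact .inl ⟨_, _, by rw [h, univL_subst], hs.subst _⟩
      · exact .inr ⟨_, _, by rw [h, univR_subst], hs.subst _⟩
  have hup : ∀ σ : ℕ → Ty, (∀ n, (σ n).Adm) → ∀ n, (up σ n).Adm := by
    rintro σ h (_ | n)
    · trivial
    · exact ren _ _ (h n)
  induction A generalizing σ with
  | var n => exact h n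
  | one => trivial
  | zero => trivial
  | arr A B ihA ihB | prod A B ihA ihB | sum A B ihA ihB => exact ⟨ihA hA.1 h, ihB hA.2 h⟩
  | mu A ih | nu A ih =>
    exact ⟨ih hA.1 (hup _ h), OnlySign.subst_iter_up (m := 0) hA.2 σ⟩
  | all A ih =>
    obtain ⟨hA, hu⟩ := hA
    refine ⟨ih hA (hup _ h), ?_⟩
    change (∃ Ps B, (Ty.all A).subst σ = univL Ps B ∧ _) ∨ (∃ Ps B, (Ty.all A).subst σ = _ ∧ _)
    rcases hu with ⟨Ps, B, h, hs⟩ | ⟨Qs, B, h, hs⟩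
    · exact .inl ⟨_, _, by rw [h, univL_subst], hs.subst _⟩
    · exact .inr ⟨_, _, by rw [h, univR_subst], hs.subst _⟩

theorem Adm.rename {A : Ty} (hA : A.Adm) (ρ : ℕ → ℕ) : (A.rename ρ).Adm := by
  rw [rename_eq_subst]; exact hA.subst fun _ => trivial

theorem Adm.shift {A : Ty} (hA : A.Adm) (m : ℕ) : (A.shift m).Adm := hA.rename _

theorem adm_scons {A : Ty} {σ : ℕ → Ty} (hA : A.Adm) (h : ∀ n, (σ n).Adm) (n : ℕ) :
    (scons A σ n).Adm := by
  cases n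
  exacts [hA, h _]

theorem adm_up {σ : ℕ → Ty} (h : ∀ n, (σ n).Adm) (n : ℕ) : (up σ n).Adm :=
  adm_scons (A := var 0) trivial (fun n => (h n).shift 1) n

theorem adm_iter_up {σ : ℕ → Ty} (h : ∀ n, (σ n).Adm) (m n : ℕ) : (up^[m] σ n).Adm := by
  induction m generalizing σ with
  | zero => exact h n
  | succ m ih => exact ih (adm_up h)

theorem adm_single {E : Ty} (hE : E.Adm) (m n : ℕ) : (single m E n).Adm :=
  adm_iter_up (σ := scons E var) (adm_scons hE fun _ => trivial) m n

theorem adm_sconsL {Cs : List Ty} {σ : ℕ → Ty} (hC : ∀ C ∈ Cs, C.Adm) (h : ∀ n, (σ n).Adm)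
    (n : ℕ) : (sconsL Cs σ n).Adm := by
  induction Cs generalizing σ with
  | nil => exact h n
  | cons C Cs ih =>
    exact ih (fun D hD => hC D (by simp [hD])) (adm_scons (hC C (by simp)) h)

theorem Adm.inst {A E : Ty} (hA : A.Adm) (hE : E.Adm) : (A.inst E).Adm :=
  hA.subst (adm_single hE 0)

theorem adm_arrows {As : List Ty} {B : Ty} :
    (arrows As B).Adm ↔ (∀ A ∈ As, A.Adm) ∧ B.Adm := by
  induction As with
  | nil => simp [arrows]
  | cons A As ih => simp only [arrows, List.foldr_cons, Adm] at ih ⊢; rw [ih]; simp [and_assoc]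

theorem adm_prodN {As : List Ty} : (prodN As).Adm ↔ ∀ A ∈ As, A.Adm := by
  fun_induction prodN As <;> simp_all [Adm]

theorem adm_sumN {As : List Ty} : (sumN As).Adm ↔ ∀ A ∈ As, A.Adm := by
  fun_induction sumN As <;> simp_all [Adm]

theorem Adm.of_allN {m : ℕ} {A : Ty} (h : (allN m A).Adm) : A.Adm := by
  induction m with
  | zero => exact h
  | succ m ih => exact ih h.1

theorem Adm.of_univL {Ps : List (ℕ × List Ty)} {B : Ty} (h : (univL Ps B).Adm) :
    (∀ p ∈ Ps, (premL p).Adm) ∧ B.Adm :=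
  let ⟨h₁, h₂⟩ := adm_arrows.1 h.1
  ⟨fun _ hp => h₁ _ (List.mem_map_of_mem hp), h₂⟩

theorem Adm.of_univR {Qs : List (ℕ × Ty)} {B : Ty} (h : (univR Qs B).Adm) :
    (∀ q ∈ Qs, (premR q).Adm) ∧ B.Adm :=
  let ⟨h₁, h₂⟩ := adm_arrows.1 h.1
  ⟨fun _ hp => h₁ _ (List.mem_map_of_mem hp), h₂⟩

theorem Adm.of_premL {p : ℕ × List Ty} (h : (premL p).Adm) : ∀ A ∈ p.2, A.Adm :=
  (adm_arrows.1 h.of_allN).1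

theorem Adm.of_premR {q : ℕ × Ty} (h : (premR q).Adm) : q.2.Adm := h.of_allN.2

end Ty
end Yoneda

namespace Yoneda

namespace Tm

/-! ### Substitution of types and terms in terms -/

theorem up_var : up var = var := by
  funext n; cases n <;> rfl

theorem up_ren (ρ : ℕ → ℕ) : up (fun n => var (ρ n)) = fun n => var (upr ρ n) := by
  funext n; cases n <;> rfl

theorem up_comp_upr (σ : ℕ → Tm) (ρ : ℕ → ℕ) :
    (fun n => up σ (upr ρ n)) = up (fun n => σ (ρ n)) := by
  funext n; cases n <;> rfl

theorem rename_eq_subst (t : Tm) (ρ : ℕ → ℕ) : t.rename ρ = t.subst (fun n => var (ρ n)) := by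
  induction t generalizing ρ <;> simp_all [rename, subst, up_ren, tshift, tsubst]

theorem subst_var (t : Tm) : t.subst var = t := by
  induction t <;> simp_all [subst, up_var, tshift, tsubst]

theorem rename_subst (t : Tm) (ρ : ℕ → ℕ) (σ : ℕ → Tm) :
    (t.rename ρ).subst σ = t.subst (fun n => σ (ρ n)) := by
  induction t generalizing ρ σ <;> simp_all [rename, subst, up_comp_upr]

theorem rename_rename (t : Tm) (ρ ρ' : ℕ → ℕ) :
    (t.rename ρ).rename ρ' = t.rename (fun n => ρ' (ρ n)) := by
  rw [rename_eq_subst (t.rename ρ), rename_subst, rename_eq_subst]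

theorem rename_tsubst (t : Tm) (ρ : ℕ → ℕ) (θ : ℕ → Ty) :
    (t.rename ρ).tsubst θ = (t.tsubst θ).rename ρ := by
  induction t generalizing ρ θ <;> simp_all [rename, tsubst]

theorem tsubst_var (t : Tm) : t.tsubst Ty.var = t := by
  induction t <;> simp_all [tsubst, Ty.up_var, Ty.subst_var]

theorem tsubst_tsubst (t : Tm) (θ η : ℕ → Ty) :
    (t.tsubst θ).tsubst η = t.tsubst (fun n => (θ n).subst η) := by
  induction t generalizing θ η <;> simp_all [tsubst, Ty.subst_subst, Ty.up_comp]

theorem tshift_tsubst_up (t : Tm) (θ : ℕ → Ty) :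
    (t.tshift 1).tsubst (Ty.up θ) = (t.tsubst θ).tshift 1 := by
  simp [tshift, tsubst_tsubst, Ty.subst, Ty.up, Ty.scons, Ty.shift, Ty.rename_eq_subst]

theorem up_rename (σ : ℕ → Tm) (ρ : ℕ → ℕ) :
    (fun n => (up σ n).rename (upr ρ)) = up (fun n => (σ n).rename ρ) := by
  funext n
  cases n with
  | zero => rfl
  | succ n => simp [up, scons, shift, rename_rename, upr]

theorem subst_rename (t : Tm) (σ : ℕ → Tm) (ρ : ℕ → ℕ) :
    (t.subst σ).rename ρ = t.subst (fun n => (σ n).rename ρ) := by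
  induction t generalizing σ ρ <;>
    simp_all [rename, subst, up_rename, tshift, rename_tsubst]

theorem up_tsubst (σ : ℕ → Tm) (θ : ℕ → Ty) :
    (fun n => (up σ n).tsubst θ) = up (fun n => (σ n).tsubst θ) := by
  funext n
  cases n with
  | zero => rfl
  | succ n => simp [up, scons, shift, rename_tsubst]

theorem subst_tsubst (t : Tm) (σ : ℕ → Tm) (θ : ℕ → Ty) :
    (t.subst σ).tsubst θ = (t.tsubst θ).subst (fun n => (σ n).tsubst θ) := by
  induction t generalizing σ θ <;>
    simp_all [tsubst, subst, up_tsubst, tshift_tsubst_up]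

theorem tshift_rename (t : Tm) (m : ℕ) (ρ : ℕ → ℕ) :
    (t.tshift m).rename ρ = (t.rename ρ).tshift m := (rename_tsubst _ _ _).symm

theorem up_comp (σ τ : ℕ → Tm) :
    (fun n => (up σ n).subst (up τ)) = up (fun n => (σ n).subst τ) := by
  funext n
  cases n with
  | zero => rfl
  | succ n => simp [up, scons, shift, rename_subst, subst_rename]

theorem subst_subst (t : Tm) (σ τ : ℕ → Tm) :
    (t.subst σ).subst τ = t.subst (fun n => (σ n).subst τ) := by
  induction t generalizing σ τ <;> simp_all [subst, up_comp, tshift, subst_tsubst]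

theorem tshift_zero (t : Tm) : t.tshift 0 = t := tsubst_var t

theorem shift_zero (t : Tm) : t.shift 0 = t := by
  rw [shift, rename_eq_subst]; exact subst_var t

theorem shift_shift (t : Tm) (m n : ℕ) : (t.shift m).shift n = t.shift (m + n) := by
  simp only [shift, rename_rename, add_assoc]

theorem tshift_tshift (t : Tm) (m n : ℕ) : (t.tshift m).tshift n = t.tshift (m + n) := by
  simp only [tshift, tsubst_tsubst, Ty.subst, add_assoc]

theorem tshift_tsubst (t : Tm) (m : ℕ) (θ : ℕ → Ty) :
    (t.tshift m).tsubst θ = t.tsubst (fun n => θ (n + m)) := by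
  simp only [tshift, tsubst_tsubst, Ty.subst]

theorem tshift_one_tinst (t : Tm) (A : Ty) : (t.tshift 1).tinst A = t := by
  rw [tinst, tshift_tsubst]; exact tsubst_var t

theorem shift_tsubst (t : Tm) (k : ℕ) (θ : ℕ → Ty) :
    (t.shift k).tsubst θ = (t.tsubst θ).shift k := rename_tsubst _ _ _

theorem shift_subst (t : Tm) (k : ℕ) (σ : ℕ → Tm) :
    (t.shift k).subst σ = t.subst (fun n => σ (n + k)) := rename_subst _ _ _

theorem subst_tshift (t : Tm) (σ : ℕ → Tm) (m : ℕ) :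
    (t.subst σ).tshift m = (t.tshift m).subst (fun n => (σ n).tshift m) := subst_tsubst _ _ _

theorem plug_tsubst (t : Tm) (k : ℕ) (a : Tm) (θ : ℕ → Ty) :
    (t.plug k a).tsubst θ = (t.tsubst θ).plug k (a.tsubst θ) := by
  rw [plug, subst_tsubst, plug]; congr 1; funext n; cases n <;> rfl

theorem plug_subst (t : Tm) (k : ℕ) (a : Tm) (σ : ℕ → Tm) :
    (t.plug k a).subst σ = t.subst (scons (a.subst σ) (fun n => σ (n + k))) := by
  rw [plug, subst_subst]; congr 1; funext n; cases n <;> rfl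

theorem plug_var_zero (t : Tm) : t.plug 1 (var 0) = t := by
  rw [plug]
  conv_rhs => rw [← subst_var t]
  congr 1; funext n; cases n <;> rfl

theorem shift_plug (t : Tm) (a : Tm) (k : ℕ) : (t.shift 1).plug k a = t.shift k := by
  rw [plug, shift_subst, shift, rename_eq_subst]; rfl

theorem subst_up_scons (t a : Tm) (σ τ : ℕ → Tm) :
    (t.subst (up σ)).subst (scons a τ) = t.subst (scons a (fun n => (σ n).subst τ)) := by
  rw [subst_subst]; congr 1; funext n
  cases n with
  | zero => rfl
  | succ n => simp only [up, scons, shift_subst]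

theorem subst_up_plug (t a : Tm) (σ : ℕ → Tm) :
    (t.subst (up σ)).plug 0 a = t.subst (scons a σ) := by
  rw [plug, subst_up_scons]; congr 1; funext n
  cases n with
  | zero => rfl
  | succ n => exact subst_var _

theorem plug_plug (t a b : Tm) (k : ℕ) : (t.plug (k + 1) a).plug 0 b = t.plug k (a.plug 0 b) := by
  rw [plug, plug_subst, plug]; congr 1

theorem plug_plug' (t a b : Tm) (k : ℕ) : (t.plug 1 a).plug k b = t.plug k (a.plug k b) := by
  rw [plug, plug_subst, plug]; congr 1

theorem plug_zero_subst (t a : Tm) (σ : ℕ → Tm) :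
    (t.plug 0 a).subst σ = (t.subst (up σ)).plug 0 (a.subst σ) := by
  rw [plug_subst, subst_up_plug]; rfl

theorem app_plug (t u a : Tm) (k : ℕ) : (app t u).plug k a = app (t.plug k a) (u.plug k a) := rfl

/-- Iterated type application. -/
def tapps (t : Tm) (Cs : List Ty) : Tm := Cs.foldl tapp t

theorem tappVars_eq (t : Tm) (m : ℕ) : t.tappVars m = t.tapps (Ty.tvars m) := rfl

theorem tapps_tsubst (t : Tm) (Cs : List Ty) (θ : ℕ → Ty) :
    (t.tapps Cs).tsubst θ = (t.tsubst θ).tapps (Cs.map fun C => C.subst θ) := by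
  induction Cs generalizing t with
  | nil => rfl
  | cons C Cs ih => simp only [tapps, List.foldl_cons, List.map_cons] at ih ⊢; rw [ih]; rfl

theorem tapps_subst (t : Tm) (Cs : List Ty) (σ : ℕ → Tm) :
    (t.tapps Cs).subst σ = (t.subst σ).tapps Cs := by
  induction Cs generalizing t with
  | nil => rfl
  | cons C Cs ih => simp only [tapps, List.foldl_cons] at ih ⊢; rw [ih]; rfl

theorem tapps_shift (t : Tm) (Cs : List Ty) (k : ℕ) :
    (t.tapps Cs).shift k = (t.shift k).tapps Cs := by
  simp only [shift, rename_eq_subst, tapps_subst]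

theorem apps_subst (t : Tm) (us : List Tm) (σ : ℕ → Tm) :
    (t.apps us).subst σ = (t.subst σ).apps (us.map fun u => u.subst σ) := by
  induction us generalizing t with
  | nil => rfl
  | cons u us ih => simp only [apps, List.foldl_cons, List.map_cons] at ih ⊢; rw [ih]; rfl

theorem apps_tsubst (t : Tm) (us : List Tm) (θ : ℕ → Ty) :
    (t.apps us).tsubst θ = (t.tsubst θ).apps (us.map fun u => u.tsubst θ) := by
  induction us generalizing t with
  | nil => rfl
  | cons u us ih => simp only [apps, List.foldl_cons, List.map_cons] at ih ⊢; rw [ih]; rfl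

theorem lams_tsubst (As : List Ty) (t : Tm) (θ : ℕ → Ty) :
    (lams As t).tsubst θ = lams (As.map fun A => A.subst θ) (t.tsubst θ) := by
  induction As with
  | nil => rfl
  | cons A As ih => simp only [lams, List.foldr_cons, List.map_cons, tsubst] at ih ⊢; rw [ih]

theorem lams_subst (As : List Ty) (t : Tm) (σ : ℕ → Tm) :
    (lams As t).subst σ = lams As (t.subst (up^[As.length] σ)) := by
  induction As generalizing σ with
  | nil => rfl
  | cons A As ih =>
    simp only [lams, List.foldr_cons, subst, List.length_cons, Function.iterate_succ_apply] at ih ⊢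
    rw [ih]

theorem tlamN_tsubst (m : ℕ) (t : Tm) (θ : ℕ → Ty) :
    (tlamN m t).tsubst θ = tlamN m (t.tsubst (Ty.up^[m] θ)) := by
  induction m generalizing θ with
  | zero => rfl
  | succ m ih => simp only [tlamN, tsubst, ih, Function.iterate_succ_apply]

theorem tlamN_subst (m : ℕ) (t : Tm) (σ : ℕ → Tm) :
    (tlamN m t).subst σ = tlamN m (t.subst fun n => (σ n).tshift m) := by
  induction m generalizing σ with
  | zero => simp only [tlamN, tshift_zero]
  | succ m ih =>
    simp only [tlamN, subst, ih, tshift_tshift]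
    simp only [Nat.add_comm 1 m]

theorem iter_up_lt (σ : ℕ → Tm) {m n : ℕ} (h : n < m) : up^[m] σ n = var n := by
  induction m generalizing n with
  | zero => omega
  | succ m ih =>
    rw [Function.iterate_succ_apply']
    cases n with
    | zero => rfl
    | succ n => simp only [up, scons] at ih ⊢; rw [ih (by omega)]; rfl

theorem iter_up_add (σ : ℕ → Tm) (m n : ℕ) : up^[m] σ (n + m) = (σ n).shift m := by
  induction m with
  | zero => simp [shift_zero]
  | succ m ih =>
    rw [Function.iterate_succ_apply', ← add_assoc]; simp only [up, scons] at ih ⊢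
    rw [ih, shift_shift]

/-- The substitution of a list of terms for the last variables of the context. -/
def sconsL (us : List Tm) (σ : ℕ → Tm) : ℕ → Tm := us.foldl (fun σ u => scons u σ) σ

theorem sconsL_add (us : List Tm) (σ : ℕ → Tm) (n : ℕ) : sconsL us σ (n + us.length) = σ n := by
  induction us generalizing σ n with
  | nil => rfl
  | cons C Cs ih =>
    simp only [List.length_cons, sconsL, List.foldl_cons] at ih ⊢
    rw [show n + (Cs.length + 1) = (n + 1) + Cs.length by omega, ih]; rfl

theorem sconsL_get (us : List Tm) (σ : ℕ → Tm) (k : ℕ) (h : k < us.length) :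
    sconsL us σ (us.length - 1 - k) = us[k] := by
  induction us generalizing σ k with
  | nil => simp at h
  | cons u us ih =>
    cases k with
    | zero =>
      have := sconsL_add us (scons u σ) 0
      simpa [sconsL, scons] using this
    | succ k =>
      simp only [List.length_cons, sconsL, List.foldl_cons, List.getElem_cons_succ] at ih ⊢
      rw [show us.length + 1 - 1 - (k + 1) = us.length - 1 - k by omega]
      exact ih _ _ (by simpa using h)

theorem vars_succ (n : ℕ) : vars (n + 1) = var n :: vars n := by
  simp [vars, List.range_succ]

theorem length_vars (n : ℕ) : (vars n).length = n := by simp [vars]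

theorem getElem_vars (n k : ℕ) (h : k < (vars n).length) : (vars n)[k] = var (n - 1 - k) := by
  simp [vars]

theorem sconsL_vars (n : ℕ) : sconsL (vars n) (fun k => var (k + n)) = var := by
  have h : ∀ (n : ℕ) (σ : ℕ → Tm) (k : ℕ),
      sconsL (vars n) σ k = if k < n then var k else σ (k - n) := by
    intro n
    induction n with
    | zero => intro σ k; rfl
    | succ n ih =>
      intro σ k
      rw [vars_succ]; simp only [sconsL, List.foldl_cons] at ih ⊢
      rw [ih]
      rcases lt_trichotomy k n with h | h | h
      · rw [if_pos h, if_pos (by omega)]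
      · subst h; simp [scons]
      · rw [if_neg (by omega), if_neg (by omega)]
        obtain ⟨l, rfl⟩ : ∃ l, k = n + 1 + l := ⟨k - (n + 1), by omega⟩
        rw [show n + 1 + l - n = l + 1 by omega, show n + 1 + l - (n + 1) = l by omega]; rfl
  funext k; rw [h]
  split
  · rfl
  · congr 1; omega

theorem iter_up_sconsL (us : List Tm) (σ τ : ℕ → Tm) :
    (fun n => (up^[us.length] σ n).subst (sconsL us τ)) = sconsL us (fun n => (σ n).subst τ) := by
  induction us generalizing σ τ with
  | nil => rfl
  | cons C Cs ih =>
    simp only [List.length_cons, Function.iterate_succ_apply, sconsL, List.foldl_cons] at ih ⊢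
    rw [ih]; congr 1; funext n
    cases n with
    | zero => rfl
    | succ n => simp only [up, scons, shift_subst]

/-! ### The functorial action and substitution -/

/-- Apart from its argument `x`, the action mentions the term context only through `t`, so a
substitution that keeps `x` reaches `t` alone. -/
theorem fmap_subst (A : Ty) (i : ℕ) (σ τ : ℕ → Ty) (t : Tm) (s : ℕ → Tm) :
    (fmap A i σ τ t).subst (up s) = fmap A i σ τ (t.subst (up s)) := by
  have aux : ∀ (r a : Tm) (s : ℕ → Tm) (k : ℕ), (r.plug (k + 1) a).subst (up^[k + 1] s) =
      (r.subst (up s)).plug (k + 1) (a.subst (up^[k + 1] s)) := by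
    intro r a s k
    rw [plug_subst, plug, subst_up_scons]; congr 2; funext n
    rw [iter_up_add]; simp only [shift, rename_eq_subst]
  have a1 : ∀ (r a : Tm) (s : ℕ → Tm), (r.plug 1 a).subst (up s) =
    (r.subst (up s)).plug 1 (a.subst (up s)) := fun r a s => aux r a s 0
  have a2 : ∀ (r a : Tm) (s : ℕ → Tm), (r.plug 2 a).subst (up (up s)) =
    (r.subst (up s)).plug 2 (a.subst (up (up s))) := fun r a s => aux r a s 1
  induction A generalizing i σ τ t s with
  | var n => simp only [fmap]; split <;> rfl
  | one => rfl
  | zero => rfl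
  | arr A B ihA ihB => simp only [fmap, subst, a2, ihA, ihB]; rfl
  | prod A B ihA ihB => simp only [fmap, subst, a1, ihA, ihB]; rfl
  | sum A B ihA ihB => simp only [fmap, subst, a2, ihA, ihB]; rfl
  | mu A ih => simp only [fmap, subst, a2, ih]; rfl
  | nu A ih => simp only [fmap, subst, a2, ih]; rfl
  | all A ih =>
    have e : (fun n => (up s n).tshift 1) = up (fun n => (s n).tshift 1) := up_tsubst _ _
    simp only [fmap, subst, e, a1, ih]
    rw [subst_tshift, e]; rfl

/-- Moves the weakening by `k` variables into `t`, so that computation rules need to be stated only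
for plugging without a change of context. -/
theorem fmap_plug (A : Ty) (i : ℕ) (σ τ : ℕ → Ty) (t a : Tm) (k : ℕ) :
    (fmap A i σ τ t).plug k a =
      (fmap A i σ τ (t.subst (up fun n => var (n + k)))).plug 0 a := by
  rw [← fmap_subst, subst_up_plug, plug]

theorem fmap_tsubst (A : Ty) (i : ℕ) (σ τ : ℕ → Ty) (t : Tm) (θ : ℕ → Ty) :
    (fmap A i σ τ t).tsubst θ =
      fmap A i (fun n => (σ n).subst θ) (fun n => (τ n).subst θ) (t.tsubst θ) := by
  induction A generalizing i σ τ t θ with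
  | var n => simp only [fmap]; split <;> rfl
  | one => rfl
  | zero => rfl
  | arr A B ihA ihB | prod A B ihA ihB | sum A B ihA ihB =>
    simp only [fmap, tsubst, plug_tsubst, ihA, ihB, Ty.subst_subst, Ty.subst]
  | mu A ih | nu A ih =>
    simp only [fmap, tsubst, plug_tsubst, ih, Ty.subst_subst, Ty.subst, Ty.scons_comp, Ty.up_comp]
  | all A ih =>
    simp only [fmap, tsubst, plug_tsubst, ih, Ty.up_comp, tshift_tsubst_up]
    rfl

/-- An equality of terms, not just of ε-classes: the action reads the substitutions only at free
variables of `A`, and reads `t` only if `i` occurs. Restricting the hypotheses to occurring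
variables is what lets vacuous data be replaced at will later. -/
theorem fmap_rename {A : Ty} {i j : ℕ} {ρ : ℕ → ℕ} {σ τ σ' τ' : ℕ → Ty} {t t' : Tm}
    (hij : ∀ n, Ty.occ n A = true → (ρ n = j ↔ n = i))
    (hσ : ∀ n, Ty.occ n A = true → σ (ρ n) = σ' n)
    (hτ : ∀ n, Ty.occ n A = true → τ (ρ n) = τ' n)
    (ht : Ty.occ i A = true → t = t') :
    fmap (A.rename ρ) j σ τ t = fmap A i σ' τ' t' := by
  induction A generalizing i j ρ σ τ σ' τ' t t' with
  | var n =>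
    simp only [fmap, Ty.rename, hij n (by simp [Ty.occ])]
    split
    · exact ht (by simp_all [Ty.occ])
    · rfl
  | one => rfl
  | zero => rfl
  | arr A B ihA ihB | prod A B ihA ihB | sum A B ihA ihB =>
    have l : ∀ {n}, Ty.occ n A = true → (Ty.occ n A || Ty.occ n B) = true := by simp_all
    have r : ∀ {n}, Ty.occ n B = true → (Ty.occ n A || Ty.occ n B) = true := by simp_all
    simp only [fmap, Ty.rename, Ty.rename_subst]
    simp only [Ty.occ] at hij hσ hτ ht
    try rw [ihA (fun n h => hij n (l h)) (fun n h => hσ n (l h)) (fun n h => hτ n (l h))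
      fun h => ht (l h)]
    try rw [ihA (fun n h => hij n (l h)) (fun n h => hτ n (l h)) (fun n h => hσ n (l h))
      fun h => ht (l h)]
    rw [ihB (fun n h => hij n (r h)) (fun n h => hσ n (r h)) (fun n h => hτ n (r h))
      fun h => ht (r h)]
    try rw [Ty.subst_congr fun n h => hτ n (l h)]
    try rw [Ty.subst_congr fun n h => hτ n (r h)]
  | all A ih =>
    simp only [Ty.occ] at hij hσ hτ ht
    simp only [fmap, Ty.rename]
    rw [ih (i := i + 1)]
    · rintro (_ | n) h <;> simp [upr]; exact hij n h
    · rintro (_ | n) h <;> simp [upr, Ty.up, Ty.scons]; rw [hσ n h]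
    · rintro (_ | n) h <;> simp [upr, Ty.up, Ty.scons]; rw [hτ n h]
    · intro h; rw [ht h]
  | mu A ih | nu A ih =>
    simp only [Ty.occ] at hij hσ hτ ht
    have e1 : (A.rename (upr ρ)).subst (Ty.up σ) = A.subst (Ty.up σ') := by
      rw [Ty.rename_subst]; apply Ty.subst_congr
      rintro (_ | n) h <;> simp [upr, Ty.up, Ty.scons]; rw [hσ n h]
    have e2 : (A.rename (upr ρ)).subst (Ty.up τ) = A.subst (Ty.up τ') := by
      rw [Ty.rename_subst]; apply Ty.subst_congr
      rintro (_ | n) h <;> simp [upr, Ty.up, Ty.scons]; rw [hτ n h]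
    have e3 : ∀ M, (A.rename (upr ρ)).subst (Ty.scons M σ) = A.subst (Ty.scons M σ') := by
      intro M
      rw [Ty.rename_subst]; apply Ty.subst_congr
      rintro (_ | n) h <;> simp [upr, Ty.scons]; rw [hσ n h]
    simp only [fmap, Ty.rename, e1, e2, e3]
    rw [ih (i := i + 1) (σ' := Ty.scons _ σ') (τ' := Ty.scons _ τ') (t' := t')]
    · rintro (_ | n) h <;> simp [upr]; exact hij n h
    · rintro (_ | n) h <;> simp [upr, Ty.scons]; exact hσ n h
    · rintro (_ | n) h <;> simp [upr, Ty.scons]; exact hτ n h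
    · intro h; rw [ht h]

theorem act_zero (A E F : Ty) (t : Tm) :
    act A 0 E F t = fmap A 0 (Ty.scons E Ty.var) (Ty.scons F Ty.var) t := by
  rw [act, tshift_zero]; rfl

end Tm
end Yoneda

namespace Yoneda
open Ty Tm

/-! ### Typing -/

theorem HasType.adm {Γ : List Ty} {t : Tm} {A : Ty} (h : HasType Γ t A) : A.Adm := by
  induction h with
  | var _ h => exact h
  | lam h _ ih => exact ⟨h, ih⟩
  | app _ _ ih _ => exact ih.2
  | tlam h _ _ => exact h
  | tapp _ h ih => exact Adm.inst ih.1 h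
  | pair _ _ ih ih' => exact ⟨ih, ih'⟩
  | fst _ ih => exact ih.1
  | snd _ ih => exact ih.2
  | star => trivial
  | inl h _ ih => exact ⟨ih, h⟩
  | inr h _ ih => exact ⟨h, ih⟩
  | case _ _ _ _ ih _ => exact ih
  | abort h _ _ => exact h
  | inm h _ _ => exact h
  | foldm h _ ih => exact ⟨h, ih.2⟩
  | outn _ ih => exact Adm.inst ih.1 ih
  | unfoldn h _ ih => exact ⟨ih.1, h⟩

theorem Ty.Adm.of_shift {A : Ty} {m : ℕ} (h : (A.shift m).Adm) : A.Adm := by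
  have := h.subst (σ := fun n => .var (n - m)) fun _ => trivial
  rw [shift_subst] at this
  simp only [Nat.add_sub_cancel] at this
  rwa [show (fun n => Ty.var n) = Ty.var from rfl, Ty.subst_var] at this

theorem shiftC_zero (Γ : List Ty) : shiftC 0 Γ = Γ := by
  simp [shiftC, show Ty.shift 0 = id from funext Ty.shift_zero]

theorem shiftC_shiftC (m n : ℕ) (Γ : List Ty) : shiftC n (shiftC m Γ) = shiftC (m + n) Γ := by
  simp [shiftC, Ty.shift_shift]

theorem shiftC_append (m : ℕ) (Γ Δ : List Ty) : shiftC m (Γ ++ Δ) = shiftC m Γ ++ shiftC m Δ := by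
  simp [shiftC]

theorem shiftC_eq (m : ℕ) (Γ : List Ty) :
    shiftC m Γ = Γ.map fun A => A.subst fun n => .var (n + m) := by
  exact List.map_congr_left fun A _ => Ty.rename_eq_subst A _

theorem shiftC_map_subst_up (Γ : List Ty) (θ : ℕ → Ty) :
    (shiftC 1 Γ).map (fun A => A.subst (Ty.up θ)) = shiftC 1 (Γ.map fun A => A.subst θ) := by
  simp only [shiftC, List.map_map]
  exact List.map_congr_left fun A _ => shift_subst_up A θ

theorem HasType.tsubst {Γ : List Ty} {t : Tm} {A : Ty} (h : HasType Γ t A) {θ : ℕ → Ty}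
    (hθ : ∀ n, (θ n).Adm) :
    HasType (Γ.map fun A => A.subst θ) (t.tsubst θ) (A.subst θ) := by
  induction h generalizing θ with
  | var h h' => exact .var (by simp [h]) (h'.subst hθ)
  | lam h _ ih => exact .lam (h.subst hθ) (ih hθ)
  | app _ _ ih ih' => exact .app (ih hθ) (ih' hθ)
  | tlam h _ ih =>
    exact .tlam (h.subst hθ) (by simpa only [shiftC_map_subst_up] using ih (adm_up hθ))
  | tapp _ h ih => rw [inst_subst]; exact .tapp (ih hθ) (h.subst hθ)
  | pair _ _ ih ih' => exact .pair (ih hθ) (ih' hθ)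
  | fst _ ih => exact .fst (ih hθ)
  | snd _ ih => exact .snd (ih hθ)
  | star => exact .star
  | inl h _ ih => exact .inl (h.subst hθ) (ih hθ)
  | inr h _ ih => exact .inr (h.subst hθ) (ih hθ)
  | case _ _ _ ih ih' ih'' => exact .case (ih hθ) (ih' hθ) (ih'' hθ)
  | abort h _ ih => exact .abort (h.subst hθ) (ih hθ)
  | inm h _ ih =>
    have := ih hθ
    rw [inst_subst] at this
    exact .inm (h.subst hθ) this
  | foldm h _ ih =>
    exact .foldm (h.subst hθ) (by simpa only [Ty.subst, inst_subst] using ih hθ)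
  | outn _ ih => rw [inst_subst]; exact .outn (ih hθ)
  | unfoldn h _ ih =>
    exact .unfoldn (h.subst hθ) (by simpa only [Ty.subst, inst_subst] using ih hθ)

theorem HasType.tshift {Γ : List Ty} {t : Tm} {A : Ty} (h : HasType Γ t A) (m : ℕ) :
    HasType (shiftC m Γ) (t.tshift m) (A.shift m) := by
  rw [shiftC_eq, Ty.shift, Ty.rename_eq_subst]; exact h.tsubst fun _ => trivial

theorem HasType.tinst {Γ : List Ty} {t : Tm} {A B : Ty} (h : HasType (shiftC 1 Γ) t A)
    (hB : B.Adm) : HasType Γ (t.tinst B) (A.inst B) := by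
  have := h.tsubst (adm_single hB 0)
  simp only [shiftC, List.map_map, Function.comp_def] at this
  have e : Γ.map (fun A => (A.shift 1).subst (Ty.single 0 B)) = Γ := by
    conv_rhs => rw [← List.map_id Γ]
    exact List.map_congr_left fun A _ => Ty.shift_inst A B
  rwa [e] at this

theorem HasType.rename {Γ : List Ty} {t : Tm} {A : Ty} (h : HasType Γ t A) {Δ : List Ty}
    {ρ : ℕ → ℕ} (hρ : ∀ n A, Γ[n]? = some A → Δ[ρ n]? = some A) : HasType Δ (t.rename ρ) A := by
  have hup : ∀ {Γ Δ : List Ty} {ρ : ℕ → ℕ} (B : Ty),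
      (∀ n A, Γ[n]? = some A → Δ[ρ n]? = some A) →
      ∀ n A, (B :: Γ)[n]? = some A → (B :: Δ)[upr ρ n]? = some A := by
    rintro Γ Δ ρ B h (_ | n) A hA
    · exact hA
    · exact h n A hA
  induction h generalizing Δ ρ with
  | var h h' => exact .var (hρ _ _ h) h'
  | lam h _ ih => exact .lam h (ih (hup _ hρ))
  | app _ _ ih ih' => exact .app (ih hρ) (ih' hρ)
  | tlam h _ ih =>
    refine .tlam h (ih fun n A hA => ?_)
    simp only [shiftC, List.getElem?_map, Option.map_eq_some_iff] at hA ⊢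
    obtain ⟨B, hB, rfl⟩ := hA
    exact ⟨B, hρ _ _ hB, rfl⟩
  | tapp _ h ih => exact .tapp (ih hρ) h
  | pair _ _ ih ih' => exact .pair (ih hρ) (ih' hρ)
  | fst _ ih => exact .fst (ih hρ)
  | snd _ ih => exact .snd (ih hρ)
  | star => exact .star
  | inl h _ ih => exact .inl h (ih hρ)
  | inr h _ ih => exact .inr h (ih hρ)
  | case _ _ _ ih ih' ih'' => exact .case (ih hρ) (ih' (hup _ hρ)) (ih'' (hup _ hρ))
  | abort h _ ih => exact .abort h (ih hρ)
  | inm h _ ih => exact .inm h (ih hρ)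
  | foldm h _ ih => exact .foldm h (ih hρ)
  | outn _ ih => exact .outn (ih hρ)
  | unfoldn h _ ih => exact .unfoldn h (ih hρ)

theorem HasType.shift {Γ : List Ty} {t : Tm} {A : Ty} (h : HasType Γ t A) (Ξ : List Ty) {k : ℕ}
    (hk : Ξ.length = k) : HasType (Ξ ++ Γ) (t.shift k) A :=
  h.rename fun n A hA => by
    subst hk; rwa [List.getElem?_append_right (by omega), Nat.add_sub_cancel]

theorem HasType.shift_one {Γ : List Ty} {t : Tm} {A : Ty} (h : HasType Γ t A) (B : Ty) :
    HasType (B :: Γ) (t.shift 1) A := h.shift [B] rfl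

/-- `σ` is a substitution from `Γ` to `Δ`. -/
def SubTy (Δ : List Ty) (σ : ℕ → Tm) (Γ : List Ty) : Prop :=
  ∀ n A, Γ[n]? = some A → A.Adm → HasType Δ (σ n) A

theorem SubTy.scons {Γ Δ : List Ty} {σ : ℕ → Tm} {a : Tm} {A : Ty} (h : SubTy Δ σ Γ)
    (ha : A.Adm → HasType Δ a A) : SubTy Δ (Tm.scons a σ) (A :: Γ) := by
  rintro (_ | n) B hB hB'
  · cases hB; exact ha hB'
  · exact h n B hB hB'

theorem SubTy.var_add (Ξ Γ : List Ty) {k : ℕ} (hk : Ξ.length = k) :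
    SubTy (Ξ ++ Γ) (fun n => .var (n + k)) Γ := fun n A hA hA' =>
  .var (by subst hk; rwa [List.getElem?_append_right (by omega), Nat.add_sub_cancel]) hA'

theorem SubTy.var (Γ : List Ty) : SubTy Γ Tm.var Γ := fun _ _ hA hA' => .var hA hA'

theorem SubTy.up {Γ Δ : List Ty} {σ : ℕ → Tm} (h : SubTy Δ σ Γ) (A : Ty) :
    SubTy (A :: Δ) (Tm.up σ) (A :: Γ) :=
  SubTy.scons (fun n B hB hB' => (h n B hB hB').shift_one A) fun hA => .var rfl hA

theorem SubTy.tshift {Γ Δ : List Ty} {σ : ℕ → Tm} (h : SubTy Δ σ Γ) (m : ℕ) :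
    SubTy (shiftC m Δ) (fun n => (σ n).tshift m) (shiftC m Γ) := by
  intro n A hA hA'
  simp only [shiftC, List.getElem?_map, Option.map_eq_some_iff] at hA
  obtain ⟨B, hB, rfl⟩ := hA
  exact (h n B hB hA'.of_shift).tshift m

theorem HasType.subst {Γ : List Ty} {t : Tm} {A : Ty} (h : HasType Γ t A) {Δ : List Ty}
    {σ : ℕ → Tm} (hσ : SubTy Δ σ Γ) : HasType Δ (t.subst σ) A := by
  induction h generalizing Δ σ with
  | var h h' => exact hσ _ _ h h'
  | lam h _ ih => exact .lam h (ih (hσ.up _))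
  | app _ _ ih ih' => exact .app (ih hσ) (ih' hσ)
  | tlam h _ ih => exact .tlam h (ih (hσ.tshift 1))
  | tapp _ h ih => exact .tapp (ih hσ) h
  | pair _ _ ih ih' => exact .pair (ih hσ) (ih' hσ)
  | fst _ ih => exact .fst (ih hσ)
  | snd _ ih => exact .snd (ih hσ)
  | star => exact .star
  | inl h _ ih => exact .inl h (ih hσ)
  | inr h _ ih => exact .inr h (ih hσ)
  | case _ _ _ ih ih' ih'' => exact .case (ih hσ) (ih' (hσ.up _)) (ih'' (hσ.up _))
  | abort h _ ih => exact .abort h (ih hσ)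
  | inm h _ ih => exact .inm h (ih hσ)
  | foldm h _ ih => exact .foldm h (ih hσ)
  | outn _ ih => exact .outn (ih hσ)
  | unfoldn h _ ih => exact .unfoldn h (ih hσ)

theorem HasType.plug {Γ : List Ty} {t a : Tm} {A B : Ty} (h : HasType (A :: Γ) t B) {Ξ : List Ty}
    {k : ℕ} (hk : Ξ.length = k) (ha : HasType (Ξ ++ Γ) a A) : HasType (Ξ ++ Γ) (t.plug k a) B :=
  h.subst ((SubTy.var_add Ξ Γ hk).scons fun _ => ha)

theorem HasType.plug_zero {Γ : List Ty} {t a : Tm} {A B : Ty} (h : HasType (A :: Γ) t B)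
    (ha : HasType Γ a A) : HasType Γ (t.plug 0 a) B := h.plug (Ξ := []) rfl ha

theorem HasType.plug_one {Γ : List Ty} {t a : Tm} {A B C : Ty} (h : HasType (A :: Γ) t B)
    (ha : HasType (C :: Γ) a A) : HasType (C :: Γ) (t.plug 1 a) B := h.plug (Ξ := [C]) rfl ha

theorem HasType.append {Γ : List Ty} {t : Tm} {A : Ty} (h : HasType Γ t A) (Δ : List Ty) :
    HasType (Γ ++ Δ) t A := by
  have := h.rename (Δ := Γ ++ Δ) (ρ := fun n => n) fun n A hA => by
    rw [List.getElem?_append_left (List.getElem?_eq_some_iff.1 hA).1]; exact hA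
  rwa [Tm.rename_eq_subst, show (fun n => Tm.var n) = Tm.var from rfl, Tm.subst_var] at this

/-- The pending substitution `σ` carries the induction on the list: each type application moves its
argument from the outermost quantifier to the head of `σ`. -/
theorem HasType.tapps {Γ : List Ty} {t : Tm} {A : Ty} {σ : ℕ → Ty} {Cs : List Ty} {m : ℕ}
    (hm : Cs.length = m) (h : HasType Γ t ((allN m A).subst σ)) (hC : ∀ C ∈ Cs, C.Adm) :
    HasType Γ (t.tapps Cs) (A.subst (Ty.sconsL Cs σ)) := by
  induction Cs generalizing t σ m with
  | nil => subst hm; exact h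
  | cons C Cs ih =>
    subst hm
    refine ih rfl ?_ fun D hD => hC D (by simp [hD])
    have := HasType.tapp (A := (allN Cs.length A).subst (Ty.up σ)) h (hC C (by simp))
    rwa [subst_up_inst] at this

theorem adm_tvars {m : ℕ} : ∀ C ∈ Ty.tvars m, C.Adm := by
  intro C hC
  obtain ⟨n, _, rfl⟩ := List.mem_map.1 hC
  trivial

theorem HasType.tappVars {Γ : List Ty} {t : Tm} {A : Ty} {m : ℕ}
    (h : HasType Γ t ((allN m A).shift m)) : HasType Γ (t.tappVars m) A := by
  rw [Ty.shift, Ty.rename_eq_subst] at h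
  have := h.tapps (length_tvars m) adm_tvars
  rwa [sconsL_tvars_shift, Ty.subst_var] at this

theorem HasType.tlamN {Γ : List Ty} {t : Tm} {A : Ty} {m : ℕ} (hA : (allN m A).Adm)
    (h : HasType (shiftC m Γ) t A) : HasType Γ (tlamN m t) (allN m A) := by
  induction m generalizing Γ with
  | zero => rwa [shiftC_zero] at h
  | succ m ih =>
    refine .tlam hA (ih hA.1 ?_)
    rwa [shiftC_shiftC, Nat.add_comm]

theorem HasType.lams {Γ : List Ty} {t : Tm} {As : List Ty} {B : Ty} (hA : ∀ A ∈ As, A.Adm)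
    (h : HasType (As.reverse ++ Γ) t B) : HasType Γ (lams As t) (arrows As B) := by
  induction As generalizing Γ with
  | nil => exact h
  | cons A As ih =>
    exact .lam (hA A (by simp)) (ih (fun C hC => hA C (by simp [hC])) (by simpa using h))

theorem HasType.apps {Γ : List Ty} {t : Tm} {As : List Ty} {us : List Tm} {B : Ty}
    (h : HasType Γ t (arrows As B)) (hu : List.Forall₂ (HasType Γ) us As) :
    HasType Γ (apps t us) B := by
  induction hu generalizing t with
  | nil => exact h
  | cons ha _ ih => exact ih (.app h ha)

/-! ### Typing of the functorial action -/

/-- The Boolean records the variance. In the domain of an arrow it is negated while `σ` and `τ` are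
exchanged, so the typing required of `t` stays the same. At a fixpoint the same type is put in front
of both substitutions, so that they still differ at one variable only. -/
theorem HasType.fmap {A : Ty} {b : Bool} {i : ℕ} {σ τ : ℕ → Ty} {t : Tm} {Γ : List Ty}
    (hA : A.Adm) (hs : OnlySign b i A) (hσ : ∀ n, (σ n).Adm) (hτ : ∀ n, (τ n).Adm)
    (hst : ∀ n, n ≠ i → σ n = τ n)
    (ht : HasType (bif b then σ i :: Γ else τ i :: Γ) t (bif b then τ i else σ i)) :
    HasType (A.subst σ :: Γ) (fmap A i σ τ t) (A.subst τ) := by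
  induction A generalizing b i σ τ t Γ with
  | var n =>
    simp only [Tm.fmap]
    split
    · rename_i h; subst h
      have : b = true := hs rfl
      subst this; exact ht
    · rename_i h; exact .var (by simp [Ty.subst, hst n h]) (hτ n)
  | one => exact .var rfl trivial
  | zero => exact .var rfl trivial
  | arr A B ihA ihB =>
    refine .lam (hA.1.subst hτ) ((ihB hA.2 hs.2 hσ hτ hst ht).plug (Ξ := [_, _]) rfl
      (.app (.var rfl (hA.subst hσ)) ((ihA hA.1 hs.1 hτ hσ (fun n h => (hst n h).symm) ?_).plug
        (Ξ := [_, _]) rfl (.var rfl (hA.1.subst hτ)))))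
    cases b <;> exact ht
  | prod A B ihA ihB =>
    have h0 : HasType ((Ty.prod A B).subst σ :: Γ) (.var 0) ((Ty.prod A B).subst σ) :=
      .var rfl (hA.subst hσ)
    exact .pair ((ihA hA.1 hs.1 hσ hτ hst ht).plug_one (.fst h0))
      ((ihB hA.2 hs.2 hσ hτ hst ht).plug_one (.snd h0))
  | sum A B ihA ihB =>
    exact .case (.var rfl (hA.subst hσ))
      (.inl (hA.2.subst hτ) ((ihA hA.1 hs.1 hσ hτ hst ht).plug (Ξ := [_, _]) rfl
        (.var rfl (hA.1.subst hσ))))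
      (.inr (hA.1.subst hτ) ((ihB hA.2 hs.2 hσ hτ hst ht).plug (Ξ := [_, _]) rfl
        (.var rfl (hA.2.subst hσ))))
  | all A ih =>
    refine .tlam (hA.subst hτ) ((ih hA.1 hs (adm_up hσ) (adm_up hτ) ?_ ?_).plug_one
      (Γ := shiftC 1 Γ) (C := ((Ty.all A).subst σ).shift 1) ?_)
    · rintro (_ | n) h
      · rfl
      · simp only [Ty.up, Ty.scons]; rw [hst n (by omega)]
    · have := ht.tshift 1
      cases b <;> exact this
    · have h0 : HasType (((Ty.all A).subst σ).shift 1 :: shiftC 1 Γ) (.var 0)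
        (((Ty.all A).subst σ).shift 1) := .var rfl ((hA.subst hσ).shift 1)
      exact h0.tappVars (m := 1)
  | mu A ih =>
    have hM := hA.subst hτ
    have hM' := hA.subst hσ
    -- The target fixpoint is the carrier of the fold, and it stands at variable `0` in both
    -- substitutions; in the case of `ν` below the source fixpoint plays this role.
    have hsc : ∀ n, n ≠ i + 1 → Ty.scons (.mu (A.subst (Ty.up τ))) σ n =
        Ty.scons (.mu (A.subst (Ty.up τ))) τ n := by
      rintro (_ | n) h
      · rfl
      · exact hst n (by omega)
    refine .app (.foldm (B := .mu (A.subst (Ty.up τ))) hM' ?_) (.var rfl hM')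
    rw [subst_up_inst]
    refine .lam (hA.1.subst (adm_scons hM hσ)) (.inm hM ?_)
    rw [subst_up_inst]
    refine (ih hA.1 hs (adm_scons hM hσ) (adm_scons hM hτ) hsc ?_).plug (Ξ := [_, _]) rfl
      (.var rfl (hA.1.subst (adm_scons hM hσ)))
    cases b <;> exact ht
  | nu A ih =>
    have hM := hA.subst hτ
    have hM' := hA.subst hσ
    have hsc : ∀ n, n ≠ i + 1 → Ty.scons (.nu (A.subst (Ty.up σ))) σ n =
        Ty.scons (.nu (A.subst (Ty.up σ))) τ n := by
      rintro (_ | n) h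
      · rfl
      · exact hst n (by omega)
    refine .app (.unfoldn (B := .nu (A.subst (Ty.up σ))) hM ?_) (.var rfl hM')
    rw [subst_up_inst]
    refine .lam hM' ((ih hA.1 hs (adm_scons hM' hσ) (adm_scons hM' hτ) hsc ?_).plug
      (Ξ := [_, _]) rfl ?_)
    · cases b <;> exact ht
    · rw [← subst_up_inst]; exact .outn (.var rfl hM')

theorem HasType.act {A E F : Ty} {b : Bool} {m : ℕ} {t : Tm} {Γ : List Ty} (hA : A.Adm)
    (hs : OnlySign b m A) (hE : E.Adm) (hF : F.Adm)
    (ht : HasType (bif b then E :: Γ else F :: Γ) t (bif b then F else E)) :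
    HasType (A.subst (single m E) :: shiftC m Γ) (act A m E F t) (A.subst (single m F)) := by
  refine HasType.fmap hA hs (adm_single hE m) (adm_single hF m) (fun n hn => single_ne E F hn) ?_
  simp only [single_self]
  cases b <;> exact ht.tshift m

theorem HasType.act_zero {A E F : Ty} {b : Bool} {t : Tm} {Γ : List Ty} (hA : A.Adm)
    (hs : OnlySign b 0 A) (hE : E.Adm) (hF : F.Adm)
    (ht : HasType (bif b then E :: Γ else F :: Γ) t (bif b then F else E)) :
    HasType (A.inst E :: Γ) (Tm.act A 0 E F t) (A.inst F) := by
  have := HasType.act hA hs hE hF ht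
  rwa [shiftC_zero] at this

/-! ### The `ε`-theory: typing, weakening, substitution -/

theorem forall₂_ofFn {α β : Type} {R : α → β → Prop} {l : List β} {f : Fin l.length → α}
    (h : ∀ k, R (f k) (l.get k)) : List.Forall₂ R (List.ofFn f) l :=
  List.forall₂_iff_get.2 ⟨by simp, fun i h₁ h₂ => by simpa using h ⟨i, h₂⟩⟩

theorem HasType.apps_tapp {α : Type} {Γ : List Ty} {t : Tm} {Ps : List α} {prem : α → Ty}
    {B E : Ty} {e : Fin Ps.length → Tm} (h : HasType Γ t (.all (arrows (Ps.map prem) B)))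
    (hE : E.Adm) (he : ∀ k, HasType Γ (e k) ((prem (Ps.get k)).inst E)) :
    HasType Γ (Tm.apps (.tapp t E) (List.ofFn e)) (B.inst E) := by
  have h1 := HasType.tapp h hE
  rw [Ty.inst, arrows_subst, List.map_map] at h1
  exact h1.apps (List.forall₂_map_right_iff.2 (forall₂_ofFn he))

/-- Each rule carries enough typing to recover that of both sides. Below, typings of reducts are
read off from equations in this way instead of being rebuilt. -/
theorem EpsEq.hasType {Γ : List Ty} {t u : Tm} {A : Ty} (h : EpsEq Γ t u A) :
    HasType Γ t A ∧ HasType Γ u A := by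
  induction h with
  | refl h => exact ⟨h, h⟩
  | symm _ ih => exact ih.symm
  | trans _ _ ih ih' => exact ⟨ih.1, ih'.2⟩
  | lam h _ ih => exact ⟨.lam h ih.1, .lam h ih.2⟩
  | app _ _ ih ih' => exact ⟨.app ih.1 ih'.1, .app ih.2 ih'.2⟩
  | tlam h _ ih => exact ⟨.tlam h ih.1, .tlam h ih.2⟩
  | tapp _ h ih => exact ⟨.tapp ih.1 h, .tapp ih.2 h⟩
  | pair _ _ ih ih' => exact ⟨.pair ih.1 ih'.1, .pair ih.2 ih'.2⟩
  | fst _ ih => exact ⟨.fst ih.1, .fst ih.2⟩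
  | snd _ ih => exact ⟨.snd ih.1, .snd ih.2⟩
  | inl h _ ih => exact ⟨.inl h ih.1, .inl h ih.2⟩
  | inr h _ ih => exact ⟨.inr h ih.1, .inr h ih.2⟩
  | case _ _ _ i1 i2 i3 => exact ⟨.case i1.1 i2.1 i3.1, .case i1.2 i2.2 i3.2⟩
  | abort h _ ih => exact ⟨.abort h ih.1, .abort h ih.2⟩
  | inm h _ ih => exact ⟨.inm h ih.1, .inm h ih.2⟩
  | foldm h _ ih => exact ⟨.foldm h ih.1, .foldm h ih.2⟩
  | outn _ ih => exact ⟨.outn ih.1, .outn ih.2⟩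
  | unfoldn h _ ih => exact ⟨.unfoldn h ih.1, .unfoldn h ih.2⟩
  | beta h h' => exact ⟨.app (.lam h'.adm h) h', h.plug_zero h'⟩
  | tbeta h h' =>
    refine ⟨.tapp h h', ?_⟩
    cases h with
    | tlam _ h => exact h.tinst h'
  | fst_beta h h' => exact ⟨.fst (.pair h h'), h⟩
  | snd_beta h h' => exact ⟨.snd (.pair h h'), h'⟩
  | inl_beta h h1 h2 h3 => exact ⟨.case (.inl h h1) h2 h3, h2.plug_zero h1⟩
  | inr_beta h h1 h2 h3 => exact ⟨.case (.inr h h1) h2 h3, h3.plug_zero h1⟩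
  | @mu_beta _ _ _ _ B h ht hu =>
    exact ⟨.app (.foldm h ht) (.inm h hu), .app ht ((HasType.act_zero (b := true) h.1 h.2 h
      ht.adm.2 (.app ((HasType.foldm h ht).shift_one _) (.var rfl h))).plug_zero hu)⟩
  | nu_beta h ht hu =>
    exact ⟨.outn (.app (.unfoldn h ht) hu), (HasType.act_zero (b := true) h.1 h.2 ht.adm.1 h
      (.app ((HasType.unfoldn h ht).shift_one _) (.var rfl ht.adm.1))).plug_zero (.app ht hu)⟩
  | eta h => exact ⟨h, .lam h.adm.1 (.app (h.shift_one _) (.var rfl h.adm.1))⟩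
  | teta h => exact ⟨h, .tlam h.adm ((h.tshift 1).tappVars (m := 1))⟩
  | prod_eta h => exact ⟨h, .pair (.fst h) (.snd h)⟩
  | one_eta h => exact ⟨h, .star⟩
  | sum_eta h h' =>
    exact ⟨h'.plug_zero h, .case h (h'.plug_one (.inl h.adm.2 (.var rfl h.adm.1)))
      (h'.plug_one (.inr h.adm.1 (.var rfl h.adm.2)))⟩
  | zero_eta h h' => exact ⟨h'.plug_zero h, .abort h'.adm h⟩
  | mu_eta h hu ht _ _ => exact ⟨ht, .app ((HasType.foldm h hu).shift_one _) (.var rfl h)⟩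
  | nu_eta hu ht _ _ =>
    exact ⟨ht, .app ((HasType.unfoldn ht.adm hu).shift_one _) (.var rfl hu.adm.1)⟩
  | epsL Ps B E F t v e f hs hE hF ht hv he hf _ _ =>
    have hB : B.Adm := ht.adm.of_univL.2
    exact ⟨(HasType.act_zero (b := true) hB hs.2 hE hF hv).plug_zero (ht.apps_tapp hE he), ht.apps_tapp hF hf⟩
  | epsR Qs B E F t v e f hs hE hF ht hv he hf _ _ =>
    have hB : B.Adm := ht.adm.of_univR.2
    exact ⟨(HasType.act_zero (b := false) hB hs.2 hF hE hv).plug_zero (ht.apps_tapp hF hf), ht.apps_tapp hE he⟩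

/-- Variables are counted from the front of the context, so types added at the far end change no
term and every rule can be replayed. This is the only weakening of the theory proved by induction on
derivations. -/
theorem EpsEq.append {Γ : List Ty} {t u : Tm} {A : Ty} (h : EpsEq Γ t u A) (Δ : List Ty) :
    EpsEq (Γ ++ Δ) t u A := by
  induction h generalizing Δ with
  | refl h => exact .refl (h.append Δ)
  | symm _ ih => exact .symm (ih Δ)
  | trans _ _ ih ih' => exact .trans (ih Δ) (ih' Δ)
  | lam h _ ih => exact .lam h (ih Δ)
  | app _ _ ih ih' => exact .app (ih Δ) (ih' Δ)
  | tlam h _ ih => exact .tlam h (by rw [shiftC_append]; exact ih _)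
  | tapp _ h ih => exact .tapp (ih Δ) h
  | pair _ _ ih ih' => exact .pair (ih Δ) (ih' Δ)
  | fst _ ih => exact .fst (ih Δ)
  | snd _ ih => exact .snd (ih Δ)
  | inl h _ ih => exact .inl h (ih Δ)
  | inr h _ ih => exact .inr h (ih Δ)
  | case _ _ _ i1 i2 i3 => exact .case (i1 Δ) (i2 Δ) (i3 Δ)
  | abort h _ ih => exact .abort h (ih Δ)
  | inm h _ ih => exact .inm h (ih Δ)
  | foldm h _ ih => exact .foldm h (ih Δ)
  | outn _ ih => exact .outn (ih Δ)
  | unfoldn h _ ih => exact .unfoldn h (ih Δ)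
  | beta h h' => exact .beta (h.append Δ) (h'.append Δ)
  | tbeta h h' => exact .tbeta (h.append Δ) h'
  | fst_beta h h' => exact .fst_beta (h.append Δ) (h'.append Δ)
  | snd_beta h h' => exact .snd_beta (h.append Δ) (h'.append Δ)
  | inl_beta h h1 h2 h3 => exact .inl_beta h (h1.append Δ) (h2.append Δ) (h3.append Δ)
  | inr_beta h h1 h2 h3 => exact .inr_beta h (h1.append Δ) (h2.append Δ) (h3.append Δ)
  | mu_beta h ht hu => exact .mu_beta h (ht.append Δ) (hu.append Δ)
  | nu_beta h ht hu => exact .nu_beta h (ht.append Δ) (hu.append Δ)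
  | eta h => exact .eta (h.append Δ)
  | teta h => exact .teta (h.append Δ)
  | prod_eta h => exact .prod_eta (h.append Δ)
  | one_eta h => exact .one_eta (h.append Δ)
  | sum_eta h h' => exact .sum_eta (h.append Δ) (h'.append Δ)
  | zero_eta h h' => exact .zero_eta (h.append Δ) (h'.append Δ)
  | mu_eta h hu ht _ ih => exact .mu_eta h (hu.append Δ) (ht.append Δ) (ih Δ)
  | nu_eta hu ht _ ih => exact .nu_eta (hu.append Δ) (ht.append Δ) (ih Δ)
  | epsL Ps B E F t v e f hs hE hF ht hv he hf _ ih =>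
    refine .epsL Ps B E F t v e f hs hE hF (ht.append Δ) (hv.append Δ) (fun k => (he k).append Δ)
      (fun k => (hf k).append Δ) fun k => ?_
    have := ih k (shiftC (Ps.get k).1 Δ)
    rwa [List.append_assoc, ← shiftC_append] at this
  | epsR Qs B E F t v e f hs hE hF ht hv he hf _ ih =>
    refine .epsR Qs B E F t v e f hs hE hF (ht.append Δ) (hv.append Δ) (fun k => (he k).append Δ)
      (fun k => (hf k).append Δ) fun k => ?_
    have := ih k (shiftC (Qs.get k).1 Δ)
    rwa [List.cons_append, ← shiftC_append] at this

theorem HasType.subst_eq_self {Γ : List Ty} {t : Tm} {A : Ty} (h : HasType Γ t A) :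
    ∀ σ : ℕ → Tm, (∀ n, n < Γ.length → σ n = .var n) → t.subst σ = t := by
  have hup : ∀ {Γ : List Ty} {σ : ℕ → Tm} (A : Ty), (∀ n, n < Γ.length → σ n = .var n) →
      ∀ n, n < (A :: Γ).length → Tm.up σ n = .var n := by
    rintro Γ σ A h (_ | n) hn
    · rfl
    · simp only [Tm.up, Tm.scons]; rw [h n (by simpa using hn)]; rfl
  induction h with
  | var h _ => exact fun σ hσ => hσ _ (List.getElem?_eq_some_iff.1 h).1
  | lam h _ ih => exact fun σ hσ => congrArg _ (ih _ (hup _ hσ))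
  | tlam h _ ih =>
    refine fun σ hσ => congrArg _ (ih _ fun n hn => ?_)
    rw [hσ n (by simpa [shiftC] using hn)]; rfl
  | case _ _ _ i1 i2 i3 =>
    intro σ hσ; simp only [Tm.subst]; rw [i1 σ hσ, i2 _ (hup _ hσ), i3 _ (hup _ hσ)]
  | _ => intro σ hσ; simp_all [Tm.subst]

theorem HasType.subst_closed {t : Tm} {A : Ty} (h : HasType [] t A) (σ : ℕ → Tm) :
    t.subst σ = t := h.subst_eq_self σ (by simp)

/-- No induction on derivations is needed: abstracting the context by `λ` turns the substitution
into applications, congruence replaces the arguments, and β undoes the abstraction. Once the context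
is empty, only weakening at the far end remains. -/
theorem EpsEq.subst {Γ : List Ty} {t u : Tm} {A : Ty} (h : EpsEq Γ t u A)
    (hΓ : ∀ B ∈ Γ, B.Adm) {Δ : List Ty} {σ τ : ℕ → Tm}
    (hσ : ∀ n B, Γ[n]? = some B → EpsEq Δ (σ n) (τ n) B) :
    EpsEq Δ (t.subst σ) (u.subst τ) A := by
  induction Γ generalizing t u A σ τ with
  | nil =>
    rw [h.hasType.1.subst_closed, h.hasType.2.subst_closed]; exact h.append Δ
  | cons B Γ ih =>
    have hB := hΓ B (by simp)
    -- The first variable is abstracted while the remaining ones are substituted by induction; `aux`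
    -- then reinserts the first value on both sides by β.
    have h1 := ih (.lam hB h) (fun C hC => hΓ C (by simp [hC])) (σ := fun n => σ (n + 1))
      (τ := fun n => τ (n + 1)) fun n C hC => hσ (n + 1) C hC
    have h0 := hσ 0 B rfl
    have aux : ∀ {t : Tm} {σ : ℕ → Tm}, HasType Δ (Tm.subst (.lam B t) fun n => σ (n + 1)) (.arr B A) →
        HasType Δ (σ 0) B → EpsEq Δ (.app (Tm.subst (.lam B t) fun n => σ (n + 1)) (σ 0))
          (t.subst σ) A := by
      intro t σ ht h0
      have := EpsEq.beta (t := t.subst (Tm.up fun n => σ (n + 1))) (by cases ht; assumption) h0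
      rw [Tm.subst_up_plug] at this
      rwa [show Tm.scons (σ 0) (fun n => σ (n + 1)) = σ by funext n; cases n <;> rfl] at this
    exact ((aux h1.hasType.1 h0.hasType.1).symm.trans (.app h1 h0)).trans
      (aux h1.hasType.2 h0.hasType.2)

/-- All types of the context are admissible. -/
def CtxAdm (Γ : List Ty) : Prop := ∀ B ∈ Γ, B.Adm

theorem CtxAdm.cons {Γ : List Ty} (h : CtxAdm Γ) {A : Ty} (hA : A.Adm) : CtxAdm (A :: Γ) := by
  simpa [CtxAdm] using ⟨hA, h⟩

theorem CtxAdm.append {Γ Δ : List Ty} (h : CtxAdm Γ) (h' : CtxAdm Δ) : CtxAdm (Γ ++ Δ) :=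
  fun B hB => (List.mem_append.1 hB).elim (h B) (h' B)

theorem CtxAdm.shiftC {Γ : List Ty} (h : CtxAdm Γ) (m : ℕ) : CtxAdm (shiftC m Γ) := by
  intro B hB
  obtain ⟨A, hA, rfl⟩ := List.mem_map.1 hB
  exact (h A hA).shift m

theorem EpsEq.plug {Γ Ξ : List Ty} {t u a a' : Tm} {A B : Ty} {k : ℕ} (h : EpsEq (A :: Γ) t u B)
    (hΓ : CtxAdm Γ) (hk : Ξ.length = k) (ha : EpsEq (Ξ ++ Γ) a a' A) :
    EpsEq (Ξ ++ Γ) (t.plug k a) (u.plug k a') B := by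
  refine h.subst (hΓ.cons ha.hasType.1.adm) ?_
  rintro (_ | n) C hC
  · cases hC; exact ha
  · exact .refl (SubTy.var_add Ξ Γ hk n C hC (hΓ _ (List.mem_of_getElem? hC)))

theorem EpsEq.plug_zero {Γ : List Ty} {t u a a' : Tm} {A B : Ty} (h : EpsEq (A :: Γ) t u B)
    (hΓ : CtxAdm Γ) (ha : EpsEq Γ a a' A) : EpsEq Γ (t.plug 0 a) (u.plug 0 a') B :=
  h.plug (Ξ := []) hΓ rfl ha

theorem EpsEq.plug_one {Γ : List Ty} {t u a a' : Tm} {A B C : Ty} (h : EpsEq (A :: Γ) t u B)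
    (hΓ : CtxAdm Γ) (ha : EpsEq (C :: Γ) a a' A) : EpsEq (C :: Γ) (t.plug 1 a) (u.plug 1 a') B :=
  h.plug (Ξ := [C]) hΓ rfl ha

theorem HasType.var_zero {Γ : List Ty} {A : Ty} (hA : A.Adm) : HasType (A :: Γ) (.var 0) A :=
  .var rfl hA

theorem EpsEq.var_zero {Γ : List Ty} {A : Ty} (hA : A.Adm) :
    EpsEq (A :: Γ) (.var 0) (.var 0) A := .refl (.var_zero hA)

theorem EpsEq.shift {Γ : List Ty} {t u : Tm} {A : Ty} (h : EpsEq Γ t u A) (hΓ : CtxAdm Γ)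
    (Ξ : List Ty) {k : ℕ} (hk : Ξ.length = k) : EpsEq (Ξ ++ Γ) (t.shift k) (u.shift k) A := by
  simp only [Tm.shift, Tm.rename_eq_subst]
  exact h.subst hΓ fun n C hC =>
    .refl (SubTy.var_add Ξ Γ hk n C hC (hΓ _ (List.mem_of_getElem? hC)))

theorem EpsEq.tapps {Γ : List Ty} {t u : Tm} {A : Ty} {σ : ℕ → Ty} {Cs : List Ty} {m : ℕ}
    (hm : Cs.length = m) (h : EpsEq Γ t u ((allN m A).subst σ)) (hC : ∀ C ∈ Cs, C.Adm) :
    EpsEq Γ (t.tapps Cs) (u.tapps Cs) (A.subst (Ty.sconsL Cs σ)) := by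
  induction Cs generalizing t u σ m with
  | nil => subst hm; exact h
  | cons C Cs ih =>
    subst hm
    refine ih rfl ?_ fun D hD => hC D (by simp [hD])
    have := EpsEq.tapp (A := (allN Cs.length A).subst (Ty.up σ)) h (hC C (by simp))
    rwa [subst_up_inst] at this

theorem EpsEq.tappVars {Γ : List Ty} {t u : Tm} {A : Ty} {m : ℕ}
    (h : EpsEq Γ t u ((allN m A).shift m)) : EpsEq Γ (t.tappVars m) (u.tappVars m) A := by
  rw [Ty.shift, Ty.rename_eq_subst] at h
  have := h.tapps (length_tvars m) adm_tvars
  rwa [sconsL_tvars_shift, Ty.subst_var] at this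

/-! ### The identity law of the functorial action -/

theorem fmap_congr {A : Ty} {i : ℕ} {σ τ σ' τ' : ℕ → Ty} {t t' : Tm}
    (hσ : ∀ n, occ n A = true → σ n = σ' n) (hτ : ∀ n, occ n A = true → τ n = τ' n)
    (ht : occ i A = true → t = t') : fmap A i σ τ t = fmap A i σ' τ' t' := by
  have := fmap_rename (A := A) (ρ := fun n => n) (i := i) (j := i) (fun _ _ => Iff.rfl) hσ hτ ht
  rwa [Ty.rename_eq_subst, show (fun n => Ty.var n) = Ty.var from rfl, Ty.subst_var] at this

/-- The identity law for weakened types, which follows from the uniformity of the terms of type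
`∀Z. Z ⇒ Z`: the term `fold_Z(λx.x)(in_Z z)` is equal to `z` for a variable type `Z`. -/
theorem fmap_shift_one {D E F : Ty} {t : Tm} {Γ : List Ty} (hD : D.Adm) :
    EpsEq (D :: Γ) (fmap (D.shift 1) 0 (Ty.scons E Ty.var) (Ty.scons F Ty.var) t) (.var 0) D := by
  have hmu : ∀ {D : Ty}, D.Adm → (Ty.mu (D.shift 1)).Adm := fun h =>
    ⟨h.shift 1, OnlySign.of_occ_false (occ_shift_one _)⟩
  have hid : ∀ {D : Ty} {Γ}, D.Adm → HasType Γ (.lam D (.var 0)) (.arr D D) :=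
    fun h => .lam h (.var_zero h)
  -- This term is computed in two ways: the rule for `fold` turns it into the action of the constant
  -- functor `D`, and polymorphism turns it into its argument.
  let X (D : Ty) : Tm := .app (.foldm (D.shift 1) (.lam D (.var 0))) (.inm (D.shift 1) (.var 0))
  have step : ∀ {D : Ty} {Γ}, D.Adm → EpsEq (D :: Γ) (X D)
      ((act (D.shift 1) 0 (.mu (D.shift 1)) D (.app ((Tm.foldm (D.shift 1)
        (.lam D (.var 0))).shift 1) (.var 0))).plug 0 (.var 0)) D := by
    intro D Γ hD
    have h1 := EpsEq.mu_beta (Γ := D :: Γ) (t := .lam D (.var 0)) (u := .var 0) (B := D)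
      (hmu hD) (by rw [shift_inst]; exact hid hD) (by rw [shift_inst]; exact .var_zero hD)
    refine h1.trans ?_
    cases h1.hasType.2 with
    | app h3 h4 =>
      cases h3 with
      | lam _ _ => exact EpsEq.beta (t := .var 0) (.var_zero hD) h4
  -- For a type variable distinct from the fixpoint variable the action is the identity by
  -- definition, so here the computation rule already gives the desired equation.
  have stepZ : EpsEq (Ty.var 0 :: shiftC 1 (D :: Γ)) (X (.var 0)) (.var 0) (.var 0) :=
    step (D := .var 0) trivial
  have hall : (Ty.all (.arr (.var 0) (.var 0))).Adm :=
    ⟨⟨trivial, trivial⟩, .inl ⟨[(0, [])], .var 0, rfl, by simp [SignL, Pos, OnlySign]⟩⟩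
  -- Congruence under `ΛZ` followed by instantiation at `D` makes the equation hold at an arbitrary
  -- type, without any induction on `D`.
  have h1 : EpsEq (D :: Γ) (.tlam (.lam (.var 0) (X (.var 0)))) (.tlam (.lam (.var 0) (.var 0)))
    (.all (.arr (.var 0) (.var 0))) := .tlam hall (.lam trivial stepZ)
  have h2 := EpsEq.tapp h1 hD
  have h3 : EpsEq (D :: Γ) (.lam D (X D)) (.lam D (.var 0)) (.arr D D) :=
    ((EpsEq.tbeta h1.hasType.1 hD).symm.trans h2).trans (EpsEq.tbeta h1.hasType.2 hD)
  have h4 : EpsEq (D :: Γ) (X D) (.var 0) D := by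
    have h5 := EpsEq.app h3 (.var_zero hD)
    have b1 := EpsEq.beta (t := X D) (step (Γ := D :: Γ) hD).hasType.1 (.var_zero hD)
    have b2 := EpsEq.beta (Γ := D :: Γ) (t := .var 0) (.var_zero hD) (.var_zero hD)
    exact (b1.symm.trans h5).trans b2
  refine EpsEq.trans ?_ ((step hD).symm.trans h4)
  rw [act_zero]
  -- Variable `0` does not occur in the weakened type, so the actions for different types at `0` and
  -- different terms are literally the same.
  have e : ∀ s r : Tm, fmap (D.shift 1) 0 (Ty.scons E Ty.var) (Ty.scons F Ty.var) s =
      (fmap (D.shift 1) 0 (Ty.scons (.mu (D.shift 1)) Ty.var) (Ty.scons D Ty.var) r).plug 0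
        (.var 0) := by
    intro s r
    have hocc : ∀ {n}, occ n (D.shift 1) = true → n ≠ 0 := by
      rintro n h rfl; rw [occ_shift_one] at h; cases h
    have h5 := fmap_congr (A := D.shift 1) (i := 0) (σ := Ty.scons (.mu (D.shift 1)) Ty.var)
      (τ := Ty.scons D Ty.var) (σ' := Ty.scons E Ty.var) (τ' := Ty.scons F Ty.var) (t := r)
      (t' := s.subst (Tm.up fun n => .var (n + 1)))
      (by rintro (_ | n) h; exacts [absurd rfl (hocc h), rfl])
      (by rintro (_ | n) h; exacts [absurd rfl (hocc h), rfl])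
      (fun h => absurd rfl (hocc h))
    rw [h5, ← fmap_subst, subst_up_plug]
    conv_lhs => rw [← Tm.subst_var (fmap _ _ _ _ _)]
    congr 1; funext n; cases n <;> rfl
  rw [e t]
  exact .refl (by rw [← act_zero]; exact (step hD).hasType.2)

theorem fmap_shift_succ (D : Ty) (j : ℕ) (σ τ : ℕ → Ty) (t : Tm) :
    fmap (D.shift 1) (j + 1) σ τ t = fmap D j (fun n => σ (n + 1)) (fun n => τ (n + 1)) t :=
  fmap_rename (by simp) (fun _ _ => rfl) (fun _ _ => rfl) fun _ => rfl

/-- The action of a substitution instance of `A` is the action of `A`, if the other types that are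
substituted satisfy the identity law. -/
theorem fmap_subst_ty {A : Ty} {b : Bool} {i j : ℕ} {Θ σ τ : ℕ → Ty} {t : Tm} {Γ : List Ty}
    (hΓ : CtxAdm Γ) (hA : A.Adm) (hs : OnlySign b i A) (hΘ : ∀ n, (Θ n).Adm) (hi : Θ i = .var j)
    (hj : ∀ n, n ≠ i → occ j (Θ n) = false) (hσ : ∀ n, (σ n).Adm) (hτ : ∀ n, (τ n).Adm)
    (hst : ∀ n, n ≠ j → σ n = τ n)
    (ht : HasType (bif b then σ j :: Γ else τ j :: Γ) t (bif b then τ j else σ j))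
    (hd : ∀ n, n ≠ i → ∀ k Γ t, CtxAdm Γ → EpsEq ((Θ n).subst (fun l => (σ l).shift k) :: Γ)
      (fmap (Θ n) j (fun l => (σ l).shift k) (fun l => (σ l).shift k) t) (.var 0)
      ((Θ n).subst (fun l => (σ l).shift k))) :
    EpsEq ((A.subst Θ).subst σ :: Γ) (fmap (A.subst Θ) j σ τ t)
      (fmap A i (fun n => (Θ n).subst σ) (fun n => (Θ n).subst τ) t) ((A.subst Θ).subst τ) := by
  -- Away from `i` the substituted types do not contain `j`, the only variable at which `σ` and `τ`
  -- may differ.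
  have eqon : ∀ {i j : ℕ} {Θ σ τ : ℕ → Ty}, (∀ n, n ≠ i → occ j (Θ n) = false) →
      (∀ n, n ≠ j → σ n = τ n) → ∀ {n l}, n ≠ i → occ l (Θ n) = true → σ l = τ l := by
    intro i j Θ σ τ hj hst n l hn hl
    apply hst; rintro rfl; rw [hj n hn] at hl; cases hl
  induction A generalizing b i j Θ σ τ t Γ with
  | var n =>
    simp only [Ty.subst]
    by_cases h : n = i
    · subst h
      obtain rfl : b = true := hs rfl
      simp only [hi, fmap, if_true, Ty.subst]
      exact .refl ht
    -- Only here do the two actions really differ: one traverses the whole type `Θ n`, the other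
    -- stops at the variable `n`. The assumed identity law closes the gap, taken at weakening `0`.
    · have e := fun l => eqon hj hst (l := l) h
      have := hd n h 0 Γ t hΓ
      simp only [Ty.shift_zero] at this
      rw [← Ty.subst_congr e, fmap_congr (σ' := σ) (τ' := σ) (t' := t) (fun _ _ => rfl)
        (fun l hl => (e l hl).symm) fun _ => rfl]
      simpa only [fmap, if_neg h] using this
  | one => exact .var_zero trivial
  | zero => exact .var_zero trivial
  | arr A B ihA ihB =>
    have hA1 := hA.1.subst hΘ
    have hd' : ∀ n, n ≠ i → ∀ k Γ t, CtxAdm Γ → EpsEq ((Θ n).subst (fun l => (τ l).shift k) :: Γ)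
      (fmap (Θ n) j (fun l => (τ l).shift k) (fun l => (τ l).shift k) t) (.var 0)
      ((Θ n).subst (fun l => (τ l).shift k)) := by
      intro n hn k Γ t hΓ
      have e := fun l (h : occ l (Θ n) = true) => congrArg (Ty.shift k)
        (eqon hj hst (l := l) hn h)
      rw [← Ty.subst_congr e, fmap_congr (fun l hl => (e l hl).symm) (fun l hl => (e l hl).symm)
        fun _ => rfl]
      exact hd n hn k Γ t hΓ
    have h1 := ihA (t := t) hΓ hA.1 hs.1 hΘ hi hj hτ hσ (fun n h => (hst n h).symm)
      (by cases b <;> exact ht) hd'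
    have h2 := ihB (t := t) hΓ hA.2 hs.2 hΘ hi hj hσ hτ hst ht hd
    simp only [fmap, ← Ty.subst_subst]
    exact .lam (hA1.subst hτ) (h2.plug (Ξ := [_, _]) hΓ rfl (.app
      (.refl (.var rfl ((hA.subst hΘ).subst hσ))) (h1.plug (Ξ := [_, _]) hΓ rfl
        (.var_zero (hA1.subst hτ)))))
  | prod A B ihA ihB =>
    have h0 : EpsEq (((Ty.prod A B).subst Θ).subst σ :: Γ) (.var 0) (.var 0)
      (((Ty.prod A B).subst Θ).subst σ) := .var_zero ((hA.subst hΘ).subst hσ)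
    exact .pair ((ihA hΓ hA.1 hs.1 hΘ hi hj hσ hτ hst ht hd).plug_one hΓ (.fst h0))
      ((ihB hΓ hA.2 hs.2 hΘ hi hj hσ hτ hst ht hd).plug_one hΓ (.snd h0))
  | sum A B ihA ihB =>
    have h1 := hA.1.subst hΘ
    have h2 := hA.2.subst hΘ
    simp only [fmap, ← Ty.subst_subst]
    exact .case (.var_zero ((hA.subst hΘ).subst hσ))
      (.inl (h2.subst hτ) ((ihA hΓ hA.1 hs.1 hΘ hi hj hσ hτ hst ht hd).plug (Ξ := [_, _]) hΓ rfl
        (.var_zero (h1.subst hσ))))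
      (.inr (h1.subst hτ) ((ihB hΓ hA.2 hs.2 hΘ hi hj hσ hτ hst ht hd).plug (Ξ := [_, _]) hΓ rfl
        (.var_zero (h2.subst hσ))))
  | all A ih =>
    have h1 := ih (i := i + 1) (j := j + 1) (Θ := Ty.up Θ) (σ := Ty.up σ) (τ := Ty.up τ)
      (t := t.tshift 1) (hΓ.shiftC 1) hA.1 hs (adm_up hΘ)
      (by simp [Ty.up, Ty.scons, hi, Ty.shift, Ty.rename])
      (by
        rintro (_ | n) h
        · rfl
        · simp only [Ty.up, Ty.scons, occ_shift_succ]; exact hj n (by omega))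
      (adm_up hσ) (adm_up hτ)
      (by
        rintro (_ | n) h
        · rfl
        · simp only [Ty.up, Ty.scons]; rw [hst n (by omega)])
      (by have := ht.tshift 1; cases b <;> exact this)
      (by
        rintro (_ | n) h k Γ t hΓ
        · exact .var_zero trivial
        -- A quantifier weakens the types in `σ` by one more variable; the arbitrary weakening in
        -- `hd` absorbs this.
        · have := hd n (by omega) (1 + k) Γ t hΓ
          simpa only [Ty.up, Ty.scons, Ty.shift_subst, fmap_shift_succ, Ty.shift_shift] using this)
    simp only [Ty.up_comp] at h1
    have h0 : EpsEq ((((Ty.all A).subst Θ).subst σ).shift 1 :: shiftC 1 Γ) (.var 0) (.var 0)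
      ((((Ty.all A).subst Θ).subst σ).shift 1) := .var_zero (((hA.subst hΘ).subst hσ).shift 1)
    exact .tlam ((hA.subst hΘ).subst hτ) (h1.plug_one (Γ := shiftC 1 Γ) (hΓ.shiftC 1)
      (h0.tappVars (m := 1)))
  | mu A ih =>
    have e1 : ∀ σ, A.subst (Ty.up fun n => (Θ n).subst σ) =
      (A.subst (Ty.up Θ)).subst (Ty.up σ) := fun σ => by rw [Ty.subst_subst, Ty.up_comp]
    have e2 : ∀ M σ, A.subst (Ty.scons M fun n => (Θ n).subst σ) =
      (A.subst (Ty.up Θ)).subst (Ty.scons M σ) := fun M σ => by rw [Ty.subst_up_scons]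
    have hM := (hA.subst hΘ).subst hτ
    have hM' := (hA.subst hΘ).subst hσ
    have h1 := ih (i := i + 1) (j := j + 1) (Θ := Ty.up Θ) (t := t)
      (σ := Ty.scons (((Ty.mu A).subst Θ).subst τ) σ)
      (τ := Ty.scons (((Ty.mu A).subst Θ).subst τ) τ) hΓ hA.1 hs (adm_up hΘ)
      (by simp [Ty.up, Ty.scons, hi, Ty.shift, Ty.rename])
      (by
        rintro (_ | n) h
        · rfl
        · simp only [Ty.up, Ty.scons, occ_shift_succ]; exact hj n (by omega))
      (adm_scons hM hσ) (adm_scons hM hτ)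
      (by
        rintro (_ | n) h
        · rfl
        · exact hst n (by omega)) ht
      (by
        rintro (_ | n) h k Γ t hΓ
        · exact .var_zero (hM.shift k)
        · have := hd n (by omega) k Γ t hΓ
          simpa only [Ty.up, Ty.scons, Ty.shift_subst, fmap_shift_succ] using this)
    simp only [Ty.up_scons] at h1
    simp only [fmap, e1, e2]
    refine .app (.foldm (B := .mu ((A.subst (Ty.up Θ)).subst (Ty.up τ))) hM' ?_) (.var_zero hM')
    rw [subst_up_inst]
    refine .lam ((hA.1.subst (adm_up hΘ)).subst (adm_scons hM hσ)) (.inm hM ?_)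
    rw [subst_up_inst]
    exact h1.plug (Ξ := [_, _]) hΓ rfl
      (.var_zero ((hA.1.subst (adm_up hΘ)).subst (adm_scons hM hσ)))
  | nu A ih =>
    have e1 : ∀ σ, A.subst (Ty.up fun n => (Θ n).subst σ) =
      (A.subst (Ty.up Θ)).subst (Ty.up σ) := fun σ => by rw [Ty.subst_subst, Ty.up_comp]
    have hM := (hA.subst hΘ).subst hτ
    have hM' := (hA.subst hΘ).subst hσ
    have h1 := ih (i := i + 1) (j := j + 1) (Θ := Ty.up Θ) (t := t)
      (σ := Ty.scons (((Ty.nu A).subst Θ).subst σ) σ)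
      (τ := Ty.scons (((Ty.nu A).subst Θ).subst σ) τ) hΓ hA.1 hs (adm_up hΘ)
      (by simp [Ty.up, Ty.scons, hi, Ty.shift, Ty.rename])
      (by
        rintro (_ | n) h
        · rfl
        · simp only [Ty.up, Ty.scons, occ_shift_succ]; exact hj n (by omega))
      (adm_scons hM' hσ) (adm_scons hM' hτ)
      (by
        rintro (_ | n) h
        · rfl
        · exact hst n (by omega)) ht
      (by
        rintro (_ | n) h k Γ t hΓ
        · exact .var_zero (hM'.shift k)
        · have := hd n (by omega) k Γ t hΓ
          simpa only [Ty.up, Ty.scons, Ty.shift_subst, fmap_shift_succ] using this)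
    simp only [Ty.up_scons] at h1
    simp only [fmap, e1]
    refine .app (.unfoldn (B := .nu ((A.subst (Ty.up Θ)).subst (Ty.up σ))) hM ?_) (.var_zero hM')
    rw [subst_up_inst]
    refine .lam hM' (h1.plug (Ξ := [_, _]) hΓ rfl ?_)
    rw [← subst_up_inst]
    exact .outn (.var_zero hM')

/-- The functorial action in a variable that does not occur is the identity. -/
theorem fmap_of_occ_false {A : Ty} {i : ℕ} {σ τ : ℕ → Ty} {t : Tm} {Γ : List Ty} (hΓ : CtxAdm Γ)
    (hA : A.Adm) (hi : occ i A = false) (hσ : ∀ n, (σ n).Adm)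
    (hst : ∀ n, occ n A = true → σ n = τ n) :
    EpsEq (A.subst σ :: Γ) (fmap A i σ τ t) (.var 0) (A.subst σ) := by
  -- Since `i` does not occur, the target substitution and the term may be replaced by the source
  -- substitution and the identity.
  rw [← fmap_congr (σ := σ) (τ := σ) (t := .var 0) (fun _ _ => rfl) hst (by simp [hi])]
  have hne : ∀ {n}, occ n A = true → n ≠ i := by rintro n h rfl; rw [hi] at h; cases h
  -- Every other variable goes to its value weakened past a new variable `0`, so that `A[Θ]` is the
  -- weakening of `A[σ]`, for which the law is known. The value at `i` is vacuous, but has to be a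
  -- variable for `fmap_subst_ty` to apply.
  let Θ : ℕ → Ty := fun n => if n = i then .var 0 else (σ n).shift 1
  have hS : ∀ n, (Ty.scons (σ i) Ty.var n).Adm := adm_scons (hσ i) fun _ => trivial
  have hΘ : ∀ n, n ≠ i → Θ n = (σ n).shift 1 := fun n hn => if_neg hn
  have h1 := fmap_subst_ty (b := true) (i := i) (j := 0) (Θ := Θ) (t := .var 0)
    (σ := Ty.scons (σ i) Ty.var) (τ := Ty.scons (σ i) Ty.var) hΓ hA
    (OnlySign.of_occ_false hi)
    (by
      intro n; by_cases h : n = i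
      · simp only [Θ, if_pos h]; trivial
      · rw [hΘ n h]; exact (hσ n).shift 1)
    (if_pos rfl) (fun n h => by rw [hΘ n h]; exact occ_shift_one _) hS hS (fun _ _ => rfl)
    (.var_zero (hσ i))
    (by
      intro n h k Γ t _
      have e := fmap_rename (A := (σ n).shift 1) (i := 0) (j := 0) (ρ := upr fun n => n + k)
        (σ := Ty.scons .one Ty.var) (τ := Ty.scons .one Ty.var) (t := t) (t' := t)
        (σ' := fun l => (Ty.scons (σ i) Ty.var l).shift k)
        (τ' := fun l => (Ty.scons (σ i) Ty.var l).shift k)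
        (by rintro (_ | n) _ <;> simp [upr])
        (by
          rintro (_ | l) hl
          · rw [occ_shift_one] at hl; cases hl
          · rfl)
        (by
          rintro (_ | l) hl
          · rw [occ_shift_one] at hl; cases hl
          · rfl) fun _ => rfl
      have e' : ((σ n).shift 1).subst (fun l => (Ty.scons (σ i) Ty.var l).shift k) =
          (σ n).shift k := by
        rw [Ty.shift_subst, Ty.shift, Ty.rename_eq_subst]; rfl
      have e2 : ((σ n).shift 1).rename (upr fun n => n + k) = ((σ n).shift k).shift 1 := by
        simp only [Ty.shift, Ty.rename_rename, upr]
      rw [hΘ n h, ← e, e', e2]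
      exact fmap_shift_one ((hσ n).shift k))
  have e1 : (fun n => (Θ n).subst (Ty.scons (σ i) Ty.var)) = σ := by
    funext n
    by_cases h : n = i
    · subst h; simp [Θ, Ty.subst, Ty.scons]
    · rw [hΘ n h, shift_scons, Ty.subst_var]
  have e2 : A.subst Θ = (A.subst σ).shift 1 := by
    rw [Ty.shift, Ty.subst_rename]
    exact Ty.subst_congr fun n h => hΘ n (hne h)
  rw [e1, e2, shift_scons, Ty.subst_var] at h1
  exact h1.symm.trans (fmap_shift_one (hA.subst hσ))

/-- The functorial action preserves identities. -/
theorem fmap_id {A : Ty} {b : Bool} {i : ℕ} {σ : ℕ → Ty} {t : Tm} {Γ : List Ty} (hΓ : CtxAdm Γ)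
    (hA : A.Adm) (hs : OnlySign b i A) (hσ : ∀ n, (σ n).Adm)
    (ht : ∀ k, EpsEq ((σ i).shift k :: shiftC k Γ) (t.tshift k) (.var 0) ((σ i).shift k)) :
    EpsEq (A.subst σ :: Γ) (fmap A i σ σ t) (.var 0) (A.subst σ) := by
  -- The rules for fixpoints use the action of the body with parameters substituted, whereas
  -- induction speaks of the body at a substitution. The two agree because the parameters do not
  -- contain the fixpoint variable.
  have unfix : ∀ {C : Ty} {σ : ℕ → Ty} {M : Ty} {Γ}, CtxAdm Γ → C.Adm → Pos 0 C →
      (∀ n, (σ n).Adm) → M.Adm →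
      EpsEq (C.subst (Ty.scons M σ) :: Γ) (fmap C 0 (Ty.scons M σ) (Ty.scons M σ) (.var 0))
        (.var 0) (C.subst (Ty.scons M σ)) →
      EpsEq ((C.subst (Ty.up σ)).inst M :: Γ) (act (C.subst (Ty.up σ)) 0 M M (.var 0)) (.var 0)
        ((C.subst (Ty.up σ)).inst M) := by
    intro C σ M Γ hΓ hC hs hσ hM h
    have hS : ∀ n, (Ty.scons M Ty.var n).Adm := adm_scons hM fun _ => trivial
    have h1 := fmap_subst_ty (b := true) (i := 0) (j := 0) (Θ := Ty.up σ) (t := .var 0)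
      (σ := Ty.scons M Ty.var) (τ := Ty.scons M Ty.var) hΓ hC hs (adm_up hσ) rfl
      (by
        rintro (_ | n) hn
        · exact absurd rfl hn
        · exact occ_shift_one _) hS hS (fun _ _ => rfl) (.var_zero hM) ?_
    · rw [Ty.up_scons] at h1
      simp only [Ty.subst_var] at h1
      rw [act_zero]
      refine h1.trans ?_
      rwa [Ty.subst_up_scons, show (fun n => (σ n).subst Ty.var) = σ from
        funext fun n => Ty.subst_var _]
    · rintro (_ | n) hn k Δ t hΔ
      · exact absurd rfl hn
      · exact fmap_of_occ_false hΔ ((hσ n).shift 1) (occ_shift_one _) (fun n => (hS n).shift k)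
          fun _ _ => rfl
  induction A generalizing b i σ t Γ with
  | var n =>
    simp only [fmap]
    split
    · rename_i h; subst h; simpa only [Ty.shift_zero, shiftC_zero, tshift_zero, Ty.subst] using ht 0
    · exact .var_zero (hσ n)
  | one => exact .var_zero trivial
  | zero => exact .var_zero trivial
  | arr A B ihA ihB =>
    have h0 := hA.subst hσ
    refine EpsEq.trans (.lam h0.1 ((ihB hΓ hA.2 hs.2 hσ ht).plug (Ξ := [_, _]) hΓ rfl (.app
      (.refl (.var rfl h0)) ((ihA hΓ hA.1 hs.1 hσ ht).plug (Ξ := [_, _]) hΓ rfl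
        (.var_zero h0.1))))) (EpsEq.eta (t := .var 0) (.var_zero h0)).symm
  | prod A B ihA ihB =>
    have h0 := EpsEq.var_zero (Γ := Γ) (hA.subst hσ)
    exact (EpsEq.pair ((ihA hΓ hA.1 hs.1 hσ ht).plug_one hΓ (.fst h0))
      ((ihB hΓ hA.2 hs.2 hσ ht).plug_one hΓ (.snd h0))).trans (EpsEq.prod_eta h0.hasType.1).symm
  | sum A B ihA ihB =>
    have h0 := hA.subst hσ
    exact (EpsEq.case (.var_zero h0) (.inl h0.2 ((ihA hΓ hA.1 hs.1 hσ ht).plug (Ξ := [_, _]) hΓ rfl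
        (.var_zero h0.1))) (.inr h0.1 ((ihB hΓ hA.2 hs.2 hσ ht).plug (Ξ := [_, _]) hΓ rfl
        (.var_zero h0.2)))).trans
      (EpsEq.sum_eta (u := .var 0) (.var_zero h0) (.var_zero h0)).symm
  | all A ih =>
    have h0 := hA.subst hσ
    -- Below the quantifier the weakened term acts; this is the reason for assuming the equation of
    -- `t` at every weakening.
    have h1 := ih (t := t.tshift 1) (hΓ.shiftC 1) hA.1 hs (adm_up hσ) fun k => by
      have := ht (1 + k)
      rwa [← Ty.shift_shift, ← shiftC_shiftC, ← tshift_tshift] at this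
    have h2 := EpsEq.var_zero (Γ := shiftC 1 Γ) (h0.shift 1)
    have h3 : EpsEq (shiftC 1 ((Ty.all A).subst σ :: Γ)) _ (.tapp (.var 0) (.var 0)) _ :=
      h1.plug_one (hΓ.shiftC 1) (h2.tappVars (m := 1))
    exact (EpsEq.tlam h0 h3).trans
      (EpsEq.teta (t := .var 0) (.var_zero h0)).symm
  | mu A ih =>
    have hM := hA.subst hσ
    have hC := hA.1.subst (adm_scons hM hσ)
    -- The induction hypothesis serves twice: in the variable `i + 1`, to simplify the step function
    -- of the fold, and in the fixpoint variable, for the premise of its uniqueness rule.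
    have h1 := ih (t := t) hΓ hA.1 hs (adm_scons hM hσ) ht
    have h2 := unfix hΓ hA.1 hA.2 hσ hM (ih (t := .var 0) hΓ hA.1 hA.2 (adm_scons hM hσ)
      fun k => .var_zero (hM.shift k))
    have e := subst_up_inst A (.mu (A.subst (Ty.up σ))) σ
    have hu : ∀ {Γ}, HasType Γ (.lam (A.subst (Ty.scons ((Ty.mu A).subst σ) σ))
        (.inm (A.subst (Ty.up σ)) (.var 0)))
        (.arr ((A.subst (Ty.up σ)).inst (.mu (A.subst (Ty.up σ)))) (.mu (A.subst (Ty.up σ)))) := by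
      intro Γ; rw [e]; exact .lam hC (.inm hM (by rw [e]; exact .var_zero hC))
    have h3 : EpsEq ((Ty.mu A).subst σ :: Γ) (.lam (A.subst (Ty.scons ((Ty.mu A).subst σ) σ))
        (.inm (A.subst (Ty.up σ)) ((fmap A (i + 1) (Ty.scons ((Ty.mu A).subst σ) σ)
          (Ty.scons ((Ty.mu A).subst σ) σ) t).plug 2 (.var 0))))
        (.lam (A.subst (Ty.scons ((Ty.mu A).subst σ) σ)) (.inm (A.subst (Ty.up σ)) (.var 0)))
        (.arr ((A.subst (Ty.up σ)).inst (.mu (A.subst (Ty.up σ)))) (.mu (A.subst (Ty.up σ)))) := by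
      rw [e]
      refine .lam hC (.inm hM ?_)
      rw [e]
      exact h1.plug (Ξ := [_, _]) hΓ rfl (.var_zero hC)
    -- What remains is the fold of the constructor itself, which the uniqueness rule identifies with
    -- the identity.
    refine (EpsEq.app (.foldm hM h3) (.var_zero hM)).trans
      (EpsEq.mu_eta (t := .var 0) hM hu (.var_zero hM) ?_).symm
    refine .trans ?_ (EpsEq.app (.refl hu) h2.symm)
    have h4 := EpsEq.beta (Γ := A.subst (Ty.scons ((Ty.mu A).subst σ) σ) :: Γ)
      (t := .inm (A.subst (Ty.up σ)) (.var 0))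
      (.inm hM (by rw [e]; exact .var_zero hC)) (.var_zero hC)
    rw [show A.subst (Ty.scons ((Ty.mu A).subst σ) σ) = _ from e.symm] at h4 ⊢
    exact h4.symm
  | nu A ih =>
    have hM := hA.subst hσ
    have hC := hA.1.subst (adm_scons hM hσ)
    have h1 := ih (t := t) hΓ hA.1 hs (adm_scons hM hσ) ht
    have h2 := unfix hΓ hA.1 hA.2 hσ hM (ih (t := .var 0) hΓ hA.1 hA.2 (adm_scons hM hσ)
      fun k => .var_zero (hM.shift k))
    have e := subst_up_inst A (.nu (A.subst (Ty.up σ))) σ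
    have hu : ∀ {Γ}, HasType Γ (.lam ((Ty.nu A).subst σ) (.outn (A.subst (Ty.up σ)) (.var 0)))
        (.arr (.nu (A.subst (Ty.up σ))) ((A.subst (Ty.up σ)).inst (.nu (A.subst (Ty.up σ))))) :=
      .lam hM (.outn (.var_zero hM))
    have h3 : EpsEq ((Ty.nu A).subst σ :: Γ) (.lam ((Ty.nu A).subst σ)
        ((fmap A (i + 1) (Ty.scons ((Ty.nu A).subst σ) σ) (Ty.scons ((Ty.nu A).subst σ) σ) t).plug 2
          (.outn (A.subst (Ty.up σ)) (.var 0))))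
        (.lam ((Ty.nu A).subst σ) (.outn (A.subst (Ty.up σ)) (.var 0)))
        (.arr (.nu (A.subst (Ty.up σ))) ((A.subst (Ty.up σ)).inst (.nu (A.subst (Ty.up σ))))) := by
      refine .lam hM ?_
      rw [e]
      refine h1.plug (Ξ := [_, _]) hΓ rfl ?_
      rw [← subst_up_inst]
      exact .outn (.var_zero hM)
    -- Dually, the unfolding of the destructor itself is the identity.
    refine (EpsEq.app (.unfoldn hM h3) (.var_zero hM)).trans
      (EpsEq.nu_eta (t := .var 0) hu (.var_zero hM) ?_).symm
    refine (h2.plug_one hΓ (.app (.refl hu) (.var_zero hM))).trans ?_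
    exact EpsEq.beta (t := .outn (A.subst (Ty.up σ)) (.var 0)) (.outn (.var_zero hM))
      (.var_zero hM)

/-! ### Iterated abstraction and application -/

theorem SubTy.iter_up {Γ Δ : List Ty} {σ : ℕ → Tm} (h : SubTy Δ σ Γ) (Ξ : List Ty) :
    SubTy (Ξ ++ Δ) (Tm.up^[Ξ.length] σ) (Ξ ++ Γ) := by
  induction Ξ with
  | nil => exact h
  | cons A Ξ ih => rw [List.length_cons, Function.iterate_succ_apply']; exact ih.up A

theorem EpsEq.apps {Γ : List Ty} {t t' : Tm} {As : List Ty} {us us' : List Tm} {B : Ty}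
    (h : EpsEq Γ t t' (arrows As B)) (hl : us.length = As.length) (hl' : us'.length = As.length)
    (hu : ∀ k (h₁ : k < us.length) (h₂ : k < us'.length) (h₃ : k < As.length),
      EpsEq Γ us[k] us'[k] As[k]) : EpsEq Γ (t.apps us) (t'.apps us') B := by
  induction As generalizing t t' us us' with
  | nil =>
    obtain rfl := List.length_eq_zero_iff.1 hl
    obtain rfl := List.length_eq_zero_iff.1 hl'
    exact h
  | cons A As ih =>
    obtain ⟨u, us, rfl⟩ := List.exists_cons_of_length_eq_add_one hl
    obtain ⟨u', us', rfl⟩ := List.exists_cons_of_length_eq_add_one hl'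
    refine ih (t := t.app u) (t' := t'.app u') (us := us) (us' := us')
      (.app h (hu 0 (by simp) (by simp) (by simp))) (by simpa using hl) (by simpa using hl')
      fun k h₁ h₂ h₃ => ?_
    exact hu (k + 1) (by simpa using h₁) (by simpa using h₂) (by simpa using h₃)

theorem EpsEq.apps_left {Γ : List Ty} {t t' : Tm} {As : List Ty} {us : List Tm} {B : Ty}
    (h : EpsEq Γ t t' (arrows As B)) (hu : List.Forall₂ (HasType Γ) us As) :
    EpsEq Γ (t.apps us) (t'.apps us) B :=
  h.apps hu.length_eq hu.length_eq fun _ h₁ _ h₃ => .refl (hu.get h₁ h₃)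

/-- Each β-step substitutes into the remaining abstractions, hence under their lifting.
`iter_up_sconsL` fuses this with the later arguments, so that a single simultaneous substitution
results. -/
theorem apps_lams {Γ : List Ty} {t : Tm} {As : List Ty} {us : List Tm} {B : Ty}
    (h : HasType (As.reverse ++ Γ) t B) (hu : List.Forall₂ (HasType Γ) us As) :
    EpsEq Γ (apps (lams As t) us) (t.subst (Tm.sconsL us .var)) B := by
  induction hu generalizing t with
  | nil => rw [show Tm.sconsL [] Tm.var = Tm.var from rfl, Tm.subst_var]; exact .refl h
  | @cons u A us As hu hus ih =>
    have hl := hus.length_eq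
    have hA : ∀ C ∈ As, C.Adm := by
      intro C hC
      obtain ⟨n, hn, rfl⟩ := List.mem_iff_getElem.1 hC
      exact (hus.get (by omega) hn).adm
    have hs : SubTy Γ (Tm.scons u .var) (A :: Γ) := (SubTy.var Γ).scons fun _ => hu
    have hs' := hs.iter_up As.reverse
    rw [List.length_reverse] at hs'
    have h' : HasType (As.reverse ++ A :: Γ) t B := by simpa using h
    have h1 := ih (h'.subst hs')
    rw [Tm.subst_subst, ← hl, Tm.iter_up_sconsL] at h1
    have h2 := EpsEq.beta (HasType.lams hA h') hu
    rw [show (Tm.lams As t).plug 0 u = (Tm.lams As t).subst (Tm.scons u .var) from rfl,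
      Tm.lams_subst, ← hl] at h2
    simp only [Tm.subst_var] at h1
    exact (h2.apps_left hus).trans h1

theorem forall₂_vars (As Γ : List Ty) (hA : ∀ A ∈ As, A.Adm) :
    List.Forall₂ (HasType (As.reverse ++ Γ)) (vars As.length) As := by
  refine List.forall₂_iff_get.2 ⟨length_vars _, fun i h₁ h₂ => ?_⟩
  simp only [List.get_eq_getElem, getElem_vars]
  refine .var ?_ (hA _ (List.getElem_mem _))
  rw [List.getElem?_append_left (by simp; omega), List.getElem?_reverse (by omega)]
  simp only [show As.length - 1 - (As.length - 1 - i) = i by omega]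
  exact List.getElem?_eq_getElem h₂

theorem apps_lams_vars {Γ : List Ty} {t : Tm} {As : List Ty} {B : Ty} (hA : ∀ A ∈ As, A.Adm)
    (h : HasType (As.reverse ++ Γ) t B) :
    EpsEq (As.reverse ++ Γ) (apps ((lams As t).shift As.length) (vars As.length)) t B := by
  have hs := (SubTy.var_add As.reverse Γ rfl).iter_up As.reverse
  have h1 := apps_lams (h.subst hs) (forall₂_vars As Γ hA)
  rw [List.length_reverse, Tm.subst_subst] at h1
  have e := Tm.iter_up_sconsL (vars As.length) (fun n => .var (n + As.length)) .var
  rw [length_vars] at e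
  rw [e, show (fun n => (Tm.var (n + As.length)).subst .var) = fun n => .var (n + As.length) from
    rfl, Tm.sconsL_vars, Tm.subst_var] at h1
  rwa [Tm.shift, Tm.rename_eq_subst, lams_subst]

theorem EpsEq.lams {Γ : List Ty} {t u : Tm} {As : List Ty} {B : Ty} (hA : ∀ A ∈ As, A.Adm)
    (h : EpsEq (As.reverse ++ Γ) t u B) : EpsEq Γ (lams As t) (lams As u) (arrows As B) := by
  induction As generalizing Γ with
  | nil => exact h
  | cons A As ih =>
    exact .lam (hA A (by simp)) (ih (fun C hC => hA C (by simp [hC])) (by simpa using h))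

theorem lams_eta {Γ : List Ty} {t : Tm} {As : List Ty} {B : Ty} (h : HasType Γ t (arrows As B)) :
    EpsEq Γ t (lams As (apps (t.shift As.length) (vars As.length))) (arrows As B) := by
  induction As generalizing Γ t with
  | nil => rw [List.length_nil, Tm.shift_zero]; exact .refl h
  | cons A As ih =>
    have hA : A.Adm := h.adm.1
    have h1 := ih (HasType.app (h.shift_one A) (.var_zero hA))
    refine (EpsEq.eta h).trans (.lam hA ?_)
    rw [List.length_cons, vars_succ]
    rw [show Tm.shift As.length (.app (t.shift 1) (.var 0)) =
      .app ((t.shift 1).shift As.length) (.var (0 + As.length)) from rfl, Tm.shift_shift,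
      Nat.add_comm 1, Nat.zero_add] at h1
    exact h1

/-- The type-level counterpart of iterated β, with a pending substitution on the term and one on its
type, both growing with each argument. -/
theorem tapps_tlamN {Γ : List Ty} {t : Tm} {A : Ty} {θ σ : ℕ → Ty} {Cs : List Ty} {m : ℕ}
    (hm : Cs.length = m) (h : HasType Γ ((tlamN m t).tsubst θ) ((allN m A).subst σ))
    (hC : ∀ C ∈ Cs, C.Adm) :
    EpsEq Γ (tapps ((tlamN m t).tsubst θ) Cs) (t.tsubst (Ty.sconsL Cs θ))
      (A.subst (Ty.sconsL Cs σ)) := by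
  induction Cs generalizing θ σ m with
  | nil => subst hm; exact .refl h
  | cons C Cs ih =>
    subst hm
    have h1 := EpsEq.tbeta h (hC C (by simp))
    rw [subst_up_inst, Tm.tinst, Tm.tsubst_tsubst, single_zero, up_scons,
      show (fun n => (θ n).subst Ty.var) = θ from funext fun n => Ty.subst_var _] at h1
    exact (h1.tapps rfl fun D hD => hC D (by simp [hD])).trans
      (ih rfl h1.hasType.2 fun D hD => hC D (by simp [hD]))

theorem tappVars_tlamN {Γ : List Ty} {t : Tm} {A : Ty} {m : ℕ}
    (h : HasType Γ (tlamN m t) (allN m A)) :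
    EpsEq (shiftC m Γ) (tappVars ((tlamN m t).tshift m) m) t A := by
  have h1 := h.tshift m
  rw [Ty.shift, Ty.rename_eq_subst] at h1
  have := tapps_tlamN (length_tvars m) h1 adm_tvars
  rwa [sconsL_tvars_shift, Ty.subst_var, Tm.tsubst_var] at this

theorem EpsEq.tlamN {Γ : List Ty} {t u : Tm} {A : Ty} {m : ℕ} (hA : (allN m A).Adm)
    (h : EpsEq (shiftC m Γ) t u A) : EpsEq Γ (tlamN m t) (tlamN m u) (allN m A) := by
  induction m generalizing Γ with
  | zero => rwa [shiftC_zero] at h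
  | succ m ih =>
    refine .tlam hA (ih hA.1 ?_)
    rwa [shiftC_shiftC, Nat.add_comm]

theorem tlamN_eta {Γ : List Ty} {t : Tm} {A : Ty} {m : ℕ} (h : HasType Γ t (allN m A)) :
    EpsEq Γ t (tlamN m (tappVars (t.tshift m) m)) (allN m A) := by
  induction m generalizing Γ t with
  | zero => rw [tshift_zero]; exact .refl h
  | succ m ih =>
    refine (EpsEq.teta h).trans (.tlam h.adm ?_)
    have h1 := ih (HasType.tappVars (m := 1) (A := allN m A) (h.tshift 1))
    have e : tappVars ((tappVars (t.tshift 1) 1).tshift m) m =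
        tappVars (t.tshift (m + 1)) (m + 1) := by
      rw [tappVars_eq (t.tshift (m + 1)), tvars_succ, tappVars_eq ((tappVars _ 1).tshift m)]
      change tapps (.tapp ((t.tshift 1).tshift m) (.var (0 + m))) _ = _
      rw [tshift_tshift, Nat.add_comm 1, Nat.zero_add]; rfl
    rwa [e] at h1

/-! ### Tuples and projections -/

theorem tuple_subst (ts : List Tm) (σ : ℕ → Tm) :
    (tuple ts).subst σ = tuple (ts.map fun t => t.subst σ) := by
  fun_induction tuple ts <;> simp_all [tuple, Tm.subst]

theorem tuple_tsubst (ts : List Tm) (θ : ℕ → Ty) :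
    (tuple ts).tsubst θ = tuple (ts.map fun t => t.tsubst θ) := by
  fun_induction tuple ts <;> simp_all [tuple, Tm.tsubst]

theorem proj_subst (n j : ℕ) (t : Tm) (σ : ℕ → Tm) :
    (proj n j t).subst σ = proj n j (t.subst σ) := by
  fun_induction proj n j t <;> simp_all [proj, Tm.subst]

theorem proj_tsubst (n j : ℕ) (t : Tm) (θ : ℕ → Ty) :
    (proj n j t).tsubst θ = proj n j (t.tsubst θ) := by
  fun_induction proj n j t <;> simp_all [proj, Tm.tsubst]

theorem HasType.tuple {Γ : List Ty} {ts : List Tm} {As : List Ty}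
    (h : List.Forall₂ (HasType Γ) ts As) : HasType Γ (tuple ts) (prodN As) := by
  induction h with
  | nil => exact .star
  | cons h hs ih =>
    cases hs with
    | nil => exact h
    | cons h' hs => exact .pair h ih

theorem EpsEq.proj {Γ : List Ty} {t u : Tm} {As : List Ty} (h : EpsEq Γ t u (prodN As)) {j : ℕ}
    (hj : j < As.length) : EpsEq Γ (proj As.length j t) (proj As.length j u) As[j] := by
  induction As generalizing t u j with
  | nil => simp at hj
  | cons A As ih =>
    cases As with
    | nil => obtain rfl : j = 0 := by simpa using hj
             exact h
    | cons B As =>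
      cases j with
      | zero => exact .fst h
      | succ j => exact ih (.snd h) (by simpa using hj)

theorem HasType.proj {Γ : List Ty} {t : Tm} {As : List Ty} (h : HasType Γ t (prodN As)) {j : ℕ}
    (hj : j < As.length) : HasType Γ (proj As.length j t) As[j] :=
  ((EpsEq.refl h).proj hj).hasType.1

theorem proj_tuple {Γ : List Ty} {ts : List Tm} {As : List Ty}
    (h : List.Forall₂ (HasType Γ) ts As) {j : ℕ} (hj : j < As.length) (hj' : j < ts.length) :
    EpsEq Γ (proj As.length j (tuple ts)) ts[j] As[j] := by
  induction h generalizing j with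
  | nil => simp at hj
  | cons h hs ih =>
    cases hs with
    | nil => obtain rfl : j = 0 := by simpa using hj
             exact .refl h
    | cons h' hs =>
      have h2 := HasType.tuple (.cons h' hs)
      cases j with
      | zero => exact .fst_beta h h2
      | succ j =>
        have h3 : j < (_ :: _).length := Nat.lt_of_succ_lt_succ hj
        exact ((EpsEq.snd_beta h h2).proj h3).trans (ih h3 (Nat.lt_of_succ_lt_succ hj'))

/-- Iterated surjective pairing; the empty tuple uses uniqueness of the inhabitant of `1`, and a
tuple of one component is that component. -/
theorem tuple_proj {Γ : List Ty} {t : Tm} {As : List Ty} (h : HasType Γ t (prodN As)) :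
    EpsEq Γ (tuple ((List.range As.length).map fun j => proj As.length j t)) t (prodN As) := by
  induction As generalizing t with
  | nil => exact (EpsEq.one_eta h).symm
  | cons A As ih =>
    cases As with
    | nil => exact .refl h
    | cons B As =>
      have h1 := ih (.snd h)
      refine EpsEq.trans ?_ (EpsEq.prod_eta h).symm
      have h2 := EpsEq.pair (.refl (.fst h)) h1
      simp only [List.length_cons, List.range_succ_eq_map (n := As.length + 1), List.map_cons,
        List.map_map] at h2 ⊢
      simp only [List.range_succ_eq_map (n := As.length), List.map_cons, List.map_map] at h2 ⊢
      exact h2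

/-- Two tuples are equal if their components are. -/
theorem tuple_ext {Γ : List Ty} {t u : Tm} {As : List Ty} (ht : HasType Γ t (prodN As))
    (hu : HasType Γ u (prodN As))
    (h : ∀ j (hj : j < As.length), EpsEq Γ (proj As.length j t) (proj As.length j u) As[j]) :
    EpsEq Γ t u (prodN As) := by
  induction As generalizing t u with
  | nil => exact (EpsEq.one_eta ht).trans (EpsEq.one_eta hu).symm
  | cons A As ih =>
    cases As with
    | nil => exact h 0 (by simp)
    | cons B As =>
      exact ((EpsEq.prod_eta ht).trans (.pair (h 0 (by simp)) (ih (.snd ht) (.snd hu)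
        fun j hj => h (j + 1) (by simpa using hj)))).trans (EpsEq.prod_eta hu).symm

/-! ### Injections and case distinction -/

theorem inj_subst (As : List Ty) (k : ℕ) (t : Tm) (σ : ℕ → Tm) :
    (inj As k t).subst σ = inj As k (t.subst σ) := by
  fun_induction inj As k t <;> simp_all [inj, Tm.subst]

theorem inj_tsubst (As : List Ty) (k : ℕ) (t : Tm) (θ : ℕ → Ty) :
    (inj As k t).tsubst θ = inj (As.map fun A => A.subst θ) k (t.tsubst θ) := by
  fun_induction inj As k t <;> simp_all [inj, Tm.tsubst, sumN_subst]

theorem EpsEq.inj {Γ : List Ty} {t u : Tm} {As : List Ty} (hA : ∀ A ∈ As, A.Adm) {k : ℕ}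
    (hk : k < As.length) (h : EpsEq Γ t u As[k]) : EpsEq Γ (inj As k t) (inj As k u) (sumN As) := by
  induction As generalizing k with
  | nil => simp at hk
  | cons A As ih =>
    cases As with
    | nil => obtain rfl : k = 0 := by simpa using hk
             exact h
    | cons B As =>
      cases k with
      | zero => exact .inl (adm_sumN.2 fun C hC => hA C (by simp_all)) h
      | succ k =>
        exact .inr (hA A (by simp)) (ih (fun C hC => hA C (by simp_all)) (by simpa using hk) h)

theorem HasType.inj {Γ : List Ty} {t : Tm} {As : List Ty} (hA : ∀ A ∈ As, A.Adm) {k : ℕ}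
    (hk : k < As.length) (h : HasType Γ t As[k]) : HasType Γ (inj As k t) (sumN As) :=
  ((EpsEq.refl h).inj hA hk).hasType.1

/-- The scrutinee lives `d` variables beyond the context `Γ` of the branches, so a substitution
reaches the branches only through its part `s₀` on `Γ`. Source and target offsets may differ, which
also permits mere changes of the offset. -/
theorem caseN_subst {C : Ty} {us : List Tm} {d d' : ℕ} {t : Tm} {s s₀ : ℕ → Tm}
    (h : ∀ n, s (n + d) = (s₀ n).shift d') :
    (caseN C us d t).subst s =
      caseN C (us.map fun u => u.subst (Tm.up s₀)) d' (t.subst s) := by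
  have hp : ∀ (u t : Tm) {s : ℕ → Tm} {d d'}, (∀ n, s (n + d) = (s₀ n).shift d') →
      (u.plug d t).subst s = (u.subst (Tm.up s₀)).plug d' (t.subst s) := by
    intro u t s d d' h
    rw [plug_subst, Tm.plug, Tm.subst_up_scons]; simp only [h, Tm.shift, Tm.rename_eq_subst]
  have hs : ∀ {s : ℕ → Tm} {d d'}, (∀ n, s (n + d) = (s₀ n).shift d') →
      ∀ n, Tm.up s (n + (d + 1)) = (s₀ n).shift (d' + 1) := by
    intro s d d' h n
    rw [← Nat.add_assoc, ← Tm.shift_shift, ← h]; rfl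
  fun_induction caseN C us d t generalizing s d' with
  | case1 => rfl
  | case2 d t u => exact hp _ _ h
  | case3 d t u v us ih =>
    simp only [Tm.subst, List.map_cons, caseN]
    rw [hp _ _ (hs h), ih (hs h)]; rfl

theorem caseN_tsubst (C : Ty) (us : List Tm) (d : ℕ) (t : Tm) (θ : ℕ → Ty) :
    (caseN C us d t).tsubst θ =
      caseN (C.subst θ) (us.map fun u => u.tsubst θ) d (t.tsubst θ) := by
  fun_induction caseN C us d t <;> simp_all [caseN, Tm.tsubst, plug_tsubst]

theorem HasType.caseN {Γ Ξ : List Ty} {C : Ty} {us : List Tm} {As : List Ty} {d : ℕ} {t : Tm}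
    (hC : C.Adm) (hu : List.Forall₂ (fun u A => HasType (A :: Γ) u C) us As)
    (hA : ∀ A ∈ As, A.Adm) (hd : Ξ.length = d)
    (ht : HasType (Ξ ++ Γ) t (sumN As)) : HasType (Ξ ++ Γ) (caseN C us d t) C := by
  induction hu generalizing Ξ d t with
  | nil => exact .abort hC ht
  | cons hu hus ih =>
    cases hus with
    | nil => exact hu.plug hd ht
    | @cons u' A' us As hu' hus =>
      exact .case ht (hu.plug (Ξ := _ :: Ξ) (by simp [hd]) (.var_zero (hA _ (by simp))))
        (ih (Ξ := _ :: Ξ) (fun A h => hA A (by simp_all)) (by simp [hd])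
          (.var_zero (adm_sumN.2 fun C hC => hA C (by simp_all))))

theorem caseN_inj {Γ Ξ : List Ty} {C : Ty} {us : List Tm} {As : List Ty} {d k : ℕ} {w : Tm}
    (hC : C.Adm) (hu : List.Forall₂ (fun u A => HasType (A :: Γ) u C) us As)
    (hA : ∀ A ∈ As, A.Adm) (hd : Ξ.length = d) (hk : k < As.length) (hk' : k < us.length)
    (hw : HasType (Ξ ++ Γ) w As[k]) :
    EpsEq (Ξ ++ Γ) (caseN C us d (inj As k w)) (us[k].plug d w) C := by
  induction hu generalizing k with
  | nil => simp at hk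
  | cons hu hus ih =>
    cases hus with
    | nil => obtain rfl : k = 0 := by simpa using hk
             exact .refl (hu.plug hd hw)
    | @cons u' A' us As hu' hus =>
      have hA' : ∀ C ∈ A' :: As, C.Adm := fun C hC => hA C (by simp_all)
      have hS := adm_sumN.2 hA'
      have hA0 := hA _ (List.mem_cons_self)
      have h1 := hu.plug (Ξ := _ :: Ξ) (k := d + 1) (by simp [hd]) (.var_zero hA0)
      have h2 := HasType.caseN (Ξ := sumN (A' :: As) :: Ξ) (d := d + 1) hC (.cons hu' hus)
        hA' (by simp [hd]) (.var_zero hS)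
      cases k with
      | zero =>
        have := EpsEq.inl_beta hS hw h1 h2
        rwa [plug_plug] at this
      | succ k =>
        have hk2 : k < (A' :: As).length := by simpa using hk
        have := EpsEq.inr_beta hA0 (HasType.inj hA' hk2 hw) h1 h2
        have e : (caseN C (u' :: us) (d + 1) (.var 0)).plug 0 (inj (A' :: As) k w) =
            caseN C (u' :: us) d (inj (A' :: As) k w) := by
          rw [Tm.plug, caseN_subst (d := d + 1) (s₀ := .var) (d' := d) (fun n => rfl)]
          simp only [Tm.up_var, Tm.subst_var, List.map_id']; rfl
        rw [e] at this
        exact this.trans (ih hA' hk2 (by simpa using hk') hw)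

/-- A map out of a sum is determined by its composites with the injections. The binary η-rule splits
off the first summand and the induction continues with `h` composed with `inr`; for the empty sum it
is the η-rule of `0`. -/
theorem caseN_eta {Γ Ξ : List Ty} {C : Ty} {us : List Tm} {As : List Ty} {d : ℕ} {h t : Tm}
    (hΓ : CtxAdm Γ) (hA : ∀ A ∈ As, A.Adm) (hd : Ξ.length = d) (hl : us.length = As.length)
    (hh : HasType (sumN As :: Γ) h C)
    (hu : ∀ k (h₁ : k < us.length) (h₂ : k < As.length),
      EpsEq (As[k] :: Γ) us[k] (h.plug 1 (inj As k (.var 0))) C)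
    (ht : HasType (Ξ ++ Γ) t (sumN As)) : EpsEq (Ξ ++ Γ) (caseN C us d t) (h.plug d t) C := by
  induction As generalizing Ξ d h t us with
  | nil =>
    obtain rfl := List.length_eq_zero_iff.1 hl
    have h1 := hh.plug (Ξ := _ :: Ξ) (k := d + 1) (by simp [hd])
      (.var_zero (A := .zero) trivial)
    have := (EpsEq.zero_eta ht h1).symm
    rwa [plug_plug] at this
  | cons A As ih =>
    cases As with
    | nil =>
      obtain ⟨u, us, rfl⟩ := List.exists_cons_of_length_eq_add_one hl
      obtain rfl : us = [] := by simpa using hl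
      have := hu 0 (by simp) (by simp)
      have h2 := this.plug hΓ hd (.refl ht)
      rw [show Tm.inj [A] 0 (.var 0) = .var 0 from rfl, plug_var_zero] at h2
      exact h2
    | cons B As =>
      obtain ⟨u, us, rfl⟩ := List.exists_cons_of_length_eq_add_one hl
      have hl' : us.length = (B :: As).length := by simpa using hl
      obtain ⟨u', us, rfl⟩ := List.exists_cons_of_length_eq_add_one hl'
      have hA' : ∀ C ∈ B :: As, C.Adm := fun C hC => hA C (by simp_all)
      have hS := adm_sumN.2 hA'
      have hA0 := hA A (by simp)
      have h1 := hh.plug (Ξ := sumN (A :: B :: As) :: Ξ) (k := d + 1) (by simp [hd])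
        (.var_zero ⟨hA0, hS⟩)
      have h2 := EpsEq.sum_eta ht h1
      have pp : ∀ b, (h.plug (d + 1) (.var 0)).plug 1 b = h.plug (d + 1) b := by
        intro b; rw [Tm.plug, plug_subst]; rfl
      rw [plug_plug, pp, pp] at h2
      refine EpsEq.trans ?_ h2.symm
      refine .case (.refl ht) ?_ ?_
      · have := (hu 0 (by simp) (by simp)).plug (Ξ := A :: Ξ) (k := d + 1) hΓ (by simp [hd])
          (.var_zero hA0)
        rwa [plug_plug'] at this
      · have h3 := ih (Ξ := sumN (B :: As) :: Ξ) (d := d + 1) (us := u' :: us)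
          (h := h.plug 1 (.inr A (.var 0))) (t := .var 0) hA' (by simp [hd]) hl'
          (hh.plug_one (.inr hA0 (.var_zero hS))) (fun k h₁ h₂ => by
            have := hu (k + 1) (by simpa using h₁) (by simpa using h₂)
            rw [plug_plug']; exact this) (.var_zero hS)
        rwa [plug_plug'] at h3

/-! ### The functorial action of iterated type formers -/

/-- The action on a quantified type is a type abstraction over the action on its body, so each type
β-step puts the argument in front of both substitutions and leaves `t` unchanged. -/
theorem tapps_fmap_allN {Γ : List Ty} {C : Ty} {i m : ℕ} {σ τ : ℕ → Ty} {t a : Tm} {Cs : List Ty}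
    (hm : Cs.length = m)
    (h : HasType Γ ((fmap (allN m C) i σ τ t).plug 0 a) ((allN m C).subst τ))
    (hC : ∀ C ∈ Cs, C.Adm) :
    EpsEq Γ (tapps ((fmap (allN m C) i σ τ t).plug 0 a) Cs)
      ((fmap C (i + m) (Ty.sconsL Cs σ) (Ty.sconsL Cs τ) t).plug 0 (tapps a Cs))
      (C.subst (Ty.sconsL Cs τ)) := by
  induction Cs generalizing i σ τ a m with
  | nil => subst hm; exact .refl h
  | cons D Cs ih =>
    subst hm
    have h1 := EpsEq.tbeta h (hC D (by simp))
    rw [subst_up_inst] at h1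
    have e : Tm.tinst (((fmap (allN Cs.length C) (i + 1) (Ty.up σ) (Ty.up τ) (t.tshift 1)).plug 1
        (.tapp (.var 0) (.var 0))).subst fun n => (Tm.scons a (fun n => .var (n + 0)) n).tshift 1) D =
        (fmap (allN Cs.length C) (i + 1) (Ty.scons D σ) (Ty.scons D τ) t).plug 0 (.tapp a D) := by
      rw [plug_subst]
      have : Tm.scons ((Tm.tapp (.var 0) (.var 0)).subst
            fun n => (Tm.scons a (fun n => .var (n + 0)) n).tshift 1)
          (fun n => (Tm.scons a (fun n => .var (n + 0)) (n + 1)).tshift 1) =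
          Tm.scons (.tapp (a.tshift 1) (.var 0)) fun n => .var (n + 0) := by
        funext n; cases n <;> rfl
      rw [this, ← Tm.plug, tinst, plug_tsubst, fmap_tsubst, single_zero, up_scons, up_scons,
        ← single_zero, ← tinst, tshift_one_tinst]
      simp only [Ty.subst_var]
      congr 1
      change Tm.tapp ((a.tshift 1).tinst D) D = _
      rw [tshift_one_tinst]
    rw [show Tm.plug _ 0 a = Tm.tlam _ from rfl] at h
    rw [e] at h1
    have h2 := ih rfl h1.hasType.2 fun D hD => hC D (by simp [hD])
    have h3 := (h1.tapps rfl fun D hD => hC D (by simp [hD])).trans h2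
    rw [show i + (D :: Cs).length = i + 1 + Cs.length by simp; omega]
    exact h3

/-- Naturality of the projections, by the β-rules for pairs. -/
theorem proj_fmap_prodN {Γ : List Ty} {As : List Ty} {i j : ℕ} {σ τ : ℕ → Ty} {t a : Tm}
    (h : HasType Γ ((fmap (prodN As) i σ τ t).plug 0 a) ((prodN As).subst τ))
    (hj : j < As.length) :
    EpsEq Γ (proj As.length j ((fmap (prodN As) i σ τ t).plug 0 a))
      ((fmap As[j] i σ τ t).plug 0 (proj As.length j a)) (As[j].subst τ) := by
  induction As generalizing j a with
  | nil => simp at hj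
  | cons A As ih =>
    cases As with
    | nil => obtain rfl : j = 0 := by simpa using hj
             exact .refl h
    | cons B As =>
      have e : (fmap (prodN (A :: B :: As)) i σ τ t).plug 0 a =
          .pair ((fmap A i σ τ t).plug 0 (.fst a)) ((fmap (prodN (B :: As)) i σ τ t).plug 0
            (.snd a)) := by
        change Tm.pair ((Tm.plug _ 1 _).plug 0 a) ((Tm.plug _ 1 _).plug 0 a) = _
        rw [plug_plug, plug_plug]; rfl
      rw [e] at h ⊢
      change HasType _ _ (.prod (A.subst τ) ((prodN (B :: As)).subst τ)) at h
      cases h with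
      | pair h1 h2 =>
        cases j with
        | zero => exact .fst_beta h1 h2
        | succ j =>
          have hj' : j < (B :: As).length := by simpa using hj
          have h3 := EpsEq.snd_beta h1 h2
          rw [prodN_subst] at h3
          have h4 := h3.proj (j := j) (by simpa using hj')
          simp only [List.length_map, List.getElem_map] at h4
          exact h4.trans (ih h2 hj')

theorem HasType.fmap_sumN {Γ : List Ty} {As : List Ty} {i : ℕ} {σ τ : ℕ → Ty} {t : Tm}
    (hA : ∀ A ∈ As, (A.subst σ).Adm)
    (hT : ∀ A ∈ As, HasType (A.subst σ :: Γ) (Tm.fmap A i σ τ t) (A.subst τ)) :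
    HasType ((sumN As).subst σ :: Γ) (Tm.fmap (sumN As) i σ τ t) ((sumN As).subst τ) := by
  induction As with
  | nil => exact .var_zero trivial
  | cons A As ih =>
    cases As with
    | nil => exact hT A (by simp)
    | cons B As =>
      have h1 := hT A (by simp)
      have h2 := ih (fun C hC => hA C (by simp_all)) fun C hC => hT C (by simp_all)
      have hA1 := hA A (by simp)
      have hA2 : ((sumN (B :: As)).subst σ).Adm := by
        rw [sumN_subst, adm_sumN]
        intro D hD
        obtain ⟨C, hC, rfl⟩ := List.mem_map.1 hD
        exact hA C (List.mem_cons_of_mem _ hC)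
      exact .case (.var_zero ⟨hA1, hA2⟩)
        (.inl h2.adm (h1.plug (Ξ := [_, _]) rfl (.var_zero hA1)))
        (.inr h1.adm (h2.plug (Ξ := [_, _]) rfl (.var_zero hA2)))

/-- Naturality of the injections: the action on a sum is a case distinction, which computes on an
injection. Typing of the summands' actions is assumed, so no sign analysis enters. -/
theorem fmap_sumN_inj {Γ : List Ty} {As : List Ty} {i k : ℕ} {σ τ : ℕ → Ty} {t w : Tm}
    (hA : ∀ A ∈ As, (A.subst σ).Adm)
    (hT : ∀ A ∈ As, HasType (A.subst σ :: Γ) (fmap A i σ τ t) (A.subst τ))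
    (hk : k < As.length) (hw : HasType Γ w (As[k].subst σ)) :
    EpsEq Γ ((fmap (sumN As) i σ τ t).plug 0 (inj (As.map fun A => A.subst σ) k w))
      (inj (As.map fun A => A.subst τ) k ((fmap As[k] i σ τ t).plug 0 w))
      ((sumN As).subst τ) := by
  induction As generalizing k w with
  | nil => simp at hk
  | cons A As ih =>
    cases As with
    | nil => obtain rfl : k = 0 := by simpa using hk
             exact .refl ((hT A (by simp)).plug_zero hw)
    | cons B As =>
      have hA' : ∀ C ∈ B :: As, (C.subst σ).Adm := fun C hC => hA C (by simp_all)
      have hT' : ∀ C ∈ B :: As, HasType (C.subst σ :: Γ) (fmap C i σ τ t) (C.subst τ) :=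
        fun C hC => hT C (by simp_all)
      have e : (fmap (sumN (A :: B :: As)) i σ τ t).plug 0
          (inj ((A :: B :: As).map fun A => A.subst σ) k w) =
          .case (.sum (A.subst τ) ((sumN (B :: As)).subst τ))
            (inj ((A :: B :: As).map fun A => A.subst σ) k w)
            (.inl ((sumN (B :: As)).subst τ) (fmap A i σ τ t))
            (.inr (A.subst τ) (fmap (sumN (B :: As)) i σ τ t)) := by
        have p : ∀ u a, (Tm.plug u 2 (.var 0)).subst (Tm.up (Tm.scons a fun n => .var (n + 0))) =
            u := by
          intro u a
          rw [plug_subst]; exact plug_var_zero u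
        change Tm.case _ _ (.inl _ ((Tm.plug _ 2 _).subst _)) (.inr _ ((Tm.plug _ 2 _).subst _)) = _
        rw [p, p]; rfl
      rw [e]
      have hAσ : ∀ C ∈ (B :: As).map (fun A => A.subst σ), C.Adm := by
        simpa using hA'
      have hSσ := adm_sumN.2 hAσ
      have hf1 := hT A (by simp)
      have hS := HasType.fmap_sumN hA' hT'
      have hS' := hS
      rw [sumN_subst (B :: As) σ] at hS'
      cases k with
      | zero =>
        have h1 := EpsEq.inl_beta hSσ hw (.inl hS.adm hf1) (.inr hf1.adm hS')
        change EpsEq _ _ _ (.sum (A.subst τ) ((sumN (B :: As)).subst τ))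
        rw [sumN_subst (B :: As) τ] at h1 ⊢
        exact h1
      | succ k =>
        have hk2 : k < (B :: As).length := by simpa using hk
        have h1 := EpsEq.inr_beta (hA A (by simp))
          (HasType.inj hAσ (k := k) (t := w) (by simpa using hk2) (by rw [List.getElem_map]; exact hw))
          (.inl hS.adm hf1) (.inr hf1.adm hS')
        exact h1.trans (.inr hf1.adm (ih hA' hT' hk2 hw))

/-! ### Existential types -/

theorem Ty.sconsL_upr {Cs : List Ty} {m : ℕ} (hm : Cs.length = m) (σ : ℕ → Ty) (ρ : ℕ → ℕ) (n : ℕ) :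
    Ty.sconsL Cs σ (upr^[m] ρ n) = Ty.sconsL Cs (fun n => σ (ρ n)) n := by
  subst hm
  induction Cs generalizing σ ρ n with
  | nil => rfl
  | cons C Cs ih =>
    rw [List.length_cons, Function.iterate_succ_apply]
    change Ty.sconsL Cs (Ty.scons C σ) _ = Ty.sconsL Cs (Ty.scons C _) n
    rw [ih]; congr 1; funext n; cases n <;> rfl

theorem Ty.sconsL_self {Cs : List Ty} {m : ℕ} (hm : Cs.length = m) (σ : ℕ → Ty) :
    Ty.sconsL Cs σ m = σ 0 := by
  subst hm; simpa using Ty.sconsL_add Cs σ 0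

theorem rename_upr_succ_single (m : ℕ) (A E : Ty) :
    (A.rename (upr^[m] Nat.succ)).subst (single m E) = A := by
  rw [Ty.rename_subst, single, Ty.iter_up_comp_upr]
  exact (congrArg A.subst (Ty.iter_up_var m)).trans (Ty.subst_var A)

theorem tvars_map_iter_up (m : ℕ) (θ : ℕ → Ty) :
    (tvars m).map (fun C => C.subst (Ty.up^[m] θ)) = tvars m := by
  refine (List.map_congr_left fun C hC => ?_).trans (List.map_id _)
  obtain ⟨i, hi, rfl⟩ := List.mem_map.1 hC
  exact Ty.iter_up_lt _ (by simpa using hi)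

theorem pack_eq (m : ℕ) (P : Ty) (u : Tm) : pack m P u =
    .tlam (.lam (exPrem m P)
      (.app (tapps (.var 0) ((tvars m).map fun C => C.shift 1)) ((u.tshift 1).shift 1))) := by
  simp [pack, tapps, tvars, Function.comp_def, Ty.shift, Ty.rename]

theorem pack_subst (m : ℕ) (P : Ty) (u : Tm) (s : ℕ → Tm) :
    (pack m P u).subst s = pack m P (u.subst s) := by
  simp only [pack_eq, Tm.subst, tapps_subst, Tm.shift_subst]
  simp only [Tm.up, Tm.scons, subst_tshift, Tm.shift, Tm.subst_rename]

theorem pack_tsubst (m : ℕ) (P : Ty) (u : Tm) (θ : ℕ → Ty) :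
    (pack m P u).tsubst (Ty.up^[m] θ) =
      pack m (P.subst (Ty.up^[m] (Ty.up^[m] θ))) (u.tsubst (Ty.up^[m] θ)) := by
  simp only [pack_eq, Tm.tsubst, tapps_tsubst, exPrem_subst, shift_tsubst, tshift_tsubst_up,
    List.map_map, Function.comp_def, Ty.shift_subst_up]
  have := congrArg (List.map fun C => C.shift 1) (tvars_map_iter_up m θ)
  rw [List.map_map] at this
  rw [← this]; rfl

theorem HasType.pack {Γ : List Ty} {m : ℕ} {P : Ty} {u : Tm} (hP : (ex m P).Adm)
    (hu : HasType Γ u (P.subst (Ty.sconsL (tvars m) Ty.var))) :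
    HasType Γ (pack m P u) (ex m P) := by
  rw [pack_eq]
  have hm : ((tvars m).map fun C => C.shift 1).length = m := by simp [length_tvars]
  refine .tlam hP (.lam hP.1.1 (.app (A := P.subst (Ty.sconsL ((tvars m).map fun C => C.shift 1)
    fun n => .var (n + 1))) ?_ ?_))
  · have h1 := HasType.tapps (Γ := exPrem m P :: shiftC 1 Γ) (t := .var 0) (σ := Ty.var) hm
      (by rw [Ty.subst_var]; exact .var_zero hP.1.1) fun D hD => by
        obtain ⟨C, hC, rfl⟩ := List.mem_map.1 hD
        exact (adm_tvars C hC).shift 1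
    simp only [Ty.subst, Ty.sconsL_self hm, Ty.rename_subst] at h1
    simp only [Ty.sconsL_upr hm] at h1
    exact h1
  · have h1 := (hu.tshift 1).shift_one (exPrem m P)
    rw [Ty.shift, Ty.rename_eq_subst, Ty.subst_subst, Ty.sconsL_comp] at h1
    simpa only [Ty.shift, Ty.rename_eq_subst, Ty.subst] using h1

theorem EpsEq.pack {Γ : List Ty} {m : ℕ} {P : Ty} {u u' : Tm} (hΓ : CtxAdm Γ) (hP : (ex m P).Adm)
    (hu : EpsEq Γ u u' (P.subst (Ty.sconsL (tvars m) Ty.var))) :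
    EpsEq Γ (pack m P u) (pack m P u') (ex m P) := by
  have h1 := HasType.pack (Γ := _ :: Γ) hP (.var_zero hu.hasType.1.adm)
  have h2 := (EpsEq.refl h1).plug_zero hΓ hu
  simp only [Tm.plug, pack_subst] at h2
  exact h2

/-- The β-rule of the encoded existential: unpacking a package hands its witnesses and its content
to the continuation. -/
theorem pack_app {Γ : List Ty} {m : ℕ} {P G : Ty} {u g : Tm} (hP : (ex m P).Adm) (hG : G.Adm)
    (hu : HasType Γ u (P.subst (Ty.sconsL (tvars m) Ty.var)))
    (hg : HasType Γ g ((exPrem m P).inst G)) :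
    EpsEq Γ (.app (.tapp (pack m P u) G) g) (.app (g.tapps (tvars m)) u) G := by
  have h1 := HasType.pack hP hu
  rw [pack_eq] at h1 ⊢
  have h2 := EpsEq.tbeta h1 hG
  have e : Tm.tinst (.lam (exPrem m P) (.app (tapps (.var 0) ((tvars m).map fun C => C.shift 1))
      ((u.tshift 1).shift 1))) G =
      .lam ((exPrem m P).inst G) (.app (tapps (.var 0) (tvars m)) (u.shift 1)) := by
    simp only [Tm.tinst, Tm.tsubst, tapps_tsubst, shift_tsubst, List.map_map, Function.comp_def]
    rw [← Tm.tinst, tshift_one_tinst]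
    congr 3
    exact (List.map_congr_left fun C _ => Ty.shift_inst C G).trans (List.map_id _)
  rw [e] at h2
  have h3 := h2.hasType.2
  change HasType Γ _ (.arr _ G) at h3
  cases h3 with
  | lam _ h4 =>
    have h5 := EpsEq.beta h4 hg
    rw [Tm.app_plug, shift_plug, Tm.shift_zero, Tm.plug, tapps_subst] at h5
    exact (EpsEq.app h2 (.refl hg)).trans h5

theorem tapp_app_vars {Γ As : List Ty} {t : Tm} {B : Ty} {m : ℕ} (hΓ : CtxAdm Γ)
    (hA : (allN m (arrows As B)).Adm)
    (h : HasType (As.reverse ++ shiftC m Γ) t B) :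
    EpsEq (As.reverse ++ shiftC m Γ)
      (apps (tappVars (((tlamN m (lams As t)).tshift m).shift As.length) m) (vars As.length)) t
      B := by
  have hA' := (adm_arrows.1 hA.of_allN).1
  have h1 := tappVars_tlamN (HasType.tlamN hA (HasType.lams hA' h))
  have h2 := h1.shift (hΓ.shiftC m) As.reverse (List.length_reverse ..)
  rw [tappVars_eq, ← tapps_shift]
  exact (h2.apps_left (forall₂_vars As _ hA')).trans (apps_lams_vars hA' h)

theorem HasType.tapps_tvars {Γ : List Ty} {t : Tm} {A : Ty} {m : ℕ} (h : HasType Γ t (allN m A))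
    (Ξ : List Ty) {k : ℕ} (hk : Ξ.length = k) :
    HasType (Ξ ++ shiftC m Γ) (Tm.tappVars ((t.tshift m).shift k) m) A := by
  rw [tappVars_eq, ← tapps_shift]
  exact (HasType.tappVars (h.tshift m)).shift Ξ hk

/-- `ΛY₁ … Yₘ. λy. pack[Y₁, …, Yₘ](y)`. -/
def packer (m : ℕ) (Q : Ty) : Tm :=
  tlamN m (.lam Q (pack m (Q.rename (upr^[m] fun n => n + m)) (.var 0)))

theorem rename_upr_iter_up (m : ℕ) (Q : Ty) (θ : ℕ → Ty) :
    (Q.rename (upr^[m] fun n => n + m)).subst (Ty.up^[m] (Ty.up^[m] θ)) =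
      (Q.subst (Ty.up^[m] θ)).rename (upr^[m] fun n => n + m) := by
  rw [Ty.rename_subst, Ty.subst_rename, Ty.iter_up_comp_upr]
  congr 1
  funext n
  rcases lt_or_ge n m with h | h
  · rw [Ty.iter_up_lt _ h, Ty.iter_up_lt _ h, Ty.rename, iter_upr_lt _ h]
  · obtain ⟨k, rfl⟩ := Nat.exists_eq_add_of_le' h
    rw [Ty.iter_up_add, Ty.iter_up_add]
    simp only [Ty.shift, Ty.rename_rename, iter_upr_add]

theorem packer_tsubst (m : ℕ) (Q : Ty) (θ : ℕ → Ty) :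
    (packer m Q).tsubst θ = packer m (Q.subst (Ty.up^[m] θ)) := by
  rw [packer, tlamN_tsubst, Tm.tsubst, pack_tsubst, packer, rename_upr_iter_up]; rfl

theorem rename_upr_add_sconsL (m : ℕ) (Q : Ty) :
    (Q.rename (upr^[m] fun n => n + m)).subst (Ty.sconsL (tvars m) Ty.var) = Q := by
  rw [Ty.rename_subst]
  simp only [Ty.sconsL_upr (length_tvars m), Ty.sconsL_tvars_shift, Ty.subst_var]

theorem ex_shift (m k : ℕ) (Q : Ty) : (ex m Q).shift k = ex m (Q.rename (upr^[m] fun n => n + k)) := by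
  rw [Ty.shift, Ty.rename_eq_subst, ex_subst, Ty.rename_eq_subst, Ty.iter_up_ren]

theorem Ty.Adm.of_ex {m : ℕ} {Q : Ty} (h : (ex m Q).Adm) : Q.Adm := by
  have := h.1.1.of_allN.1.subst (adm_single (E := .one) trivial m)
  rwa [rename_upr_succ_single] at this

theorem HasType.pack_var_zero {Γ : List Ty} {m : ℕ} {Q : Ty} (hQ : (ex m Q).Adm) :
    HasType (Q :: Γ) (Yoneda.pack m (Q.rename (upr^[m] fun n => n + m)) (.var 0)) ((ex m Q).shift m) := by
  rw [ex_shift]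
  refine HasType.pack (by rw [← ex_shift]; exact hQ.shift m) ?_
  rw [rename_upr_add_sconsL]
  exact .var_zero hQ.of_ex

theorem HasType.packer {m : ℕ} {Q : Ty} (hQ : (ex m Q).Adm) :
    HasType [] (Yoneda.packer m Q) ((exPrem m Q).inst (ex m Q)) := by
  have h : ((exPrem m Q).inst (ex m Q)).Adm := hQ.1.1.inst hQ
  rw [exPrem_inst] at h ⊢
  exact .tlamN h (.lam hQ.of_ex (.pack_var_zero hQ))

theorem HasType.of_closed {t : Tm} {A : Ty} (h : HasType [] t A) (Γ : List Ty) : HasType Γ t A :=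
  h.append Γ

theorem HasType.shift_closed {t : Tm} {A : Ty} (h : HasType [] t A) (k : ℕ) : t.shift k = t := by
  rw [Tm.shift, Tm.rename_eq_subst, h.subst_closed]

/-- A form of the `ε`-rule of `∃Y₁ … Yₘ. Q`. -/
theorem ex_comm {Γ : List Ty} {m : ℕ} {Q G : Ty} {h z g : Tm} (hΓ : CtxAdm Γ) (hG : G.Adm)
    (hh : HasType (ex m Q :: Γ) h G) (hz : HasType Γ z (ex m Q))
    (hg : HasType Γ g ((exPrem m Q).inst G))
    (he : EpsEq (Q :: shiftC m Γ)
      ((h.tshift m).plug 1 (pack m (Q.rename (upr^[m] fun n => n + m)) (.var 0)))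
      (.app (tappVars ((g.tshift m).shift 1) m) (.var 0)) (G.shift m)) :
    EpsEq Γ (h.plug 0 (.app (.tapp z (ex m Q)) (packer m Q))) (.app (.tapp z G) g) G := by
  have hQ := hz.adm
  have hp := HasType.packer hQ
  have hpΓ := hp.of_closed Γ
  -- The existential is read as a universal type of the form (a): a single premise with one
  -- argument, `Q` weakened past `Z`, and `B = Z`.
  let Q' := Q.rename (upr^[m] Nat.succ)
  have ho : occ m Q' = false := occ_rename_false fun n hn => by
    rcases lt_or_ge n m with h | h
    · rw [iter_upr_lt _ h] at hn; omega
    · obtain ⟨k, rfl⟩ := Nat.exists_eq_add_of_le' h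
      rw [iter_upr_add] at hn; omega
  have hs : SignL [(m, [Q'])] (.var 0) :=
    ⟨fun p hp A hA => by
      obtain rfl : p = (m, [Q']) := by simpa using hp
      obtain rfl : A = Q' := by simpa using hA
      exact .of_occ_false ho, fun _ => rfl⟩
  have hp1 : ∀ E : Ty, HasType Γ z (univL [(m, [Q'])] (.var 0)) := fun _ => hz
  have key := EpsEq.epsL [(m, [Q'])] (.var 0) (ex m Q) G z h (fun _ => packer m Q) (fun _ => g) hs
    hQ hG hz hh ?_ ?_ ?_
  -- Because `B` is the variable `Z`, its action is `h` itself.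
  · have e : act (.var 0) 0 (ex m Q) G h = h := Tm.tshift_zero h
    rw [e] at key
    exact key
  · intro k
    obtain rfl : k = 0 := Fin.fin_one_eq_zero k
    exact hpΓ
  · intro k
    obtain rfl : k = 0 := Fin.fin_one_eq_zero k
    exact hg
  · intro k
    obtain rfl : k = 0 := Fin.fin_one_eq_zero k
    change EpsEq (Q'.subst (single m (ex m Q)) :: shiftC m Γ)
      ((h.tshift m).plug 1 (apps (tappVars (((packer m Q).tshift m).shift 1) m) (vars 1)))
      (.app (tappVars ((g.tshift m).shift 1) m) ((act Q' m (ex m Q) G h).plug 1 (.var 0)))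
      (G.shift m)
    have hΓ' := hΓ.shiftC m
    have hE := hQ.1.1.inst hQ
    rw [exPrem_inst] at hE
    have h1 := tapp_app_vars (As := [Q]) hΓ hE (HasType.pack_var_zero hQ)
    have h2 := (EpsEq.refl (hh.tshift m)).plug_one hΓ' h1
    -- `Z` does not occur in the argument, so its action can be dropped, and the premise of the
    -- ε-rule becomes the assumed equation `he`.
    have h3 := fmap_of_occ_false (t := h.tshift m) (τ := single m G) hΓ' hQ.1.1.of_allN.1 ho
      (adm_single hQ m) fun n hn => single_ne _ _ fun e => by
        subst e; exact absurd hn (by simp only [Q'] at ho; simp [ho])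
    rw [rename_upr_succ_single] at h3 ⊢
    rw [exPrem_inst] at hg
    have h4 := HasType.tapps_tvars hg [Q] rfl
    rw [plug_var_zero]
    exact (h2.trans he).trans (.app (.refl h4) h3.symm)

/-- Both sides are η-expanded to `ΛZ. λf`. The bodies agree by the ε-rule for the map `x ↦ x Z f` at
the fresh type `Z`, whose premise is the β-rule for packages. -/
theorem ex_self {Γ : List Ty} {m : ℕ} {Q : Ty} {z : Tm} (hΓ : CtxAdm Γ)
    (hz : HasType Γ z (ex m Q)) :
    EpsEq Γ (.app (.tapp z (ex m Q)) (packer m Q)) z (ex m Q) := by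
  have hQ := hz.adm
  have hp := HasType.packer hQ
  have hz2 : HasType Γ (.app (.tapp z (ex m Q)) (packer m Q)) (ex m Q) :=
    .app (.tapp hz hQ) (hp.of_closed Γ)
  have ext : ∀ {t : Tm}, HasType Γ t (ex m Q) → EpsEq Γ t (.tlam (.lam (exPrem m Q)
      (.app (.tapp ((t.tshift 1).shift 1) (.var 0)) (.var 0)))) (ex m Q) := by
    intro t ht
    have h1 := HasType.tappVars (m := 1) (A := .arr (exPrem m Q) (.var 0)) (ht.tshift 1)
    exact (EpsEq.teta ht).trans (.tlam hQ (EpsEq.eta h1))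
  refine (ext hz2).trans (EpsEq.trans ?_ (ext hz).symm)
  refine .tlam hQ (.lam hQ.1.1 ?_)
  -- All data are weakened past the fresh type variable `Z`, which then serves as the target type.
  let Q₁ := Q.rename (upr^[m] fun n => n + 1)
  let Γ₁ := exPrem m Q :: shiftC 1 Γ
  have hΓ₁ : CtxAdm Γ₁ := (hΓ.shiftC 1).cons hQ.1.1
  have e₁ : (ex m Q).shift 1 = ex m Q₁ := ex_shift m 1 Q
  have hQ₁ : (ex m Q₁).Adm := e₁ ▸ hQ.shift 1
  have hz₁ : HasType Γ₁ ((z.tshift 1).shift 1) (ex m Q₁) := e₁ ▸ (hz.tshift 1).shift_one _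
  have ep : ((packer m Q).tshift 1).shift 1 = packer m Q₁ := by
    rw [tshift, packer_tsubst, Ty.iter_up_ren, ← Ty.rename_eq_subst,
      (HasType.packer hQ₁).shift_closed]
  have eP : (exPrem m Q₁).inst (.var 0) = exPrem m Q := by
    have := exPrem_subst m Q fun n => .var (n + 1)
    rw [Ty.iter_up_ren, ← Ty.rename_eq_subst] at this
    rw [← this, subst_up_inst]
    exact (congrArg (exPrem m Q).subst (by funext n; cases n <;> rfl)).trans (Ty.subst_var _)
  have hh : HasType (ex m Q₁ :: Γ₁) (.app (.tapp (.var 0) (.var 0)) (.var 1)) (.var 0) := by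
    refine HasType.app (A := exPrem m Q) ?_ (.var rfl hQ.1.1)
    have := HasType.tapp (B := .var 0) (HasType.var_zero (Γ := Γ₁) hQ₁) trivial
    change HasType _ _ (.arr ((exPrem m Q₁).inst (.var 0)) _) at this
    rwa [eP] at this
  have hg : HasType Γ₁ (.var 0) ((exPrem m Q₁).inst (.var 0)) := by
    rw [eP]; exact .var_zero hQ.1.1
  have key := ex_comm hΓ₁ (G := .var 0) trivial hh hz₁ hg ?_
  · change EpsEq Γ₁ (.app (.tapp (.app (.tapp ((z.tshift 1).shift 1)
      ((ex m Q).subst fun n => .var (n + 1)))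
      (((packer m Q).tshift 1).shift 1)) (.var 0)) (.var 0)) _ _
    rw [ep, ← Ty.rename_eq_subst, ← Ty.shift, e₁]; exact key
  · have hP := hQ₁.shift m
    rw [ex_shift] at hP
    refine pack_app hP (G := .var (0 + m)) trivial ?_ ?_
    · rw [rename_upr_add_sconsL]; exact .var_zero hQ₁.of_ex
    · have eP' := congrArg (Ty.shift m) eP
      rw [Ty.shift, Ty.rename_eq_subst, inst_subst, exPrem_subst, Ty.iter_up_ren,
        ← Ty.rename_eq_subst] at eP'
      change HasType _ _ ((exPrem m _).inst (Ty.subst (.var 0) fun n => .var (n + m)))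
      rw [eP']
      exact .var rfl (hQ.1.1.shift m)

/-- Uniqueness of the eliminator of `∃Y₁ … Yₘ. Q`. -/
theorem ex_eta {Γ : List Ty} {m : ℕ} {Q G : Ty} {h z g : Tm} (hΓ : CtxAdm Γ)
    (hh : HasType (ex m Q :: Γ) h G) (hz : HasType Γ z (ex m Q))
    (hg : HasType Γ g ((exPrem m Q).inst G))
    (he : EpsEq (Q :: shiftC m Γ)
      ((h.tshift m).plug 1 (pack m (Q.rename (upr^[m] fun n => n + m)) (.var 0)))
      (.app (tappVars ((g.tshift m).shift 1) m) (.var 0)) (G.shift m)) :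
    EpsEq Γ (.app (.tapp z G) g) (h.plug 0 z) G :=
  (ex_comm hΓ hh.adm hh hz hg he).symm.trans ((EpsEq.refl hh).plug_zero hΓ (ex_self hΓ hz))

/-! ### The functorial action on arrows and on packages. -/

theorem app_fmap_arr {Γ : List Ty} {C D : Ty} {i : ℕ} {σ τ : ℕ → Ty} {t a b : Tm}
    (h : HasType Γ ((fmap (.arr C D) i σ τ t).plug 0 a) ((Ty.arr C D).subst τ))
    (hb : HasType Γ b (C.subst τ)) :
    EpsEq Γ (.app ((fmap (.arr C D) i σ τ t).plug 0 a) b)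
      ((fmap D i σ τ t).plug 0 (.app a ((fmap C i τ σ t).plug 0 b))) (D.subst τ) := by
  change HasType Γ (.lam (C.subst τ) _) (.arr (C.subst τ) (D.subst τ)) at h
  cases h with
  | lam _ h =>
    have h1 := EpsEq.beta h hb
    have e : ((fmap D i σ τ t).plug 2 (.app (.var 1) ((fmap C i τ σ t).plug 2 (.var 0)))).subst
        (Tm.scons b (Tm.scons a fun n => .var (n + 0))) =
        (fmap D i σ τ t).plug 0 (.app a ((fmap C i τ σ t).plug 0 b)) := by
      rw [plug_subst, Tm.subst, plug_subst]; rfl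
    rw [Tm.subst_up_plug, e] at h1
    exact h1

theorem OnlySign.allN {b : Bool} {i m : ℕ} {A : Ty} (h : OnlySign b (i + m) A) :
    OnlySign b i (allN m A) := by
  induction m generalizing i with
  | zero => exact h
  | succ m ih => exact ih (i := i + 1) (by rwa [Nat.add_right_comm, Nat.add_assoc])

theorem OnlySign.prodN {b : Bool} {i : ℕ} {As : List Ty} (h : ∀ A ∈ As, OnlySign b i A) :
    OnlySign b i (prodN As) := by
  fun_induction Ty.prodN As with
  | case1 => trivial
  | case2 A => exact h A (by simp)
  | case3 A B L ih => exact ⟨h A (by simp), ih fun C hC => h C (by simp_all)⟩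

theorem OnlySign.exPrem {b : Bool} {i m : ℕ} {A : Ty} (h : OnlySign b (i + m) A) :
    OnlySign (!b) (i + 1) (exPrem m A) := by
  refine OnlySign.allN ⟨?_, fun h => by omega⟩
  rw [Bool.not_not]
  refine OnlySign.rename h fun n => ?_
  rcases lt_or_ge n m with h | h
  · rw [iter_upr_lt _ h]; omega
  · obtain ⟨k, rfl⟩ := Nat.exists_eq_add_of_le' h
    rw [iter_upr_add]; omega

theorem OnlySign.ex {b : Bool} {i m : ℕ} {A : Ty} (h : OnlySign b (i + m) A) :
    OnlySign b i (ex m A) :=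
  ⟨OnlySign.exPrem h, fun h => by omega⟩

/-- The action of `∃Y₁ … Yₘ. Q` on a package. -/
theorem fmap_ex_pack {Γ : List Ty} {m i : ℕ} {Q G : Ty} {σ τ : ℕ → Ty} {t u g : Tm}
    (hQ : (ex m Q).Adm) (hs : OnlySign true (i + m) Q) (hσ : ∀ n, (σ n).Adm)
    (hτ : ∀ n, (τ n).Adm) (hst : ∀ n, n ≠ i → σ n = τ n) (hG : G.Adm)
    (ht : HasType (σ i :: Γ) t (τ i)) (hu : HasType Γ u (Q.subst (Ty.sconsL (tvars m) σ)))
    (hg : HasType Γ g (allN m (.arr (Q.subst (Ty.up^[m] τ)) (G.shift m)))) :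
    EpsEq Γ
      (.app (.tapp ((fmap (ex m Q) i σ τ t).plug 0 (pack m (Q.subst (Ty.up^[m] σ)) u)) G) g)
      (.app (g.tapps (tvars m))
        ((fmap Q (i + m) (Ty.sconsL (tvars m) σ) (Ty.sconsL (tvars m) τ) t).plug 0 u)) G := by
  have hu' : HasType Γ u ((Q.subst (Ty.up^[m] σ)).subst (Ty.sconsL (tvars m) Ty.var)) := by
    have e := Ty.iter_up_sconsL (tvars m) σ Ty.var
    rw [length_tvars] at e
    simp only [Ty.subst_var] at e
    rwa [Ty.subst_subst, e]
  have hPσ := hQ.subst hσ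
  rw [ex_subst] at hPσ
  have hp := HasType.pack hPσ hu'
  rw [← ex_subst] at hp
  have h1 := (HasType.fmap hQ (OnlySign.ex hs) hσ hτ hst ht).plug_zero hp
  -- The encoded quantifier over `Z` is instantiated at `G` inside the action; its result type `Z`
  -- is then acted on trivially.
  have h2 := tapps_fmap_allN (m := 1) (Cs := [G]) (C := .arr (exPrem m Q) (.var 0)) rfl h1
    (by simpa using hG)
  have eg : ∀ τ, allN m (.arr (Q.subst (Ty.up^[m] τ)) (G.shift m)) =
      (exPrem m Q).subst (Ty.scons G τ) := by
    intro τ; rw [← subst_up_inst, exPrem_subst, exPrem_inst]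
  rw [eg] at hg
  have h3 := app_fmap_arr h2.hasType.2 hg
  rw [show fmap (.var 0) (i + 1) (Ty.sconsL [G] σ) (Ty.sconsL [G] τ) t = .var 0 from
    if_neg (by omega)] at h3
  -- The continuation stands in a contravariant position, so its action runs from `τ` back to `σ`:
  -- it precomposes `g` with the action on the content.
  have hW := (HasType.fmap (i := i + 1) (t := t) (Γ := Γ) hQ.1.1 (OnlySign.exPrem hs)
    (adm_scons hG hτ) (adm_scons hG hσ) (fun n hn => by
      cases n with
      | zero => rfl
      | succ n => exact (hst n (by omega)).symm) ht).plug_zero hg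
  have h4 := pack_app hPσ hG hu' (by rw [exPrem_inst, eg]; exact hW)
  have hu2 : HasType Γ u
      ((Q.rename (upr^[m] Nat.succ)).subst (Ty.sconsL (tvars m) (Ty.scons G σ))) := by
    rw [Ty.rename_subst]; simp only [Ty.sconsL_upr (length_tvars m)]; exact hu
  have h5 := tapps_fmap_allN (length_tvars m) hW adm_tvars
  have h6 := app_fmap_arr h5.hasType.2 hu2
  -- Weakening `Q` past `Z` and then assigning `G` to `Z` changes nothing, even syntactically.
  have ef : fmap (Q.rename (upr^[m] Nat.succ)) (i + 1 + m) (Ty.sconsL (tvars m) (Ty.scons G σ))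
      (Ty.sconsL (tvars m) (Ty.scons G τ)) t =
      fmap Q (i + m) (Ty.sconsL (tvars m) σ) (Ty.sconsL (tvars m) τ) t :=
    fmap_rename
      (fun n _ => by
        rcases lt_or_ge n m with h | h
        · rw [iter_upr_lt _ h]; omega
        · obtain ⟨k, rfl⟩ := Nat.exists_eq_add_of_le' h
          rw [iter_upr_add]; omega)
      (fun n _ => Ty.sconsL_upr (length_tvars m) _ _ n)
      (fun n _ => Ty.sconsL_upr (length_tvars m) _ _ n) (fun _ => rfl)
  rw [show fmap (.var m) (i + 1 + m) (Ty.sconsL (tvars m) (Ty.scons G τ))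
      (Ty.sconsL (tvars m) (Ty.scons G σ)) t = .var 0 from if_neg (by omega), ef] at h6
  have eG : (Ty.var m).subst (Ty.sconsL (tvars m) (Ty.scons G σ)) = G :=
    Ty.sconsL_self (length_tvars m) _
  rw [eG] at h6
  have h7 := h5.app (.refl hu2)
  rw [eG] at h7
  exact ((((h2.app (.refl hg)).trans h3).trans h4).trans h7).trans h6

/-! ### The type `α` and the eliminator `b` -/

theorem subst_congr_of_occ_false {A : Ty} {i : ℕ} {σ τ : ℕ → Ty} (h : occ i A = false)
    (hst : ∀ n, n ≠ i → σ n = τ n) : A.subst σ = A.subst τ :=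
  Ty.subst_congr fun n hn => hst n fun e => by subst e; rw [h] at hn; cases hn

theorem inst_eq_of_occ_false {A : Ty} (h : occ 0 A = false) (E F : Ty) : A.inst E = A.inst F :=
  subst_congr_of_occ_false h fun _ hn => single_ne E F hn

theorem summands_subst (Ps : List (ℕ × List Ty)) (θ : ℕ → Ty) :
    (summands Ps).map (fun S => S.subst (Ty.up θ)) = summands (Ps.map (subL θ)) := by
  simp only [summands, List.map_map]
  refine List.map_congr_left fun p _ => ?_
  simp only [Function.comp_apply, ex_subst, prodN_subst, subL, Function.iterate_succ_apply]

theorem tyT_subst (Ps : List (ℕ × List Ty)) (θ : ℕ → Ty) :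
    (tyT Ps).subst (Ty.up θ) = tyT (Ps.map (subL θ)) := by
  rw [tyT, sumN_subst, summands_subst, tyT]

theorem occL_subL (Ps : List (ℕ × List Ty)) (θ : ℕ → Ty) : occL (Ps.map (subL θ)) = occL Ps := by
  simp only [occL, List.any_map, Function.comp_def, subL, occ_subst_iter_up]

theorem occ_tyT (Ps : List (ℕ × List Ty)) : occ 0 (tyT Ps) = occL Ps := by
  simp only [tyT, occ_sumN, summands, List.any_map, Function.comp_def, occ_ex, occ_prodN, occL,
    Nat.zero_add]

theorem alpha_subst (Ps : List (ℕ × List Ty)) (θ : ℕ → Ty) :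
    (alpha Ps).subst θ = alpha (Ps.map (subL θ)) := by
  simp only [alpha, occL_subL]
  split
  · rw [Ty.subst, tyT_subst]
  · rw [inst_subst, tyT_subst]; rfl

theorem alpha_of_occ {Ps : List (ℕ × List Ty)} (h : occL Ps = true) : alpha Ps = .mu (tyT Ps) :=
  if_pos h

theorem alpha_of_not_occ {Ps : List (ℕ × List Ty)} (h : occL Ps = false) (G : Ty) :
    alpha Ps = (tyT Ps).inst G := by
  rw [alpha, if_neg (by simp [h])]
  exact inst_eq_of_occ_false ((occ_tyT Ps).trans h) _ _

/-- Admissibility of `α` suffices: either `T` is the body of an admissible fixpoint, or `X` does not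
occur and `T⟨G⟩` is `α`. -/
theorem adm_tyT_inst {Ps : List (ℕ × List Ty)} (h : (alpha Ps).Adm) {G : Ty} (hG : G.Adm) :
    ((tyT Ps).inst G).Adm := by
  cases ho : occL Ps with
  | true => rw [alpha_of_occ ho] at h; exact h.1.inst hG
  | false => rwa [alpha_of_not_occ ho G] at h

/-- The list of the summands of `T⟨G⟩`. -/
def summandsAt (Ps : List (ℕ × List Ty)) (G : Ty) : List Ty := (summands Ps).map fun S => S.inst G

theorem sumN_summandsAt (Ps : List (ℕ × List Ty)) (G : Ty) :
    sumN (summandsAt Ps G) = (tyT Ps).inst G := by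
  rw [tyT, Ty.inst, sumN_subst]; rfl

theorem length_summandsAt (Ps : List (ℕ × List Ty)) (G : Ty) :
    (summandsAt Ps G).length = Ps.length := by simp [summandsAt, summands]

theorem getElem_summandsAt (Ps : List (ℕ × List Ty)) (G : Ty) {k : ℕ}
    (h : k < (summandsAt Ps G).length) (h' : k < Ps.length) : (summandsAt Ps G)[k] =
      ex Ps[k].1 (prodN (Ps[k].2.map fun A => A.subst (single Ps[k].1 G))) := by
  simp only [summandsAt, summands, List.getElem_map, Ty.inst, ex_subst, prodN_subst, single,
    Function.iterate_zero, id]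

theorem summandsAt_subst (Ps : List (ℕ × List Ty)) (G : Ty) (θ : ℕ → Ty) :
    (summandsAt Ps G).map (fun S => S.subst θ) = summandsAt (Ps.map (subL θ)) (G.subst θ) := by
  rw [summandsAt, summandsAt, ← summands_subst, List.map_map, List.map_map]
  exact List.map_congr_left fun S _ => inst_subst S G θ

theorem adm_summandsAt {Ps : List (ℕ × List Ty)} (h : (alpha Ps).Adm) {G : Ty} (hG : G.Adm) :
    ∀ S ∈ summandsAt Ps G, S.Adm :=
  adm_sumN.1 (by rw [sumN_summandsAt]; exact adm_tyT_inst h hG)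

/-- `ΛY⃗. λy. f Y⃗ ⟨πⱼ y⟩ⱼ`. -/
def uncurryTm (m : ℕ) (As : List Ty) (f : Tm) : Tm :=
  tlamN m (.lam (prodN As) (apps (tappVars ((f.tshift m).shift 1) m)
    ((List.range As.length).map fun j => proj As.length j (.var 0))))

theorem uncurryTm_tsubst (m : ℕ) (As : List Ty) (f : Tm) (θ : ℕ → Ty) :
    (uncurryTm m As f).tsubst θ =
      uncurryTm m (As.map fun A => A.subst (Ty.up^[m] θ)) (f.tsubst θ) := by
  simp only [uncurryTm, tlamN_tsubst, Tm.tsubst, prodN_subst, apps_tsubst, tappVars_eq,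
    tapps_tsubst, tvars_map_iter_up, shift_tsubst, tshift_tsubst, List.length_map, List.map_map]
  simp only [Function.comp_def, proj_tsubst, Tm.tsubst, Tm.tshift, tsubst_tsubst, Ty.shift,
    Ty.iter_up_add, Ty.rename_eq_subst]

theorem uncurryTm_subst (m : ℕ) (As : List Ty) (f : Tm) (s : ℕ → Tm) :
    (uncurryTm m As f).subst s = uncurryTm m As (f.subst s) := by
  simp only [uncurryTm, tlamN_subst, Tm.subst, apps_subst, tappVars_eq, tapps_subst,
    Tm.shift_subst, List.map_map, subst_tshift]
  simp only [Function.comp_def, proj_subst, Tm.subst, Tm.up, Tm.scons, Tm.shift,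
    Tm.subst_rename]

/-- `λx. b[x]` at the type `G`, for `f⃗ₖ : ∀Y⃗ₖ. ⟨Aⱼₖ⟨G⟩⟩ⱼ ⇒ G`. -/
def elimTm (Ps : List (ℕ × List Ty)) (G : Ty) (fs : List Tm) : Tm :=
  .lam ((tyT Ps).inst G) (caseN G (List.zipWith (fun p f =>
    .app (.tapp (.var 0) G) (uncurryTm p.1 (p.2.map fun A => A.subst (single p.1 G)) (f.shift 1)))
    Ps fs) 1 (.var 0))

theorem elimTm_tsubst (Ps : List (ℕ × List Ty)) (G : Ty) (fs : List Tm) (θ : ℕ → Ty) :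
    (elimTm Ps G fs).tsubst θ =
      elimTm (Ps.map (subL θ)) (G.subst θ) (fs.map fun f => f.tsubst θ) := by
  simp only [elimTm, Tm.tsubst, inst_subst, tyT_subst, caseN_tsubst, List.map_zipWith,
    List.zipWith_map, uncurryTm_tsubst, subL, List.map_map, Function.comp_def, Ty.subst_subst,
    iter_up_succ_single, shift_tsubst, single_comp_iter_up]

theorem elimTm_subst (Ps : List (ℕ × List Ty)) (G : Ty) (fs : List Tm) (s : ℕ → Tm) :
    (elimTm Ps G fs).subst s = elimTm Ps G (fs.map fun f => f.subst s) := by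
  simp only [elimTm, Tm.subst]
  rw [caseN_subst (s₀ := s) (d' := 1) (fun n => rfl)]
  simp only [Tm.subst, List.map_zipWith, List.zipWith_map_right, uncurryTm_subst, Tm.shift_subst,
    Tm.up, Tm.scons]
  simp only [Tm.shift, Tm.subst_rename]

/-- In `t` the target type is the bound variable `X`, so the premises are first weakened past `X`
and then instantiated at it, which cancels. The extra weakening of the `fₖ` accounts for the
argument of the fold. -/
theorem bTerm_eq (Ps : List (ℕ × List Ty)) :
    bTerm Ps = elimTm (Ps.map (subL fun n => .var (n + 1))) (.var 0)
      ((vars Ps.length).map fun f => f.shift 1) := by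
  have eT : (tyT (Ps.map (subL fun n => .var (n + 1)))).inst (.var 0) = tyT Ps := by
    rw [← tyT_subst, subst_up_inst]
    exact (congrArg (tyT Ps).subst (by funext n; cases n <;> rfl)).trans (Ty.subst_var _)
  -- The two terms place their branches in contexts that differ by the abstracted variable; this
  -- trades the offset `1` for a weakening of the branches.
  have hc : ∀ us : List Tm, caseN (.var 0) us 1 (.var 0) =
      caseN (.var 0) (us.map fun u => u.subst (Tm.up fun n => .var (n + 1))) 0 (.var 0) := by
    intro us
    have := caseN_subst (C := .var 0) (us := us) (d := 1) (t := .var 0) (s := .var)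
      (s₀ := fun n => .var (n + 1)) (d' := 0) fun n => rfl
    rwa [Tm.subst_var] at this
  have hA : ∀ (m : ℕ) (A : Ty), (A.subst (Ty.up^[m + 1] fun n => .var (n + 1))).subst
      (single m (.var 0)) = A := by
    intro m A
    rw [Ty.subst_subst, iter_up_succ_single,
      show Ty.scons (.var 0) (fun n => .var (n + 1)) = Ty.var by funext n; cases n <;> rfl,
      Ty.iter_up_var, Ty.subst_var]
  rw [bTerm, elimTm, eT, hc]
  congr 2
  refine List.ext_getElem (by simp [length_vars]) fun k h₁ h₂ => ?_
  simp only [List.getElem_ofFn, List.getElem_map, List.getElem_zipWith, getElem_vars, subL,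
    List.map_map, Function.comp_def, hA, List.map_id', List.get_eq_getElem, Tm.subst,
    uncurryTm_subst]
  rw [uncurryTm]
  rfl

/-! ### Typing and computation of the eliminator. -/

theorem EpsEq.congr_right {Γ : List Ty} {t u u' : Tm} {A : Ty} (h : EpsEq Γ t u A) (e : u = u') :
    EpsEq Γ t u' A := e ▸ h

theorem forall₂_proj {Γ : List Ty} {As : List Ty} {t : Tm} (h : HasType Γ t (prodN As)) :
    List.Forall₂ (HasType Γ) ((List.range As.length).map fun j => proj As.length j t) As := by
  refine List.forall₂_iff_get.2 ⟨by simp, fun i h₁ h₂ => ?_⟩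
  simp only [List.get_eq_getElem, List.getElem_map, List.getElem_range]
  exact h.proj h₂

theorem HasType.uncurryTm {Γ : List Ty} {m : ℕ} {As : List Ty} {G : Ty} {f : Tm}
    (hA : (allN m (.arr (prodN As) (G.shift m))).Adm)
    (hf : HasType Γ f (allN m (arrows As (G.shift m)))) :
    HasType Γ (uncurryTm m As f) (allN m (.arr (prodN As) (G.shift m))) :=
  .tlamN hA (.lam hA.of_allN.1 ((HasType.tapps_tvars hf [prodN As] rfl).apps
    (forall₂_proj (.var_zero hA.of_allN.1))))

/-- Stated under the weakening past `Y⃗` and past further term variables, the setting of both the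
uniqueness principle of the existential and the ε-rule. -/
theorem uncurryTm_app {Γ Ξ : List Ty} {m J : ℕ} {As : List Ty} {G : Ty} {f W : Tm}
    (hΓ : CtxAdm Γ) (hA : (allN m (.arr (prodN As) (G.shift m))).Adm)
    (hf : HasType Γ f (allN m (arrows As (G.shift m)))) (hJ : Ξ.length = J)
    (hW : HasType (Ξ ++ shiftC m Γ) W (prodN As)) :
    EpsEq (Ξ ++ shiftC m Γ)
      (.app (tappVars (((uncurryTm m As f).tshift m).shift J) m) W)
      (apps (tappVars ((f.tshift m).shift J) m)
        ((List.range As.length).map fun j => proj As.length j W)) (G.shift m) := by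
  have h1 := (tappVars_tlamN (HasType.uncurryTm hA hf)).shift (hΓ.shiftC m) Ξ hJ
  have h2 := h1.hasType.2
  rw [tappVars_eq, tapps_shift, ← tappVars_eq] at h1
  cases h2 with
  | lam _ h2 =>
    have h3 := EpsEq.beta h2 hW
    refine (EpsEq.app h1 (.refl hW)).trans ?_
    refine h3.congr_right ?_
    rw [Tm.plug, Tm.rename_subst, apps_subst, tappVars_eq, tapps_subst, Tm.shift_subst,
      List.map_map]
    simp only [Function.comp_def, proj_subst, Tm.subst, upr, Tm.scons, Nat.add_zero]
    rw [Tm.shift, Tm.rename_eq_subst]; rfl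

/-- Terms `f⃗ₖ : ∀Y⃗ₖ. ⟨Aⱼₖ⟨G⟩⟩ⱼ ⇒ G` in an admissible context `Γ`. -/
structure ElimData (Ps : List (ℕ × List Ty)) (Γ : List Ty) (G : Ty) (fs : List Tm) : Prop where
  ctx : CtxAdm Γ
  adm : G.Adm
  alpha : (alpha Ps).Adm
  prem : ∀ p ∈ Ps, (premL p).Adm
  pos : ∀ p ∈ Ps, ∀ A ∈ p.2, Pos p.1 A
  length : fs.length = Ps.length
  type : ∀ k (h : k < fs.length) (h' : k < Ps.length),
    HasType Γ fs[k] ((premL Ps[k]).inst G)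

theorem ElimData.tsubst {Ps : List (ℕ × List Ty)} {Γ : List Ty} {G : Ty} {fs : List Tm}
    (h : ElimData Ps Γ G fs) {θ : ℕ → Ty} (hθ : ∀ n, (θ n).Adm) :
    ElimData (Ps.map (subL θ)) (Γ.map fun A => A.subst θ) (G.subst θ)
      (fs.map fun f => f.tsubst θ) where
  ctx B hB := by
    obtain ⟨A, hA, rfl⟩ := List.mem_map.1 hB
    exact (h.ctx A hA).subst hθ
  adm := h.adm.subst hθ
  alpha := by rw [← alpha_subst]; exact h.alpha.subst hθ
  prem p hp := by
    obtain ⟨q, hq, rfl⟩ := List.mem_map.1 hp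
    rw [← premL_subst_up]; exact (h.prem q hq).subst (adm_up hθ)
  pos p hp A hA := by
    obtain ⟨q, hq, rfl⟩ := List.mem_map.1 hp
    obtain ⟨C, hC, rfl⟩ := List.mem_map.1 hA
    exact OnlySign.subst_iter_up (h.pos q hq C hC) θ
  length := by simp [h.length]
  type k h₁ h₂ := by
    simp only [List.getElem_map]
    rw [← premL_subst_up, ← inst_subst]
    exact (h.type k (by simpa using h₁) (by simpa using h₂)).tsubst hθ

theorem ElimData.tshift {Ps : List (ℕ × List Ty)} {Γ : List Ty} {G : Ty} {fs : List Tm}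
    (h : ElimData Ps Γ G fs) (m : ℕ) :
    ElimData (Ps.map (subL fun n => .var (n + m))) (shiftC m Γ) (G.shift m)
      (fs.map fun f => f.tshift m) := by
  rw [shiftC_eq, Ty.shift, Ty.rename_eq_subst]; exact h.tsubst fun _ => trivial

theorem ElimData.shift {Ps : List (ℕ × List Ty)} {Γ : List Ty} {G : Ty} {fs : List Tm}
    (h : ElimData Ps Γ G fs) {Ξ : List Ty} (hΞ : CtxAdm Ξ) {k : ℕ} (hk : Ξ.length = k) :
    ElimData Ps (Ξ ++ Γ) G (fs.map fun f => f.shift k) where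
  ctx := hΞ.append h.ctx
  adm := h.adm
  alpha := h.alpha
  prem := h.prem
  pos := h.pos
  length := by simp [h.length]
  type k h₁ h₂ := by
    simp only [List.getElem_map]
    exact (h.type k (by simpa using h₁) h₂).shift Ξ hk

theorem ElimData.type' {Ps : List (ℕ × List Ty)} {Γ : List Ty} {G : Ty} {fs : List Tm}
    (h : ElimData Ps Γ G fs) {k : ℕ} (h₁ : k < fs.length) (h₂ : k < Ps.length) :
    HasType Γ fs[k] (allN Ps[k].1 (arrows (Ps[k].2.map fun A => A.subst (single Ps[k].1 G))
      (G.shift Ps[k].1))) := by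
  rw [← premL_inst]; exact h.type k h₁ h₂

theorem ElimData.adm_exPrem {Ps : List (ℕ × List Ty)} {Γ : List Ty} {G : Ty} {fs : List Tm}
    (h : ElimData Ps Γ G fs) {k : ℕ} (hk : k < Ps.length) :
    (allN Ps[k].1 (.arr (prodN (Ps[k].2.map fun A => A.subst (single Ps[k].1 G)))
      (G.shift Ps[k].1))).Adm := by
  have h1 := adm_summandsAt h.alpha h.adm _
    (List.getElem_mem (n := k) (l := summandsAt Ps G) (by rwa [length_summandsAt]))
  rw [getElem_summandsAt Ps G _ hk] at h1
  have h2 := h1.1.1.inst h.adm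
  rwa [exPrem_inst] at h2

/-- The branches of `b`. -/
theorem ElimData.branch {Ps : List (ℕ × List Ty)} {Γ : List Ty} {G : Ty} {fs : List Tm}
    (h : ElimData Ps Γ G fs) {k : ℕ} (h₁ : k < fs.length) (h₂ : k < Ps.length) {w : Tm}
    (hw : HasType Γ w ((summandsAt Ps G)[k]'(by rwa [length_summandsAt]))) :
    HasType Γ (.app (.tapp w G)
      (uncurryTm Ps[k].1 (Ps[k].2.map fun A => A.subst (single Ps[k].1 G)) fs[k])) G := by
  rw [getElem_summandsAt Ps G _ h₂] at hw
  have h3 := HasType.tapp hw h.adm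
  have h4 := HasType.uncurryTm (h.adm_exPrem h₂) (h.type' h₁ h₂)
  rw [← exPrem_inst] at h4
  exact .app h3 h4

theorem ElimData.branches {Ps : List (ℕ × List Ty)} {Γ : List Ty} {G : Ty} {fs : List Tm}
    (h : ElimData Ps Γ G fs) :
    List.Forall₂ (fun u A => HasType (A :: Γ) u G) (List.zipWith (fun p f =>
      .app (.tapp (.var 0) G) (uncurryTm p.1 (p.2.map fun A => A.subst (single p.1 G)) (f.shift 1)))
      Ps fs) (summandsAt Ps G) := by
  refine List.forall₂_iff_get.2 ⟨by simp [length_summandsAt, h.length], fun k h₁ h₂ => ?_⟩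
  have hk : k < Ps.length := by rwa [length_summandsAt] at h₂
  have hk' : k < fs.length := by rw [h.length]; exact hk
  have hS := adm_summandsAt h.alpha h.adm _ (List.getElem_mem h₂)
  have h3 := (h.shift (Ξ := [(summandsAt Ps G)[k]]) (by simpa [CtxAdm] using hS) rfl).branch
    (k := k) (by simpa using hk') hk (.var_zero hS)
  simpa using h3

theorem ElimData.hasType {Ps : List (ℕ × List Ty)} {Γ : List Ty} {G : Ty} {fs : List Tm}
    (h : ElimData Ps Γ G fs) : HasType Γ (elimTm Ps G fs) (.arr ((tyT Ps).inst G) G) := by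
  have hT := adm_tyT_inst h.alpha h.adm
  refine .lam hT ?_
  exact HasType.caseN (Ξ := [_]) h.adm h.branches (adm_summandsAt h.alpha h.adm) rfl
    (by rw [sumN_summandsAt]; exact .var_zero hT)

theorem ElimData.app {Ps : List (ℕ × List Ty)} {Γ : List Ty} {G : Ty} {fs : List Tm}
    (h : ElimData Ps Γ G fs) {a : Tm} (ha : HasType Γ a ((tyT Ps).inst G)) :
    EpsEq Γ (.app (elimTm Ps G fs) a) (caseN G (List.zipWith (fun p f =>
      .app (.tapp (.var 0) G) (uncurryTm p.1 (p.2.map fun A => A.subst (single p.1 G)) (f.shift 1)))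
      Ps fs) 0 a) G := by
  have h1 := h.hasType
  cases h1 with
  | lam _ h1 =>
    have h2 := EpsEq.beta h1 ha
    rw [Tm.plug, caseN_subst (d := 1) (s₀ := .var) (d' := 0) (fun n => rfl)] at h2
    simp only [Tm.up_var, Tm.subst_var, List.map_id'] at h2
    exact h2

/-- Computation rule of `b`. -/
theorem ElimData.app_inj {Ps : List (ℕ × List Ty)} {Γ : List Ty} {G : Ty} {fs : List Tm}
    (h : ElimData Ps Γ G fs) {k : ℕ} (h₁ : k < fs.length) (h₂ : k < Ps.length) {w : Tm}
    (hw : HasType Γ w ((summandsAt Ps G)[k]'(by rwa [length_summandsAt]))) :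
    EpsEq Γ (.app (elimTm Ps G fs) (inj (summandsAt Ps G) k w)) (.app (.tapp w G)
      (uncurryTm Ps[k].1 (Ps[k].2.map fun A => A.subst (single Ps[k].1 G)) fs[k])) G := by
  have hS := adm_summandsAt h.alpha h.adm
  have hk : k < (summandsAt Ps G).length := by rwa [length_summandsAt]
  have h3 := HasType.inj hS hk hw
  refine (h.app (by rw [← sumN_summandsAt]; exact h3)).trans ?_
  have h4 := caseN_inj (Ξ := []) h.adm h.branches hS rfl hk (by simp [h.length, h₂]) hw
  refine h4.congr_right ?_
  simp only [List.getElem_zipWith, Tm.plug, Tm.subst, uncurryTm_subst, Tm.shift_subst, Tm.scons]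
  congr 2
  exact Tm.subst_var _

/-- `in_T a`, or `a` if `α` is without `μX.` -/
def inTm (Ps : List (ℕ × List Ty)) (a : Tm) : Tm := if occL Ps then .inm (tyT Ps) a else a

theorem EpsEq.inTm {Ps : List (ℕ × List Ty)} {Γ : List Ty} {a a' : Tm} (hα : (alpha Ps).Adm)
    (h : EpsEq Γ a a' ((tyT Ps).inst (alpha Ps))) :
    EpsEq Γ (inTm Ps a) (inTm Ps a') (alpha Ps) := by
  cases ho : occL Ps with
  | true =>
    rw [alpha_of_occ ho] at hα h ⊢
    simp only [Yoneda.inTm, ho, if_true]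
    exact .inm hα h
  | false =>
    simp only [Yoneda.inTm, ho, Bool.false_eq_true, if_false]
    rwa [← alpha_of_not_occ ho] at h

theorem inTm_subst (Ps : List (ℕ × List Ty)) (a : Tm) (s : ℕ → Tm) :
    (inTm Ps a).subst s = inTm Ps (a.subst s) := by
  simp only [inTm]; split <;> rfl

theorem inTm_tsubst (Ps : List (ℕ × List Ty)) (a : Tm) (θ : ℕ → Ty) :
    (inTm Ps a).tsubst θ = inTm (Ps.map (subL θ)) (a.tsubst θ) := by
  simp only [inTm, occL_subL]
  split
  · rw [Tm.tsubst, tyT_subst]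
  · rfl

/-- `in_T (inₖ (pack[Y⃗ₖ] ⟨zⱼ⟩ⱼ))`, under the type variables `Y⃗ₖ`. -/
def aBody (Ps : List (ℕ × List Ty)) (p : ℕ × List Ty) (k : ℕ) : Tm :=
  let Ps' := Ps.map (subL fun n => .var (n + p.1))
  inTm Ps' (inj (summandsAt Ps' (alpha Ps')) k
    (pack p.1 ((prodN (p.2.map fun A => A.subst (single p.1 (alpha Ps)))).rename
      (upr^[p.1] (fun n => n + p.1))) (tuple (vars p.2.length))))

/-! ### The constructors as a family stable under substitution. -/

theorem shift_eq_subst (A : Ty) (m : ℕ) : A.shift m = A.subst fun n => .var (n + m) :=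
  Ty.rename_eq_subst A _

/-- Under `Y⃗ₖ` all types are those of the weakened premises, so they can be written as `α` and `T`
of another list of premises. The general lemmas then apply below the quantifiers. -/
theorem aHat_eq (Ps : List (ℕ × List Ty)) (k : Fin Ps.length) :
    aHat Ps k = tlamN Ps[k].1
      (lams (Ps[k].2.map fun A => A.subst (single Ps[k].1 (alpha Ps))) (aBody Ps Ps[k] k)) := by
  have e1 : ∀ m, (summands Ps).map (fun S => (S.inst (alpha Ps)).shift m) =
      summandsAt (Ps.map (subL fun n => .var (n + m)))
        (alpha (Ps.map (subL fun n => .var (n + m)))) := by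
    intro m
    rw [← alpha_subst, ← summandsAt_subst, summandsAt, List.map_map]
    exact List.map_congr_left fun S _ => shift_eq_subst _ _
  have e2 : ∀ m, (tyT Ps).rename (upr fun n => n + m) =
      tyT (Ps.map (subL fun n => .var (n + m))) := by
    intro m; rw [← tyT_subst, Ty.rename_eq_subst, Ty.up_ren]
  simp only [aHat, aBody, inTm, e1, e2, occL_subL, prodN_subst, List.get_eq_getElem,
    Fin.getElem_fin]

theorem subL_subL (Ps : List (ℕ × List Ty)) (σ τ : ℕ → Ty) :
    (Ps.map (subL σ)).map (subL τ) = Ps.map (subL fun n => (σ n).subst τ) := by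
  rw [List.map_map]
  refine List.map_congr_left fun p _ => ?_
  simp only [Function.comp_apply, subL, List.map_map, Function.comp_def, Ty.subst_subst,
    Ty.iter_up_comp]

theorem subL_single (p : ℕ × List Ty) (E : Ty) (θ : ℕ → Ty) :
    (p.2.map fun A => A.subst (single p.1 E)).map (fun A => A.subst (Ty.up^[p.1] θ)) =
      (subL θ p).2.map fun A => A.subst (single p.1 (E.subst θ)) := by
  simp only [subL, List.map_map, Function.comp_def, Ty.subst_subst, single_comp_iter_up,
    iter_up_succ_single]

theorem getElem_summandsAt_map (Ps : List (ℕ × List Ty)) (E : Ty) (θ : ℕ → Ty) {k : ℕ}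
    (h : k < (summandsAt (Ps.map (subL θ)) (E.subst θ)).length) (hk : k < Ps.length) :
    (summandsAt (Ps.map (subL θ)) (E.subst θ))[k] = ex Ps[k].1
      ((prodN (Ps[k].2.map fun A => A.subst (single Ps[k].1 E))).subst (Ty.up^[Ps[k].1] θ)) := by
  rw [getElem_summandsAt _ _ _ (by simpa using hk)]
  simp only [List.getElem_map]
  rw [prodN_subst, subL_single]; rfl

theorem getElem_summandsAt_shift (Ps : List (ℕ × List Ty)) (m : ℕ) {k : ℕ}
    (h : k < (summandsAt (Ps.map (subL fun n => .var (n + m)))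
      (alpha (Ps.map (subL fun n => .var (n + m))))).length) (hk : k < Ps.length) :
    (summandsAt (Ps.map (subL fun n => .var (n + m)))
      (alpha (Ps.map (subL fun n => .var (n + m)))))[k] = ex Ps[k].1
      ((prodN (Ps[k].2.map fun A => A.subst (single Ps[k].1 (alpha Ps)))).rename
        (upr^[Ps[k].1] fun n => n + m)) := by
  rw [Ty.rename_eq_subst, ← Ty.iter_up_ren]
  simp only [← alpha_subst] at h ⊢
  exact getElem_summandsAt_map Ps _ _ h hk

theorem aBody_tsubst (Ps : List (ℕ × List Ty)) (θ : ℕ → Ty) (p : ℕ × List Ty) (k : ℕ) :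
    (aBody Ps p k).tsubst (Ty.up^[p.1] θ) = aBody (Ps.map (subL θ)) (subL θ p) k := by
  have e : (Ps.map (subL fun n => .var (n + p.1))).map (subL (Ty.up^[p.1] θ)) =
      (Ps.map (subL θ)).map (subL fun n => .var (n + p.1)) := by
    simp only [subL_subL, Ty.subst, Ty.iter_up_add, shift_eq_subst]
  simp only [aBody, inTm_tsubst, inj_tsubst, summandsAt_subst, alpha_subst, e, pack_tsubst,
    rename_upr_iter_up, prodN_subst, subL_single, tuple_tsubst]
  congr 3
  simp [vars, subL]; rfl

/-- Type substitution acts on the constructors through the premises alone; in particular a weakened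
constructor is the constructor of the weakened premises. -/
theorem aHat_tsubst (Ps : List (ℕ × List Ty)) (θ : ℕ → Ty) :
    (List.ofFn (aHat Ps)).map (fun f => f.tsubst θ) = List.ofFn (aHat (Ps.map (subL θ))) := by
  refine List.ext_getElem (by simp) fun k h₁ h₂ => ?_
  simp only [List.getElem_map, List.getElem_ofFn, aHat_eq, tlamN_tsubst, lams_tsubst,
    Fin.getElem_fin, aBody_tsubst, subL_single, alpha_subst]
  rfl

theorem HasType.aBody {Ps : List (ℕ × List Ty)} (hα : (alpha Ps).Adm) {k : ℕ} (hk : k < Ps.length)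
    (hA : ∀ A ∈ Ps[k].2, A.Adm) (Γ : List Ty) :
    HasType ((Ps[k].2.map fun A => A.subst (single Ps[k].1 (alpha Ps))).reverse ++ Γ)
      (aBody Ps Ps[k] k) ((alpha Ps).shift Ps[k].1) := by
  let m := Ps[k].1
  let Ps' := Ps.map (subL fun n => .var (n + m))
  have eα : (alpha Ps).shift m = alpha Ps' := by rw [shift_eq_subst, alpha_subst]
  have hα' : (alpha Ps').Adm := eα ▸ hα.shift m
  have hS := adm_summandsAt hα' hα'
  have hk' : k < (summandsAt Ps' (alpha Ps')).length := by
    rw [length_summandsAt]; simpa [Ps'] using hk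
  have eS : (summandsAt Ps' (alpha Ps'))[k] =
      ex m ((prodN (Ps[k].2.map fun A => A.subst (single m (alpha Ps)))).rename
        (upr^[m] (fun n => n + m))) := getElem_summandsAt_shift Ps m hk' hk
  have hE := hS _ (List.getElem_mem hk')
  rw [eS] at hE
  have hz := HasType.tuple (forall₂_vars (Ps[k].2.map fun A => A.subst (single m (alpha Ps))) Γ
    fun B hB => by
      obtain ⟨A, hA', rfl⟩ := List.mem_map.1 hB
      exact (hA A hA').subst (adm_single hα m))
  rw [List.length_map, ← rename_upr_add_sconsL m (prodN _)] at hz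
  have h1 := HasType.pack hE hz
  rw [← eS] at h1
  have h1 := HasType.inj hS hk' h1
  rw [sumN_summandsAt] at h1
  rw [eα]
  exact ((EpsEq.refl h1).inTm hα').hasType.1

/-- Typing in the empty context shows that the constructors have no free term variables, so later
weakenings and substitutions of terms leave them alone. -/
theorem HasType.aHat {Ps : List (ℕ × List Ty)} (hα : (alpha Ps).Adm)
    (hPs : ∀ p ∈ Ps, (premL p).Adm) (k : Fin Ps.length) :
    HasType [] (aHat Ps k) ((premL Ps[k]).inst (alpha Ps)) := by
  have h := (hPs Ps[k] (List.getElem_mem _)).inst hα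
  rw [premL_inst] at h ⊢
  rw [aHat_eq]
  exact .tlamN h (.lams (adm_arrows.1 h.of_allN).1
    (.aBody hα k.2 (hPs Ps[k] (List.getElem_mem _)).of_premL _))

/-! ### The isomorphism `≡_{X+}` -/

theorem map_subst_sconsL (us : List Tm) :
    (vars us.length).map (fun z => z.subst (Tm.sconsL us .var)) = us := by
  refine List.ext_getElem (by simp [length_vars]) fun k h₁ h₂ => ?_
  rw [List.getElem_map, getElem_vars _ _ (by simpa [length_vars] using h₂)]
  exact Tm.sconsL_get us .var k h₂

/-- The constructor `âₖ` applied to arguments. -/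
theorem aHat_app {Ps : List (ℕ × List Ty)} (hα : (alpha Ps).Adm) (hPs : ∀ p ∈ Ps, (premL p).Adm)
    {k : ℕ} (hk : k < Ps.length) {Δ : List Ty} {J : ℕ} {us : List Tm}
    (hu : List.Forall₂ (HasType Δ) us
      (Ps[k].2.map fun A => A.subst (single Ps[k].1 (alpha Ps)))) :
    EpsEq Δ (apps (tappVars (((aHat Ps ⟨k, hk⟩).tshift Ps[k].1).shift J) Ps[k].1) us)
      ((aBody Ps Ps[k] k).subst (Tm.sconsL us .var)) ((alpha Ps).shift Ps[k].1) := by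
  have h1 := HasType.aHat hα hPs ⟨k, hk⟩
  rw [(h1.tshift Ps[k].1).shift_closed]
  rw [Fin.getElem_fin, premL_inst, aHat_eq] at h1
  rw [aHat_eq]
  have h2 := (tappVars_tlamN h1).append Δ
  refine (h2.apps_left hu).trans (apps_lams ?_ hu)
  exact .aBody hα hk (hPs _ (List.getElem_mem _)).of_premL Δ

theorem aBody_subst (Ps : List (ℕ × List Ty)) (p : ℕ × List Ty) (k : ℕ) (us : List Tm)
    (hu : us.length = p.2.length) :
    (aBody Ps p k).subst (Tm.sconsL us .var) =
      inTm (Ps.map (subL fun n => .var (n + p.1)))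
        (inj (summandsAt (Ps.map (subL fun n => .var (n + p.1)))
          (alpha (Ps.map (subL fun n => .var (n + p.1))))) k
          (pack p.1 ((prodN (p.2.map fun A => A.subst (single p.1 (alpha Ps)))).rename
            (upr^[p.1] (fun n => n + p.1))) (tuple us))) := by
  simp only [aBody, inTm_subst, inj_subst, pack_subst, tuple_subst, ← hu, map_subst_sconsL]

theorem elimData_aHat {Ps : List (ℕ × List Ty)} (hα : (alpha Ps).Adm)
    (hPs : ∀ p ∈ Ps, (premL p).Adm) (hpos : ∀ p ∈ Ps, ∀ A ∈ p.2, Pos p.1 A) {Γ : List Ty}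
    (hΓ : CtxAdm Γ) : ElimData Ps Γ (alpha Ps) (List.ofFn (aHat Ps)) where
  ctx := hΓ
  adm := hα
  alpha := hα
  prem := hPs
  pos := hpos
  length := by simp
  type k h₁ h₂ := by
    rw [List.getElem_ofFn]
    exact (HasType.aHat hα hPs ⟨k, h₂⟩).of_closed Γ

/-- By uniqueness of case distinction and of existential elimination it suffices to compare both
sides on injected packages. There `âₖ Y⃗ₖ ⟨πⱼ y⟩ⱼ` repackages the tuple of projections of `y`, which
is `y`. -/
theorem elimTm_aHat {Ps : List (ℕ × List Ty)} (hα : (alpha Ps).Adm)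
    (hPs : ∀ p ∈ Ps, (premL p).Adm) (hpos : ∀ p ∈ Ps, ∀ A ∈ p.2, Pos p.1 A) {Γ : List Ty}
    (hΓ : CtxAdm Γ) :
    EpsEq ((tyT Ps).inst (alpha Ps) :: Γ)
      (.app (elimTm Ps (alpha Ps) (List.ofFn (aHat Ps))) (.var 0)) (inTm Ps (.var 0))
      (alpha Ps) := by
  have hT := adm_tyT_inst hα hα
  have hS := adm_summandsAt hα hα
  let Δ := (tyT Ps).inst (alpha Ps) :: Γ
  have hΔ : CtxAdm Δ := hΓ.cons hT
  have hin : ∀ {Ξ a}, HasType Ξ a ((tyT Ps).inst (alpha Ps)) →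
      HasType Ξ (inTm Ps a) (alpha Ps) := fun ha => ((EpsEq.refl ha).inTm hα).hasType.1
  have D := elimData_aHat hα hPs hpos hΔ
  refine (D.app (.var_zero hT)).trans ?_
  have key := caseN_eta (Ξ := []) (h := inTm Ps (.var 0)) (t := .var 0) hΔ hS rfl
    D.branches.length_eq (hin (by rw [sumN_summandsAt]; exact .var_zero hT)) ?_
    (by rw [sumN_summandsAt]; exact .var_zero hT)
  · rw [Tm.plug, inTm_subst] at key; exact key
  intro k h₁ h₂
  have hk : k < Ps.length := by rwa [length_summandsAt] at h₂
  have hE := hS _ (List.getElem_mem h₂)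
  have D' := D.shift (k := 1) (Ξ := [(summandsAt Ps (alpha Ps))[k]]) (by simpa [CtxAdm] using hE) rfl
  have hk' : k < ((List.ofFn (aHat Ps)).map fun f => f.shift 1).length := by simpa using hk
  have hf := D'.type' hk' hk
  have hg := HasType.uncurryTm (D.adm_exPrem hk) hf
  have hE' := hE
  rw [getElem_summandsAt Ps _ _ hk] at hE'
  have hz : HasType ((summandsAt Ps (alpha Ps))[k] :: Δ) (.var 0) (ex Ps[k].1
      (prodN (Ps[k].2.map fun A => A.subst (single Ps[k].1 (alpha Ps))))) := by
    rw [← getElem_summandsAt Ps _ h₂ hk]; exact .var_zero hE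
  have hh : HasType (ex Ps[k].1 (prodN (Ps[k].2.map fun A =>
      A.subst (single Ps[k].1 (alpha Ps)))) :: (summandsAt Ps (alpha Ps))[k] :: Δ)
      (inTm Ps (inj (summandsAt Ps (alpha Ps)) k (.var 0))) (alpha Ps) := by
    refine hin ?_
    rw [← sumN_summandsAt]
    refine HasType.inj hS h₂ ?_
    rw [getElem_summandsAt Ps _ _ hk]
    exact .var_zero hE'
  -- The `k`-th branch eliminates a package; it is compared with the map sending `z` to `in_T (inₖ
  -- z)`.
  have fin := ex_eta D'.ctx hh hz (by rw [exPrem_inst]; exact hg) ?_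
  · rw [Tm.plug, inTm_subst, inj_subst] at fin
    rw [Tm.plug, inTm_subst]
    simp only [List.getElem_zipWith]
    simp only [List.getElem_map] at fin
    exact fin
  · have hf1 : ((List.ofFn (aHat Ps)).map fun f => f.shift 1)[k] = aHat Ps ⟨k, hk⟩ := by
      rw [List.getElem_map, List.getElem_ofFn, (HasType.aHat hα hPs ⟨k, hk⟩).shift_closed]
    have hv : HasType ([prodN (Ps[k].2.map fun A => A.subst (single Ps[k].1 (alpha Ps)))] ++
        shiftC Ps[k].1 ([(summandsAt Ps (alpha Ps))[k]] ++ Δ)) (.var 0)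
        (prodN (Ps[k].2.map fun A => A.subst (single Ps[k].1 (alpha Ps)))) := .var_zero hE'.of_ex
    have h3 := uncurryTm_app (J := 1) D'.ctx (D.adm_exPrem hk) hf rfl hv
    refine EpsEq.trans ?_ h3.symm
    have hpr := forall₂_proj (HasType.var_zero (Γ := shiftC Ps[k].1
      ((summandsAt Ps (alpha Ps))[k] :: Δ)) hE'.of_ex)
    have h4 := aHat_app hα hPs hk (J := 1) hpr
    rw [aBody_subst _ _ _ _ (by simp)] at h4
    rw [hf1]
    refine EpsEq.trans ?_ h4.symm
    have eα : (alpha Ps).shift Ps[k].1 =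
        alpha (Ps.map (subL fun n => .var (n + Ps[k].1))) := by rw [shift_eq_subst, alpha_subst]
    have hα' := hα.shift Ps[k].1
    rw [eα] at hα' ⊢
    have hS' := adm_summandsAt hα' hα'
    have hk2 : k < (summandsAt (Ps.map (subL fun n => .var (n + Ps[k].1)))
      (alpha (Ps.map (subL fun n => .var (n + Ps[k].1))))).length := by simpa [length_summandsAt]
    have eS := getElem_summandsAt_shift Ps Ps[k].1 hk2 hk
    have hP := hS' _ (List.getElem_mem hk2)
    rw [eS] at hP
    -- The content of a package was taken apart by uncurrying; surjectivity of tuples puts it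
    -- together again.
    have hy := tuple_proj (HasType.var_zero (Γ := shiftC Ps[k].1
      ((summandsAt Ps (alpha Ps))[k] :: Δ)) hE'.of_ex)
    have hy' := EpsEq.pack ((hΔ.cons hE).shiftC _ |>.cons hE'.of_ex) hP
      (by rw [rename_upr_add_sconsL]; exact hy.symm)
    rw [← eS] at hy'
    have hy'' := hy'.inj hS' hk2
    rw [sumN_summandsAt] at hy''
    have fin := hy''.inTm hα'
    simp only [Tm.tshift, Tm.plug, inTm_tsubst, inj_tsubst, summandsAt_subst, alpha_subst,
      inTm_subst, inj_subst]
    exact fin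

/-- `fold_T b`, or `b` if `α` is without `μX.` -/
def foldTm (Ps : List (ℕ × List Ty)) (b : Tm) : Tm := if occL Ps then .foldm (tyT Ps) b else b

theorem foldTm_subst (Ps : List (ℕ × List Ty)) (b : Tm) (s : ℕ → Tm) :
    (foldTm Ps b).subst s = foldTm Ps (b.subst s) := by
  simp only [foldTm]; split <;> rfl

theorem foldTm_tsubst (Ps : List (ℕ × List Ty)) (b : Tm) (θ : ℕ → Ty) :
    (foldTm Ps b).tsubst θ = foldTm (Ps.map (subL θ)) (b.tsubst θ) := by
  simp only [foldTm, occL_subL]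
  split
  · rw [Tm.tsubst, tyT_subst]
  · rfl

theorem HasType.foldTm {Ps : List (ℕ × List Ty)} {Γ : List Ty} {G : Ty} {b : Tm}
    (hα : (alpha Ps).Adm) (hb : HasType Γ b (.arr ((tyT Ps).inst G) G)) :
    HasType Γ (foldTm Ps b) (.arr (alpha Ps) G) := by
  cases ho : occL Ps with
  | true =>
    rw [alpha_of_occ ho] at hα ⊢
    simp only [Yoneda.foldTm, ho, if_true]
    exact .foldm hα hb
  | false =>
    simp only [Yoneda.foldTm, ho, Bool.false_eq_true, if_false]
    rwa [alpha_of_not_occ ho G]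

/-- `fold_T(λx. b[x]) x`, in context `Γ, x`. -/
def foldVar (Ps : List (ℕ × List Ty)) (G : Ty) (fs : List Tm) : Tm :=
  .app ((foldTm Ps (elimTm Ps G fs)).shift 1) (.var 0)

theorem foldVar_eq (Ps : List (ℕ × List Ty)) (G : Ty) (fs : List Tm) :
    foldVar Ps G fs =
      .app (foldTm Ps (elimTm Ps G (fs.map fun f => f.shift 1))) (.var 0) := by
  simp only [foldVar, Tm.shift, Tm.rename_eq_subst, foldTm_subst, elimTm_subst]

theorem foldVar_tsubst (Ps : List (ℕ × List Ty)) (G : Ty) (fs : List Tm) (θ : ℕ → Ty) :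
    (foldVar Ps G fs).tsubst θ =
      foldVar (Ps.map (subL θ)) (G.subst θ) (fs.map fun f => f.tsubst θ) := by
  simp only [foldVar, Tm.tsubst, shift_tsubst, foldTm_tsubst, elimTm_tsubst]

theorem foldVar_subst_up (Ps : List (ℕ × List Ty)) (G : Ty) (fs : List Tm) (s : ℕ → Tm) :
    (foldVar Ps G fs).subst (Tm.up s) = foldVar Ps G (fs.map fun f => f.subst s) := by
  simp only [foldVar, Tm.subst, foldTm_subst, elimTm_subst, Tm.up, Tm.scons,
    Tm.shift, Tm.rename_eq_subst, Tm.subst_subst, List.map_map, Function.comp_def]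

theorem foldVar_plug (Ps : List (ℕ × List Ty)) (G : Ty) (fs : List Tm) (k : ℕ) (a : Tm) :
    (foldVar Ps G fs).plug k a =
      .app (foldTm Ps (elimTm Ps G (fs.map fun f => f.shift k))) a := by
  rw [foldVar, app_plug, shift_plug]
  simp only [Tm.shift, Tm.rename_eq_subst, foldTm_subst, elimTm_subst]; rfl

theorem ElimData.foldVar {Ps : List (ℕ × List Ty)} {Γ : List Ty} {G : Ty} {fs : List Tm}
    (h : ElimData Ps Γ G fs) : HasType (Yoneda.alpha Ps :: Γ) (foldVar Ps G fs) G :=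
  .app ((HasType.foldTm h.alpha h.hasType).shift_one _) (.var_zero h.alpha)

theorem fmap_var_zero {A : Ty} {b : Bool} {i : ℕ} {σ : ℕ → Ty} {Γ : List Ty} (hΓ : CtxAdm Γ)
    (hA : A.Adm) (hs : OnlySign b i A) (hσ : ∀ n, (σ n).Adm) :
    EpsEq (A.subst σ :: Γ) (fmap A i σ σ (.var 0)) (.var 0) (A.subst σ) :=
  fmap_id hΓ hA hs hσ fun k => .var_zero ((hσ i).shift k)

/-- `fold_T(λx. b[x]) x ≃ x` for the constructors `â`. -/
theorem foldVar_aHat {Ps : List (ℕ × List Ty)} (hα : (alpha Ps).Adm)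
    (hPs : ∀ p ∈ Ps, (premL p).Adm) (hpos : ∀ p ∈ Ps, ∀ A ∈ p.2, Pos p.1 A) {Γ : List Ty}
    (hΓ : CtxAdm Γ) :
    EpsEq (alpha Ps :: Γ) (foldVar Ps (alpha Ps) (List.ofFn (aHat Ps))) (.var 0) (alpha Ps) := by
  have h1 := elimTm_aHat hα hPs hpos hΓ
  have hb := (elimData_aHat hα hPs hpos (Γ := []) (by simp [CtxAdm])).hasType
  have hb1 := hb.shift_closed 1
  cases ho : occL Ps with
  | true =>
    have hbΓ := hb.of_closed Γ
    simp only [foldVar, foldTm, ho, if_true]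
    simp only [inTm, ho, if_true] at h1
    rw [alpha_of_occ ho] at h1 hb1 hbΓ hα ⊢
    -- Uniqueness of the fold for the identity map on `α`: its premise is the equation for `b` at
    -- the constructors, as the action of `T` on the identity is the identity.
    refine (EpsEq.mu_eta hα hbΓ (.var_zero hα) (h1.symm.trans
      (.app (A := (tyT Ps).inst (.mu (tyT Ps))) ?_ ?_))).symm
    · have := hbΓ.shift_one ((tyT Ps).inst (.mu (tyT Ps)))
      rw [hb1] at this ⊢
      exact .refl this
    · exact (fmap_var_zero hΓ hα.1 hα.2 (adm_single hα 0)).symm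
  | false =>
    simp only [foldVar, foldTm, ho, Bool.false_eq_true, if_false, hb1]
    simp only [inTm, ho, Bool.false_eq_true, if_false] at h1
    rwa [← alpha_of_not_occ ho] at h1

/-! ### The fold as an algebra homomorphism. -/

theorem subst_sconsL_eq_single (m : ℕ) (A E : Ty) :
    (A.subst (single m E)).subst (Ty.sconsL (tvars m) Ty.var) =
      A.subst (Ty.sconsL (tvars m) (Ty.scons E Ty.var)) := by
  have e := single_sconsL E (tvars m) Ty.var
  rw [length_tvars, Ty.subst_var] at e
  rw [Ty.subst_subst, e]

theorem ElimData.adm_ex {Ps : List (ℕ × List Ty)} {Γ : List Ty} {G : Ty} {fs : List Tm}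
    (h : ElimData Ps Γ G fs) (ho : occL Ps = true) : ∀ S ∈ summands Ps, S.Adm := by
  have h1 := h.alpha
  rw [alpha_of_occ ho] at h1
  exact adm_sumN.1 h1.1

theorem sconsL_ne {m n : ℕ} {σ : ℕ → Ty} (E F : Ty) (h : n ≠ m) :
    Ty.sconsL (tvars m) (Ty.scons E σ) n = Ty.sconsL (tvars m) (Ty.scons F σ) n := by
  rw [Ty.sconsL_tvars, Ty.sconsL_tvars]
  split
  · rfl
  · obtain ⟨k, hk⟩ : ∃ k, n - m = k + 1 := ⟨n - m - 1, by omega⟩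
    rw [hk]; rfl

/-- Computation rule of `fold_T(λx. b[x])`. -/
theorem ElimData.foldTm_inTm {Ps : List (ℕ × List Ty)} {Γ : List Ty} {G : Ty} {fs : List Tm}
    (h : ElimData Ps Γ G fs) {k : ℕ} (h₁ : k < fs.length) (h₂ : k < Ps.length) {u : Tm}
    (hu : HasType Γ u ((prodN Ps[k].2).subst
      (Ty.sconsL (tvars Ps[k].1) (Ty.scons (Yoneda.alpha Ps) Ty.var)))) :
    ∃ W, HasType Γ W ((prodN Ps[k].2).subst (Ty.sconsL (tvars Ps[k].1) (Ty.scons G Ty.var))) ∧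
      EpsEq Γ (.app (foldTm Ps (elimTm Ps G fs)) (inTm Ps (inj (summandsAt Ps (Yoneda.alpha Ps)) k
          (pack Ps[k].1 (prodN (Ps[k].2.map fun A =>
            A.subst (single Ps[k].1 (Yoneda.alpha Ps)))) u))))
        (.app (tappVars (uncurryTm Ps[k].1 (Ps[k].2.map fun A => A.subst (single Ps[k].1 G))
          fs[k]) Ps[k].1) W) G ∧
      ∀ j (hj : j < Ps[k].2.length), EpsEq Γ (proj Ps[k].2.length j W)
        ((fmap Ps[k].2[j] Ps[k].1 (Ty.sconsL (tvars Ps[k].1) (Ty.scons (Yoneda.alpha Ps) Ty.var))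
          (Ty.sconsL (tvars Ps[k].1) (Ty.scons G Ty.var)) (Yoneda.foldVar Ps G fs)).plug 0
            (proj Ps[k].2.length j u))
        (Ps[k].2[j].subst (Ty.sconsL (tvars Ps[k].1) (Ty.scons G Ty.var))) := by
  have hα := h.alpha
  have hG := h.adm
  have hm : Ps[k] ∈ Ps := List.getElem_mem _
  have hAs := (h.prem _ hm).of_premL
  have hpos := h.pos _ hm
  have hkα : k < (summandsAt Ps (Yoneda.alpha Ps)).length := by rwa [length_summandsAt]
  have hkG : k < (summandsAt Ps G).length := by rwa [length_summandsAt]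
  have hSα := adm_summandsAt hα hα
  have hSG := adm_summandsAt hα hG
  have hE := hSα _ (List.getElem_mem hkα)
  rw [getElem_summandsAt Ps _ _ h₂] at hE
  have hu' : HasType Γ u ((prodN (Ps[k].2.map fun A =>
      A.subst (single Ps[k].1 (Yoneda.alpha Ps)))).subst (Ty.sconsL (tvars Ps[k].1) Ty.var)) := by
    rw [← prodN_subst, subst_sconsL_eq_single]; exact hu
  have hp := HasType.pack hE hu'
  rw [← getElem_summandsAt Ps _ hkα h₂] at hp
  have hg := HasType.uncurryTm (h.adm_exPrem h₂) (h.type' h₁ h₂)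
  cases ho : occL Ps with
  | false =>
    have hoA : ∀ A ∈ Ps[k].2, occ Ps[k].1 A = false := fun A hA => by
      simp only [occL, List.any_eq_false, Bool.not_eq_true] at ho
      exact ho _ hm A hA
    have eA : (Ps[k].2.map fun A => A.subst (single Ps[k].1 (Yoneda.alpha Ps))) =
        Ps[k].2.map fun A => A.subst (single Ps[k].1 G) :=
      List.map_congr_left fun A hA => subst_congr_of_occ_false (hoA A hA) fun n hn =>
        single_ne _ _ hn
    have eσ : ∀ A ∈ Ps[k].2,
        A.subst (Ty.sconsL (tvars Ps[k].1) (Ty.scons (Yoneda.alpha Ps) Ty.var)) =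
          A.subst (Ty.sconsL (tvars Ps[k].1) (Ty.scons G Ty.var)) := fun A hA =>
      subst_congr_of_occ_false (hoA A hA) fun n hn => sconsL_ne _ _ hn
    have eS : summandsAt Ps (Yoneda.alpha Ps) = summandsAt Ps G := by
      refine List.map_congr_left fun S hS => inst_eq_of_occ_false ?_ _ _
      have := (occ_tyT Ps).trans ho
      simp only [tyT, occ_sumN, List.any_eq_false, Bool.not_eq_true] at this
      exact this S hS
    -- With `X` absent, the types at `α` and at `G` coincide and nothing has to be mapped, so `W` is
    -- `u` itself.
    refine ⟨u, ?_, ?_, fun j hj => ?_⟩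
    · rw [prodN_subst, ← List.map_congr_left eσ, ← prodN_subst]; exact hu
    · simp only [foldTm, inTm, ho, Bool.false_eq_true, if_false]
      rw [eA] at hp hu' hE ⊢
      simp only [eS] at hp ⊢
      refine (h.app_inj h₁ h₂ hp).trans ?_
      rw [← exPrem_inst] at hg
      exact pack_app hE hG hu' hg
    · have h3 := fmap_of_occ_false (t := Yoneda.foldVar Ps G fs) h.ctx
        (hAs _ (List.getElem_mem hj)) (hoA _ (List.getElem_mem hj))
        (adm_sconsL (adm_tvars (m := Ps[k].1)) (adm_scons hα (σ := Ty.var) fun _ => trivial))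
        (τ := Ty.sconsL (tvars Ps[k].1) (Ty.scons G Ty.var)) fun n hn => sconsL_ne _ _ fun e => by
          subst e; rw [hoA _ (List.getElem_mem hj)] at hn; cases hn
      rw [prodN_subst] at hu
      have h4 := HasType.proj hu (j := j) (by simpa using hj)
      simp only [List.getElem_map, List.length_map] at h4
      rw [← eσ _ (List.getElem_mem hj)]
      exact (h3.plug_zero h.ctx (.refl h4)).symm
  | true =>
    have hS := h.adm_ex ho
    have hv := h.foldVar
    have hmu := h.alpha
    have hf := h.hasType
    have hQ : (ex Ps[k].1 (prodN Ps[k].2)).Adm := hS _ (List.mem_map_of_mem hm)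
    have hs : OnlySign true (0 + Ps[k].1) (prodN Ps[k].2) := by
      rw [Nat.zero_add]; exact OnlySign.prodN hpos
    have hσ := adm_single hα 0
    have hτ := adm_single hG 0
    have hst : ∀ n, n ≠ 0 → single 0 (Yoneda.alpha Ps) n = single 0 G n :=
      fun n hn => single_ne _ _ hn
    have ht : HasType (single 0 (Yoneda.alpha Ps) 0 :: Γ) (Yoneda.foldVar Ps G fs)
      (single 0 G 0) := hv
    have h5 := fmap_ex_pack hQ hs hσ hτ hst hG ht hu (by rw [prodN_subst]; exact hg)
    have hW := (HasType.fmap (i := Ps[k].1) hQ.of_ex (OnlySign.prodN hpos)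
      (adm_sconsL (adm_tvars (m := Ps[k].1)) hσ) (adm_sconsL (adm_tvars (m := Ps[k].1)) hτ)
      (fun n hn => sconsL_ne _ _ hn) (t := Yoneda.foldVar Ps G fs) (Γ := Γ) (by
        simp only [cond_true, Ty.sconsL_self (length_tvars _)]; exact ht)).plug_zero hu
    -- With `X` present, `W` is the image of `u` under the action of the product, whose components
    -- are given by naturality of the projections.
    refine ⟨_, hW, ?_, fun j hj => proj_fmap_prodN hW hj⟩
    have hT : ∀ S ∈ summands Ps, HasType (S.subst (single 0 (Yoneda.alpha Ps)) :: Γ)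
        (fmap S 0 (single 0 (Yoneda.alpha Ps)) (single 0 G) (Yoneda.foldVar Ps G fs))
        (S.subst (single 0 G)) := fun S hS' => by
      refine HasType.fmap (b := true) (hS S hS') ?_ hσ hτ hst ht
      obtain ⟨p, hp, rfl⟩ := List.mem_map.1 hS'
      exact OnlySign.ex (OnlySign.prodN fun A hA => by rw [Nat.zero_add]; exact h.pos p hp A hA)
    have hk : k < (summands Ps).length := by simpa [summands] using h₂
    have eS : (summands Ps)[k] = ex Ps[k].1 (prodN Ps[k].2) := by simp [summands]
    have hp' : HasType Γ (pack Ps[k].1 (prodN (Ps[k].2.map fun A =>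
        A.subst (single Ps[k].1 (Yoneda.alpha Ps)))) u)
        ((summands Ps)[k].subst (single 0 (Yoneda.alpha Ps))) := by
      simp only [summandsAt, List.getElem_map] at hp
      exact hp
    have h6 := fmap_sumN_inj (fun S hS' => (hS S hS').subst hσ) hT hk hp'
    have h7 := HasType.inj hSα hkα hp
    rw [sumN_summandsAt] at h7
    have ev : act (tyT Ps) 0 (.mu (tyT Ps)) G
        (.app ((Tm.foldm (tyT Ps) (elimTm Ps G fs)).shift 1) (.var 0)) =
        fmap (tyT Ps) 0 (single 0 (Yoneda.alpha Ps)) (single 0 G) (Yoneda.foldVar Ps G fs) := by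
      rw [act, Tm.tshift_zero, Yoneda.foldVar, foldTm, if_pos ho, alpha_of_occ ho]
    simp only [foldTm, inTm, ho, if_true]
    -- The fold unrolls once; its recursive calls form the action of `T`, which passes first through
    -- the injection (`h6`) and, after `b` has selected its branch, through the package (`h5`).
    have h8 : EpsEq Γ (.app (.foldm (tyT Ps) (elimTm Ps G fs)) (.inm (tyT Ps)
        (inj (summandsAt Ps (Yoneda.alpha Ps)) k (pack Ps[k].1 (prodN (Ps[k].2.map fun A =>
            A.subst (single Ps[k].1 (Yoneda.alpha Ps)))) u))))
        (.app (elimTm Ps G fs) ((act (tyT Ps) 0 (.mu (tyT Ps)) G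
          (.app ((Tm.foldm (tyT Ps) (elimTm Ps G fs)).shift 1) (.var 0))).plug 0
            (inj (summandsAt Ps (Yoneda.alpha Ps)) k (pack Ps[k].1 (prodN (Ps[k].2.map fun A =>
            A.subst (single Ps[k].1 (Yoneda.alpha Ps)))) u)))) G := by
      refine EpsEq.mu_beta ?_ hf ?_
      · rw [← alpha_of_occ ho]; exact hmu
      · rw [← alpha_of_occ ho]; exact h7
    rw [ev] at h8
    refine (h8.trans (.app (.refl hf) h6)).trans ?_
    have h9 := h.app_inj h₁ h₂ (by
      simp only [summandsAt, List.getElem_map]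
      exact (hT _ (List.getElem_mem hk)).plug_zero hp')
    refine h9.trans ?_
    rw [eS]
    rw [Nat.zero_add, prodN_subst] at h5
    exact h5

/-- Computation below `Y⃗` uses premises weakened past `Y⃗`, which bind copies of `Y⃗` of their own.
Filling these copies with the free variables gives the types that the ε-rule mentions. -/
theorem iter_up_shift_sconsL (m : ℕ) (E : Ty) (n : ℕ) :
    (Ty.up^[m + 1] (fun n => .var (n + m)) n).subst
      (Ty.sconsL (tvars m) (Ty.scons (E.shift m) Ty.var)) = single m E n := by
  have e := congrFun (Ty.iter_up_sconsL (tvars m) (Ty.up fun n => .var (n + m))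
    (Ty.scons (E.shift m) Ty.var)) n
  have e' := congrFun (single_sconsL E (tvars m) fun n => .var (n + m)) n
  rw [length_tvars] at e e'
  have e2 : single m E n = (single m E n).subst (Ty.sconsL (tvars m) fun n => .var (n + m)) := by
    rw [sconsL_tvars_shift, Ty.subst_var]
  rw [Function.iterate_succ_apply, e, up_scons, e2, e', shift_eq_subst]
  rfl

theorem subL_sconsL (p : ℕ × List Ty) (E : Ty) :
    (prodN (subL (fun n => .var (n + p.1)) p).2).subst
      (Ty.sconsL (tvars p.1) (Ty.scons (E.shift p.1) Ty.var)) =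
      prodN (p.2.map fun A => A.subst (single p.1 E)) := by
  simp only [prodN_subst, subL, List.map_map, Function.comp_def, Ty.subst_subst,
    iter_up_shift_sconsL]

theorem fmap_shift_sconsL (m : ℕ) (A E F : Ty) (t : Tm) :
    fmap (A.subst (Ty.up^[m + 1] fun n => .var (n + m))) m
      (Ty.sconsL (tvars m) (Ty.scons (E.shift m) Ty.var))
      (Ty.sconsL (tvars m) (Ty.scons (F.shift m) Ty.var)) t =
      fmap A m (single m E) (single m F) t := by
  have e : ∀ E n, Ty.sconsL (tvars m) (Ty.scons (Ty.shift m E) Ty.var)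
      (upr^[m + 1] (fun n => n + m) n) = single m E n := by
    intro E n
    rw [← iter_up_shift_sconsL, Ty.iter_up_ren]; rfl
  rw [Ty.iter_up_ren, ← Ty.rename_eq_subst]
  refine fmap_rename (fun n _ => ?_) (fun n _ => e E n) (fun n _ => e F n) fun _ => rfl
  rcases lt_or_ge n (m + 1) with h | h
  · rw [iter_upr_lt _ h]
  · obtain ⟨k, rfl⟩ := Nat.exists_eq_add_of_le' h
    rw [iter_upr_add]; omega

/-- Brings the action as it appears in the ε-rule into the form produced by the computation rule of
the fold for the weakened premises. -/
theorem act_foldVar_plug {Ps : List (ℕ × List Ty)} {G : Ty} {fs : List Tm} (A : Ty) (m J : ℕ)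
    (b : Tm) :
    (act A m (alpha Ps) G (foldVar Ps G fs)).plug J b =
      (fmap (A.subst (Ty.up^[m + 1] fun n => .var (n + m))) m
        (Ty.sconsL (tvars m) (Ty.scons ((Yoneda.alpha Ps).shift m) Ty.var))
        (Ty.sconsL (tvars m) (Ty.scons (G.shift m) Ty.var))
        (Yoneda.foldVar (Ps.map (subL fun n => .var (n + m))) (G.shift m)
          ((fs.map fun f => f.tshift m).map fun f => f.shift J))).plug 0 b := by
  rw [fmap_shift_sconsL, act, fmap_plug, Tm.tshift, foldVar_tsubst, foldVar_subst_up,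
    ← shift_eq_subst]
  simp only [Tm.shift, Tm.rename_eq_subst]
  rfl

/-- The premise of the ε-rule. The constructor builds an injected package, the fold computes on it,
and uncurrying `fₖ` is undone by projecting the components, each of which has been mapped by the
action of the fold. -/
theorem ElimData.comm {Ps : List (ℕ × List Ty)} {Γ : List Ty} {G : Ty} {fs : List Tm}
    (h : ElimData Ps Γ G fs) {k : ℕ} (h₁ : k < fs.length) (h₂ : k < Ps.length) :
    EpsEq ((Ps[k].2.map fun A => A.subst (single Ps[k].1 (Yoneda.alpha Ps))).reverse ++
        shiftC Ps[k].1 Γ)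
      (((Yoneda.foldVar Ps G fs).tshift Ps[k].1).plug Ps[k].2.length
        (apps (tappVars (((aHat Ps ⟨k, h₂⟩).tshift Ps[k].1).shift Ps[k].2.length) Ps[k].1)
          (vars Ps[k].2.length)))
      (apps (tappVars ((fs[k].tshift Ps[k].1).shift Ps[k].2.length) Ps[k].1)
        (List.zipWith (fun A z => (act A Ps[k].1 (Yoneda.alpha Ps) G (Yoneda.foldVar Ps G fs)).plug
          Ps[k].2.length z) Ps[k].2 (vars Ps[k].2.length)))
      (G.shift Ps[k].1) := by
  have hα := h.alpha
  have hG := h.adm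
  have hAs := (h.prem _ (List.getElem_mem h₂)).of_premL
  have hpos := h.pos _ (List.getElem_mem h₂)
  have hA : ∀ B ∈ Ps[k].2.map fun A => A.subst (single Ps[k].1 (Yoneda.alpha Ps)), B.Adm := by
    intro B hB
    obtain ⟨A, hA', rfl⟩ := List.mem_map.1 hB
    exact (hAs A hA').subst (adm_single hα _)
  have hlen : (Ps[k].2.map fun A => A.subst (single Ps[k].1 (Yoneda.alpha Ps))).reverse.length =
    Ps[k].2.length := by simp
  have hz := forall₂_vars (Ps[k].2.map fun A => A.subst (single Ps[k].1 (Yoneda.alpha Ps)))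
    (shiftC Ps[k].1 Γ) hA
  rw [List.length_map] at hz
  -- The computation takes place under `Y⃗ₖ` and the variables `zⱼ`, so the whole datum is weakened
  -- past both.
  have D' := (h.tshift Ps[k].1).shift (fun B hB => hA B (List.mem_reverse.1 hB)) hlen
  have h1 := aHat_app hα h.prem h₂ (J := Ps[k].2.length) hz
  rw [aBody_subst _ _ _ _ (length_vars _)] at h1
  have h2 := (EpsEq.refl (h.foldVar.tshift Ps[k].1)).plug (h.ctx.shiftC _) hlen h1
  refine h2.trans ?_
  have hu := HasType.tuple hz
  rw [← subL_sconsL, shift_eq_subst, alpha_subst] at hu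
  obtain ⟨W, hW, h3, h4⟩ := D'.foldTm_inTm (k := k) (by simpa using h₁) (by simpa using h₂)
    (u := tuple (vars Ps[k].2.length)) (by simp only [List.getElem_map]; exact hu)
  simp only [List.getElem_map] at hW h3 h4
  have hW' : HasType ((Ps[k].2.map fun A => A.subst (single Ps[k].1 (Yoneda.alpha Ps))).reverse ++
      shiftC Ps[k].1 Γ) W (prodN (Ps[k].2.map fun A => A.subst (single Ps[k].1 G))) := by
    rw [← subL_sconsL]; exact hW
  have eP : (prodN (Ps[k].2.map fun A => A.subst (single Ps[k].1 (Yoneda.alpha Ps)))).rename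
      (upr^[Ps[k].1] fun n => n + Ps[k].1) =
      prodN ((subL (fun n => .var (n + Ps[k].1)) Ps[k]).2.map fun A => A.subst (single Ps[k].1
        (Yoneda.alpha (Ps.map (subL fun n => .var (n + Ps[k].1)))))) := by
    rw [Ty.rename_eq_subst, ← Ty.iter_up_ren, prodN_subst, subL_single, alpha_subst]
  have eU : uncurryTm Ps[k].1 ((subL (fun n => .var (n + Ps[k].1)) Ps[k]).2.map fun A =>
        A.subst (single Ps[k].1 (G.shift Ps[k].1))) ((fs[k].tshift Ps[k].1).shift Ps[k].2.length) =
      ((uncurryTm Ps[k].1 (Ps[k].2.map fun A => A.subst (single Ps[k].1 G)) fs[k]).tshift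
        Ps[k].1).shift Ps[k].2.length := by
    simp only [Tm.tshift, uncurryTm_tsubst, Tm.shift, Tm.rename_eq_subst, uncurryTm_subst,
      subL_single, shift_eq_subst]
  have h5 := uncurryTm_app h.ctx (h.adm_exPrem h₂) (h.type' h₁ h₂) hlen hW'
  rw [Tm.tshift, foldVar_tsubst, foldVar_plug, ← shift_eq_subst, eP]
  refine h3.trans ((EpsEq.congr_right (.refl h3.hasType.2) ?_).trans (h5.trans ?_))
  · rw [← eU]; rfl
  refine EpsEq.apps (.refl (HasType.tapps_tvars (h.type' h₁ h₂) _ hlen)) (by simp)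
    (by simp [length_vars]) fun j j₁ j₂ j₃ => ?_
  have hj : j < Ps[k].2.length := by simpa using j₁
  simp only [List.getElem_map, List.getElem_range, List.getElem_zipWith, List.length_map]
  have hv := (HasType.act (m := Ps[k].1) (hAs _ (List.getElem_mem hj))
    (hpos _ (List.getElem_mem hj)) hα hG h.foldVar)
  have hzj := (List.forall₂_iff_get.1 hz).2 j (by simpa [length_vars]) (by simpa using hj)
  -- Here the package contains the literal tuple of the `zⱼ`, so projecting from it returns `zⱼ`.
  have hpt := proj_tuple hz (j := j) (by simpa using hj) (by simpa [length_vars])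
  simp only [List.get_eq_getElem, List.getElem_map, List.length_map] at hzj hpt
  have h6 := (EpsEq.refl hv).plug (h.ctx.shiftC _) hlen hpt
  rw [act_foldVar_plug, act_foldVar_plug] at h6
  rw [act_foldVar_plug]
  refine EpsEq.trans ?_ h6
  have h7 := h4 j (by simpa [subL] using hj)
  simp only [subL, List.getElem_map, List.length_map] at h7
  rw [Ty.subst_subst, show (fun n => (Ty.up^[Ps[k].1 + 1] (fun n => .var (n + Ps[k].1)) n).subst
    (Ty.sconsL (tvars Ps[k].1) (Ty.scons (G.shift Ps[k].1) Ty.var))) = single Ps[k].1 G from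
    funext (iter_up_shift_sconsL _ _), ← alpha_subst, ← shift_eq_subst] at h7
  exact h7

/-! ### From the ε-rules to the isomorphisms. -/

theorem act_rename_up (B E : Ty) (v : Tm) :
    act (B.rename (upr Nat.succ)) 0 (E.shift 1) (.var 0) v =
      fmap B 0 (Ty.scons (E.shift 1) fun n => .var (n + 1)) Ty.var v := by
  rw [act, Tm.tshift_zero]
  refine fmap_rename (fun n _ => ?_) (fun n _ => ?_) (fun n _ => ?_) fun _ => rfl <;>
    cases n <;> simp [upr, single, Ty.scons]

/-- The terms `x α ⟨eₖ⟩ₖ` and `ΛX. λ⟨fₖ⟩ₖ. Φ_B(v)` form an isomorphism if `v[α, ⟨eₖ⟩ₖ] ≃ x` and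
`Φ_B(v)[x α ⟨eₖ⟩ₖ] ≃ x X ⟨fₖ⟩ₖ`. -/
theorem isEpsIso_of {prems : List Ty} {B α : Ty} {es : List Tm} {v : Tm} {b : Bool}
    (hU : (Ty.all (arrows prems B)).Adm) (hs : OnlySign b 0 B) (hα : α.Adm)
    (he : List.Forall₂ (HasType []) es (prems.map fun P => P.inst α))
    (hv : HasType ((bif b then α.shift 1 else .var 0) :: prems.reverse) v
      (bif b then .var 0 else α.shift 1))
    (hid : ∀ k, EpsEq [α.shift k]
      (((v.tsubst (single 0 α)).subst (Tm.up (Tm.sconsL es .var))).tshift k) (.var 0) (α.shift k))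
    (hcore : EpsEq (prems.reverse ++ [(Ty.all (arrows prems B)).shift 1])
      ((fmap B 0 (Ty.scons (α.shift 1) fun n => .var (n + 1)) Ty.var v).plug 0
        (apps (.tapp (.var prems.length) (α.shift 1)) (es.map fun e => e.tshift 1)))
      (apps (.tapp (.var prems.length) (.var 0)) (vars prems.length)) B) :
    IsEpsIso (.all (arrows prems B)) (B.inst α) (apps (.tapp (.var 0) α) es)
      (.tlam (lams prems ((fmap B 0 (Ty.scons (α.shift 1) fun n => .var (n + 1)) Ty.var v).plug 0
        (.var prems.length)))) := by
  have hP : ∀ P ∈ prems, P.Adm := (adm_arrows.1 hU.1).1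
  have hB : B.Adm := (adm_arrows.1 hU.1).2
  have hσ : ∀ n, (Ty.scons (α.shift 1) (fun n => .var (n + 1)) n).Adm :=
    adm_scons (hα.shift 1) fun _ => trivial
  have eσ : B.subst (Ty.scons (α.shift 1) fun n => .var (n + 1)) = (B.inst α).shift 1 := by
    rw [shift_eq_subst (B.inst α), Ty.inst, Ty.subst_subst]
    congr 1; funext n; cases n
    · simp [single, Ty.scons, shift_eq_subst]
    · rfl
  have hbody : HasType (prems.reverse ++ shiftC 1 [B.inst α])
      ((fmap B 0 (Ty.scons (α.shift 1) fun n => .var (n + 1)) Ty.var v).plug 0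
        (.var prems.length)) B := by
    have h1 := HasType.fmap (Γ := prems.reverse ++ shiftC 1 [B.inst α]) (t := v) hB hs hσ
      (τ := Ty.var) (fun _ => trivial) (fun n hn => by cases n <;> [exact absurd rfl hn; rfl]) (by
        have := hv.append (shiftC 1 [B.inst α])
        cases b <;> exact this)
    rw [Ty.subst_var, eσ] at h1
    refine h1.plug_zero (.var ?_ ((hB.inst hα).shift 1))
    rw [List.getElem?_append_right (by simp)]
    simp [shiftC]
  have hs1 : ∀ {Γ t}, HasType Γ t (.all (arrows prems B)) →
      HasType Γ (apps (.tapp t α) es) (B.inst α) := by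
    intro Γ t ht
    have h1 := HasType.tapp ht hα
    rw [Ty.inst, arrows_subst] at h1
    exact h1.apps (he.imp fun _ _ h => h.of_closed Γ)
  have ht1 : HasType [B.inst α] (.tlam (lams prems ((fmap B 0 (Ty.scons (α.shift 1) fun n =>
      .var (n + 1)) Ty.var v).plug 0 (.var prems.length)))) (.all (arrows prems B)) :=
    .tlam hU (.lams hP hbody)
  have hes : ∀ s : ℕ → Tm, es.map (fun e => e.subst s) = es := fun s => by
    have : ∀ {L : List Ty} {es}, List.Forall₂ (HasType []) es L →
        es.map (fun e => e.subst s) = es := by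
      intro L es h
      induction h with
      | nil => rfl
      | cons h _ ih => rw [List.map_cons, ih, h.subst_closed]
    exact this he
  have hlen : es.length = prems.length := by simpa using he.length_eq
  refine ⟨hs1 (.var_zero hU), ht1, ?_, ?_⟩
  -- β-reduction at `α` and at the given arguments leaves the action of `B` on the instance of `v`,
  -- which is the identity by assumption.
  · have h1 := EpsEq.tbeta ht1 hα
    rw [Tm.tinst, lams_tsubst, show (arrows prems B).inst α = _ from arrows_subst _ _ _] at h1
    have h2 := hbody.tsubst (adm_single hα 0)
    have eΓ : (prems.reverse ++ shiftC 1 [B.inst α]).map (fun A => A.subst (single 0 α)) =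
        (prems.map fun A => A.subst (single 0 α)).reverse ++ [B.inst α] := by
      simp only [List.map_append, List.map_reverse, shiftC, List.map_cons, List.map_nil]
      congr 2; exact shift_inst _ _
    rw [eΓ] at h2
    have he' := he.imp fun _ _ h => h.of_closed [B.inst α]
    have h3 := (h1.apps_left he').trans (apps_lams h2 he')
    rw [Tm.plug, apps_subst, hes]
    refine h3.trans ?_
    -- Instantiating `X` with `α` makes the source and target substitutions of the action coincide,
    -- as the identity law requires.
    have e1 : (fun n => (Ty.scons (α.shift 1) (fun n => Ty.var (n + 1)) n).subst (single 0 α)) =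
        single 0 α := by
      funext n; cases n
      · exact shift_inst _ _
      · rfl
    have e2 : Tm.sconsL es Tm.var prems.length = .var 0 := by
      simpa [hlen] using Tm.sconsL_add es Tm.var 0
    rw [plug_tsubst, fmap_tsubst, plug_zero_subst, fmap_subst, e1]
    simp only [Ty.subst, Tm.tsubst, Tm.subst, e2]
    have hΓ : CtxAdm [B.inst α] := by simpa [CtxAdm] using hB.inst hα
    refine (fmap_id hΓ hB hs (adm_single hα 0) fun k => ?_).plug_zero hΓ
      (.refl (.var_zero (hB.inst hα)))
    exact (hid k).append _
  -- Here `x` is η-expanded to `ΛX. λ⟨fₖ⟩ₖ. x X ⟨fₖ⟩ₖ`, and `hcore` compares the bodies.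
  · have hx : HasType [Ty.all (arrows prems B)] (.var 0) (.all (arrows prems B)) := .var_zero hU
    refine EpsEq.trans ?_ (EpsEq.teta hx).symm
    rw [Tm.plug, Tm.subst, lams_subst, plug_zero_subst]
    refine EpsEq.tlam hU ?_
    have h1 := HasType.tapp (hx.tshift 1) (B := .var 0) trivial
    have e1 : (((arrows prems B).subst (Ty.up fun n => .var (n + 1))).inst (.var 0)) =
        arrows prems B := by
      rw [subst_up_inst, show Ty.scons (.var 0) (fun n => .var (n + 1)) = Ty.var by
        funext n; cases n <;> rfl, Ty.subst_var]
    change HasType _ _ (((arrows prems B).rename (upr fun n => n + 1)).inst (.var 0)) at h1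
    rw [Ty.rename_eq_subst, ← Ty.up_ren, e1] at h1
    refine EpsEq.trans ?_ (lams_eta h1).symm
    refine EpsEq.lams hP ?_
    have hes1 : es.map ((fun e => e.shift prems.length) ∘ fun e => e.tshift 1) =
        es.map fun e => e.tshift 1 := by
      have := congrArg (List.map fun e => e.tshift 1) (hes fun n => .var (n + prems.length))
      rw [List.map_map] at this
      refine Eq.trans (List.map_congr_left fun e _ => ?_) this
      simp only [Function.comp_apply, subst_tshift, Tm.shift, Tm.rename_eq_subst]; rfl
    have e2 := Tm.iter_up_add (fun n => tshift 1 ((apps (.tapp (.var 0) α) es).scons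
      (fun n => .var (n + 1)) n)) prems.length 0
    rw [Nat.zero_add] at e2
    have e3 : (apps (.tapp (.var 0) α) es).tshift 1 =
        apps (.tapp (.var 0) (α.shift 1)) (es.map fun e => e.tshift 1) := by
      rw [Tm.tshift, apps_tsubst, shift_eq_subst]; rfl
    have e4 : ∀ (t : Tm) (us : List Tm), (apps t us).shift prems.length =
        apps (t.shift prems.length) (us.map fun u => u.shift prems.length) := fun t us => by
      simp only [Tm.shift, Tm.rename_eq_subst, apps_subst]
    rw [fmap_subst, hv.subst_eq_self, Tm.subst, e2]
    · simp only [Tm.scons, e3, e4, List.map_map, hes1]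
      simp only [Tm.shift, Tm.rename, Tm.tshift, Tm.tsubst, Nat.zero_add]
      exact hcore
    · rintro (_ | n) hn
      · rfl
      · simp only [Tm.up, Tm.scons]
        rw [Tm.iter_up_lt _ (by simpa using hn)]; rfl

/-- The ε-rule taken along the fold from `α` with its constructors to `G` with the given algebra. -/
theorem ElimData.act_apps {Ps : List (ℕ × List Ty)} {Γ : List Ty} {G : Ty} {fs : List Tm}
    (h : ElimData Ps Γ G fs) {B : Ty} (hB : Pos 0 B) {x : Tm} (hx : HasType Γ x (univL Ps B)) :
    EpsEq Γ ((act B 0 (Yoneda.alpha Ps) G (Yoneda.foldVar Ps G fs)).plug 0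
        (apps (.tapp x (Yoneda.alpha Ps)) (List.ofFn (aHat Ps))))
      (apps (.tapp x G) fs) (B.inst G) := by
  have hl : ∀ k : Fin Ps.length, k.1 < fs.length := fun k => by rw [h.length]; exact k.2
  have h1 := EpsEq.epsL Ps B (Yoneda.alpha Ps) G x (Yoneda.foldVar Ps G fs) (aHat Ps)
    (fun k => fs[k.1]'(hl k)) ⟨h.pos, hB⟩ h.alpha h.adm hx h.foldVar
    (fun k => (HasType.aHat h.alpha h.prem k).of_closed Γ) (fun k => h.type k.1 (hl k) k.2)
    fun k => h.comm (hl k) k.2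
  rwa [show List.ofFn (fun k : Fin Ps.length => fs[k.1]'(hl k)) = fs from
    List.ext_getElem (by simp [h.length]) fun k h₁ h₂ => by simp] at h1

theorem inst_var_zero (A : Ty) : (A.subst (Ty.up fun n => .var (n + 1))).inst (.var 0) = A := by
  rw [subst_up_inst, show Ty.scons (.var 0) (fun n => .var (n + 1)) = Ty.var by
    funext n; cases n <;> rfl, Ty.subst_var]

theorem HasType.getElem_vars {Γ As : List Ty} (hA : ∀ A ∈ As, A.Adm) {k : ℕ}
    (h : k < (vars As.length).length) (h' : k < As.length) :
    HasType (As.reverse ++ Γ) (vars As.length)[k] As[k] :=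
  (List.forall₂_iff_get.1 (forall₂_vars As Γ hA)).2 k h h'

/-- In the body of `t` the abstracted `fₖ` themselves form the algebra, with carrier the bound
variable `X`; the premises therefore have to be weakened past `X`. -/
theorem elimData_vars {Ps : List (ℕ × List Ty)} (hα : (alpha Ps).Adm)
    (hPs : ∀ p ∈ Ps, (premL p).Adm) (hpos : ∀ p ∈ Ps, ∀ A ∈ p.2, Pos p.1 A) {Γ : List Ty}
    (hΓ : CtxAdm Γ) :
    ElimData (Ps.map (subL fun n => .var (n + 1))) ((Ps.map premL).reverse ++ Γ) (.var 0)
      (vars Ps.length) := by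
  have hP : ∀ P ∈ Ps.map premL, P.Adm := fun P hP => by
    obtain ⟨p, hp, rfl⟩ := List.mem_map.1 hP; exact hPs p hp
  refine ⟨fun P h => ?_, trivial, ?_, fun p hp => ?_, fun p hp A hA => ?_, by simp [length_vars],
    fun k h₁ h₂ => ?_⟩
  · rcases List.mem_append.1 h with h | h
    · exact hP P (List.mem_reverse.1 h)
    · exact hΓ P h
  · rw [← alpha_subst]; exact hα.subst fun _ => trivial
  · obtain ⟨q, hq, rfl⟩ := List.mem_map.1 hp
    rw [← premL_subst_up]; exact (hPs q hq).subst (adm_up fun _ => trivial)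
  · obtain ⟨q, hq, rfl⟩ := List.mem_map.1 hp
    obtain ⟨C, hC, rfl⟩ := List.mem_map.1 hA
    exact OnlySign.subst_iter_up (hpos q hq C hC) _
  · have := HasType.getElem_vars (Γ := Γ) hP (k := k) (by simpa [length_vars] using h₁)
      (by simpa using h₂)
    simp only [List.length_map, List.getElem_map] at this ⊢
    rw [← premL_subst_up, inst_var_zero]
    exact this

theorem tTerm_eq (Ps : List (ℕ × List Ty)) (B : Ty) :
    tTerm Ps B = .tlam (lams (Ps.map premL)
      ((fmap B 0 (Ty.scons ((alpha Ps).shift 1) fun n => .var (n + 1)) Ty.var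
        (foldVar (Ps.map (subL fun n => .var (n + 1))) (.var 0) (vars Ps.length))).plug 0
          (.var (Ps.map premL).length))) := by
  rw [foldVar_eq, ← bTerm_eq, foldTm, occL_subL, ← tyT_subst, Ty.up_ren, ← Ty.rename_eq_subst,
    List.length_map]
  rfl

/-- `≡_{X+}` -/
theorem isEpsIso_univL {Ps : List (ℕ × List Ty)} {B : Ty} (hs : SignL Ps B)
    (hU : (univL Ps B).Adm) (hα : (alpha Ps).Adm) :
    IsEpsIso (univL Ps B) (B.inst (alpha Ps)) (sTerm Ps) (tTerm Ps B) := by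
  have hPs := hU.of_univL.1
  have eα : (alpha Ps).shift 1 = alpha (Ps.map (subL fun n => .var (n + 1))) := by
    rw [shift_eq_subst, alpha_subst]
  rw [tTerm_eq]
  refine isEpsIso_of (b := true) hU hs.2 hα ?_ ?_ (fun k => ?_) ?_
  · refine List.forall₂_iff_get.2 ⟨by simp, fun k h₁ h₂ => ?_⟩
    simp only [List.get_eq_getElem, List.getElem_ofFn, List.getElem_map]
    exact HasType.aHat hα hPs ⟨k, by simpa using h₂⟩
  · have := (elimData_vars hα hPs hs.1 (Γ := []) (by simp [CtxAdm])).foldVar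
    rw [List.append_nil] at this
    simp only [cond_true, eα]; exact this
  · have e1 : (vars Ps.length).map (fun f => (f.tsubst (single 0 (alpha Ps))).subst
        (Tm.sconsL (List.ofFn (aHat Ps)) .var)) = List.ofFn (aHat Ps) := by
      have := map_subst_sconsL (List.ofFn (aHat Ps))
      rw [List.length_ofFn] at this
      refine Eq.trans (List.map_congr_left fun f hf => ?_) this
      simp only [vars, List.mem_map] at hf
      obtain ⟨n, _, rfl⟩ := hf; rfl
    -- Weakening past `X` and substituting `α` for `X` cancel, so the instance is the fold over the
    -- original premises.
    have e2 : (Ps.map (subL fun n => .var (n + 1))).map (subL (single 0 (alpha Ps))) = Ps := by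
      rw [subL_subL]; exact Eq.trans (List.map_congr_left fun p _ => by
        simp only [subL, Ty.subst, single, Function.iterate_zero, id, Ty.scons, Ty.iter_up_var,
          Ty.subst_var, List.map_id']) (List.map_id _)
    have eG : (Ty.var 0).subst (single 0 (alpha Ps)) = alpha Ps := rfl
    rw [foldVar_tsubst, foldVar_subst_up, e2, List.map_map, Function.comp_def, e1, eG, Tm.tshift,
      foldVar_tsubst, aHat_tsubst, shift_eq_subst, alpha_subst]
    have D := (elimData_aHat hα hPs hs.1 (Γ := []) (by simp [CtxAdm])).tshift k
    rw [shift_eq_subst, alpha_subst] at D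
    exact foldVar_aHat D.alpha D.prem D.pos (by simp [CtxAdm])
  · have hΓ : CtxAdm [(univL Ps B).shift 1] := by simpa [CtxAdm] using hU.shift 1
    have D := elimData_vars hα hPs hs.1 hΓ
    have hx : HasType ((Ps.map premL).reverse ++ [(univL Ps B).shift 1]) (.var Ps.length)
        (univL (Ps.map (subL fun n => .var (n + 1))) (B.rename (upr Nat.succ))) := by
      have e : (univL Ps B).shift 1 = univL (Ps.map (subL fun n => .var (n + 1)))
          (B.rename (upr Nat.succ)) := by
        rw [shift_eq_subst, univL_subst, Ty.up_ren, ← Ty.rename_eq_subst]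
      rw [← e]
      refine .var ?_ (hU.shift 1)
      rw [List.getElem?_append_right (by simp)]; simp
    have hB : Pos 0 (B.rename (upr Nat.succ)) := by
      rw [Ty.rename_eq_subst, ← Ty.up_ren]; exact (hs.subst _).2
    have h1 := D.act_apps hB hx
    rw [← eα, act_rename_up, Ty.rename_eq_subst, ← Ty.up_ren, inst_var_zero, ← aHat_tsubst] at h1
    rw [List.length_map]
    exact h1

/-! ### The type `β` -/

/-- `νX. U`, or `U` without the variable `X` if `X` does not occur in it. -/
def nuTy (U : Ty) : Ty := if occ 0 U then .nu U else U.inst .one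

/-- `out_U x`, or `x` if `X` does not occur in `U`. -/
def outTm (U : Ty) (x : Tm) : Tm := if occ 0 U then .outn U x else x

/-- `unfold_U d`, or `d` if `X` does not occur in `U`. -/
def unfoldTm (U : Ty) (d : Tm) : Tm := if occ 0 U then .unfoldn U d else d

theorem occ_subst_up (U : Ty) (θ : ℕ → Ty) : occ 0 (U.subst (Ty.up θ)) = occ 0 U :=
  occ_subst_iter_up U 0 θ

theorem nuTy_subst (U : Ty) (θ : ℕ → Ty) : (nuTy U).subst θ = nuTy (U.subst (Ty.up θ)) := by
  simp only [nuTy, occ_subst_up]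
  split
  · rfl
  · rw [inst_subst]; rfl

theorem nuTy_of_not_occ {U : Ty} (h : occ 0 U = false) (G : Ty) : nuTy U = U.inst G := by
  rw [nuTy, if_neg (by simp [h])]
  exact inst_eq_of_occ_false h _ _

theorem adm_of_nuTy {U : Ty} (h : (nuTy U).Adm) : U.Adm ∧ Pos 0 U := by
  cases ho : occ 0 U with
  | true => simp only [nuTy, ho, if_true] at h; exact h
  | false =>
    refine ⟨?_, OnlySign.of_occ_false ho⟩
    rw [nuTy_of_not_occ ho .one] at h
    -- As `X` does not occur, `U` is the weakening of `U[1/X]` and inherits its admissibility.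
    have h1 := h.shift 1
    rw [shift_eq_subst, Ty.inst, Ty.subst_subst, subst_congr_of_occ_false ho (τ := Ty.var),
      Ty.subst_var] at h1
    · exact h1
    · rintro (_ | n) hn
      · exact absurd rfl hn
      · rfl

theorem outTm_subst (U : Ty) (x : Tm) (s : ℕ → Tm) :
    (outTm U x).subst s = outTm U (x.subst s) := by
  simp only [outTm]; split <;> rfl

theorem outTm_tsubst (U : Ty) (x : Tm) (θ : ℕ → Ty) :
    (outTm U x).tsubst θ = outTm (U.subst (Ty.up θ)) (x.tsubst θ) := by
  simp only [outTm, occ_subst_up]; split <;> rfl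

theorem unfoldTm_subst (U : Ty) (d : Tm) (s : ℕ → Tm) :
    (unfoldTm U d).subst s = unfoldTm U (d.subst s) := by
  simp only [unfoldTm]; split <;> rfl

theorem unfoldTm_shift (U : Ty) (d : Tm) (k : ℕ) :
    (unfoldTm U d).shift k = unfoldTm U (d.shift k) := by
  simp only [Tm.shift, Tm.rename_eq_subst, unfoldTm_subst]

theorem unfoldTm_tsubst (U : Ty) (d : Tm) (θ : ℕ → Ty) :
    (unfoldTm U d).tsubst θ = unfoldTm (U.subst (Ty.up θ)) (d.tsubst θ) := by
  simp only [unfoldTm, occ_subst_up]; split <;> rfl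

theorem EpsEq.outTm {Γ : List Ty} {U : Ty} {x y : Tm} (h : EpsEq Γ x y (nuTy U)) :
    EpsEq Γ (outTm U x) (outTm U y) (U.inst (nuTy U)) := by
  cases ho : occ 0 U with
  | true =>
    simp only [nuTy, ho, if_true] at h
    simp only [Yoneda.outTm, nuTy, ho, if_true]
    exact .outn h
  | false =>
    simp only [Yoneda.outTm, ho, Bool.false_eq_true, if_false]
    rwa [← nuTy_of_not_occ ho]

theorem HasType.unfoldTm {Γ : List Ty} {U G : Ty} {d : Tm} (hU : (nuTy U).Adm)
    (h : HasType Γ d (.arr G (U.inst G))) : HasType Γ (unfoldTm U d) (.arr G (nuTy U)) := by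
  cases ho : occ 0 U with
  | true =>
    simp only [nuTy, ho, if_true] at hU
    simp only [Yoneda.unfoldTm, nuTy, ho, if_true]
    exact .unfoldn hU h
  | false =>
    simp only [Yoneda.unfoldTm, ho, Bool.false_eq_true, if_false]
    rwa [nuTy_of_not_occ ho G]

/-- `unfold_U(d) x`, in context `Γ, x`. -/
def unfoldVar (U : Ty) (d : Tm) : Tm := .app ((unfoldTm U d).shift 1) (.var 0)

theorem HasType.unfoldVar {Γ : List Ty} {U G : Ty} {d : Tm} (hU : (nuTy U).Adm) (hG : G.Adm)
    (h : HasType Γ d (.arr G (U.inst G))) : HasType (G :: Γ) (unfoldVar U d) (nuTy U) :=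
  .app ((HasType.unfoldTm hU h).shift_one _) (.var_zero hG)

/-- Computation rule of `unfold_U(d)`. -/
theorem outTm_unfoldTm {Γ : List Ty} {U G : Ty} {d x : Tm} (hΓ : CtxAdm Γ) (hU : (nuTy U).Adm)
    (hG : G.Adm) (hd : HasType Γ d (.arr G (U.inst G))) (hx : HasType Γ x G) :
    EpsEq Γ (outTm U (.app (unfoldTm U d) x))
      ((fmap U 0 (single 0 G) (single 0 (nuTy U)) (unfoldVar U d)).plug 0 (.app d x))
      (U.inst (nuTy U)) := by
  cases ho : occ 0 U with
  | true =>
    have h1 := hU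
    simp only [nuTy, ho, if_true] at h1
    have h2 := EpsEq.nu_beta h1 hd hx
    rw [act, Tm.tshift_zero] at h2
    simp only [outTm, unfoldVar, unfoldTm, nuTy, ho, if_true]
    exact h2
  | false =>
    -- Without `νX` nothing is unfolded: the action of the constant functor is the identity and both
    -- sides reduce to `d x`.
    have h1 := fmap_of_occ_false (t := unfoldVar U d) hΓ (adm_of_nuTy hU).1 ho (adm_single hG 0)
      (τ := single 0 (nuTy U)) fun n hn => single_ne _ _ fun e => by
        subst e; rw [ho] at hn; cases hn
    have h2 := (h1.plug_zero hΓ (.refl (.app hd hx))).symm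
    simp only [outTm, unfoldTm, ho, Bool.false_eq_true, if_false]
    rw [inst_eq_of_occ_false ho (nuTy U) G]
    exact h2

/-- Uniqueness rule of `unfold_U(d)`. -/
theorem unfoldVar_eq_self {Γ : List Ty} {U : Ty} {d : Tm} (hΓ : CtxAdm Γ) (hU : (nuTy U).Adm)
    (hd : HasType Γ d (.arr (nuTy U) (U.inst (nuTy U))))
    (h : EpsEq (nuTy U :: Γ) (.app (d.shift 1) (.var 0)) (outTm U (.var 0))
      (U.inst (nuTy U))) :
    EpsEq (nuTy U :: Γ) (unfoldVar U d) (.var 0) (nuTy U) := by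
  cases ho : occ 0 U with
  | true =>
    have h1 := fmap_var_zero hΓ (adm_of_nuTy hU).1 (adm_of_nuTy hU).2 (adm_single hU 0)
    have h2 := h1.plug_one hΓ (EpsEq.refl h.hasType.1)
    have h3 := h2.trans h
    simp only [unfoldVar, unfoldTm, nuTy, outTm, ho, if_true] at h3 hd hU ⊢
    -- Uniqueness of the unfolding for the identity map; the action of `U` on the identity has been
    -- removed in `h1`.
    refine (EpsEq.nu_eta hd (.var_zero hU) ?_).symm
    rw [act, Tm.tshift_zero]
    exact h3
  | false =>
    simp only [unfoldVar, unfoldTm, ho, Bool.false_eq_true, if_false]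
    simp only [outTm, ho, Bool.false_eq_true, if_false] at h
    rwa [← nuTy_of_not_occ ho] at h

/-! ### Weakening of `U` and instantiation of bound quantifiers. -/

theorem rename_upr_rename_upr (U : Ty) (ρ : ℕ → ℕ) (m : ℕ) :
    (U.rename (upr ρ)).rename (upr fun n => n + m) = U.rename (upr fun n => ρ n + m) := by
  rw [Ty.rename_rename]; congr 1; funext n; cases n <;> rfl

theorem nuTy_shift (U : Ty) (m : ℕ) :
    (nuTy U).shift m = nuTy (U.rename (upr fun n => n + m)) := by
  rw [shift_eq_subst, nuTy_subst, Ty.up_ren, ← Ty.rename_eq_subst]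

theorem rename_upr_inst (U : Ty) (ρ : ℕ → ℕ) (G : Ty) :
    (U.rename (upr ρ)).inst G = U.subst (Ty.scons G fun n => .var (ρ n)) := by
  rw [Ty.rename_eq_subst, ← Ty.up_ren, subst_up_inst]

theorem sconsL_tvars_comp_shift (m : ℕ) (τ : ℕ → Ty) :
    Ty.sconsL (tvars m) (fun n => (τ n).shift m) = Ty.up^[m] τ := by
  have e := Ty.iter_up_sconsL (tvars m) τ fun n => .var (n + m)
  simp only [length_tvars, sconsL_tvars_shift, Ty.subst_var, ← shift_eq_subst] at e
  exact e.symm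

theorem sconsL_tvars_scons (m : ℕ) (G : Ty) (ρ : ℕ → ℕ) :
    Ty.sconsL (tvars m) (Ty.scons (G.shift m) fun n => .var (ρ n + m)) =
      Ty.up^[m] (Ty.scons G fun n => .var (ρ n)) := by
  rw [← sconsL_tvars_comp_shift]; congr 1; funext n; cases n <;> rfl

/-! ### The isomorphism `≡_{X-}` -/

/-- A type `U` with selectors `U⟨X⟩ → Aⱼ`, natural in `X` and jointly monic, and terms
`mk X ⟨fⱼ⟩ⱼ : X ⇒ U⟨X⟩` whose components are the `fⱼ : ∀Y⃗ⱼ. X ⇒ Aⱼ`. -/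
structure Selectors (Qs : List (ℕ × Ty)) (U : Ty) (sel : ℕ → Tm → Tm)
    (mk : Ty → List Tm → Tm) : Prop where
  occ : Ty.occ 0 U = occR Qs
  sel_subst : ∀ j w s, (sel j w).subst s = sel j (w.subst s)
  sel_tsubst : ∀ j (h : j < Qs.length) w θ, (sel j w).tsubst (Ty.up^[Qs[j].1] θ) =
    sel j (w.tsubst (Ty.up^[Qs[j].1] θ))
  sel_congr : ∀ {Γ w w' σ j} (h : j < Qs.length), EpsEq Γ w w' (U.subst σ) →
    EpsEq Γ (sel j w) (sel j w') (Qs[j].2.subst (Ty.sconsL (tvars Qs[j].1) σ))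
  sel_fmap : ∀ {Γ σ τ t a j} (h : j < Qs.length),
    HasType Γ ((fmap U 0 σ τ t).plug 0 a) (U.subst τ) →
    EpsEq Γ (sel j ((fmap U 0 σ τ t).plug 0 a))
      ((fmap Qs[j].2 Qs[j].1 (Ty.sconsL (tvars Qs[j].1) σ) (Ty.sconsL (tvars Qs[j].1) τ) t).plug 0
        (sel j a)) (Qs[j].2.subst (Ty.sconsL (tvars Qs[j].1) τ))
  sel_ext : ∀ {Γ w w' σ}, CtxAdm Γ → (U.subst σ).Adm → HasType Γ w (U.subst σ) →
    HasType Γ w' (U.subst σ) →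
    (∀ j (h : j < Qs.length), EpsEq (shiftC Qs[j].1 Γ) (sel j (w.tshift Qs[j].1))
      (sel j (w'.tshift Qs[j].1)) (Qs[j].2.subst (Ty.up^[Qs[j].1] σ))) →
    EpsEq Γ w w' (U.subst σ)
  mk_subst : ∀ G fs s, (mk G fs).subst s = mk G (fs.map fun f => f.subst s)
  mk_tsubst : ∀ G fs θ, (mk G fs).tsubst θ = mk (G.subst θ) (fs.map fun f => f.tsubst θ)
  mk_type : ∀ {Γ fs} {σ : ℕ → Ty}, CtxAdm Γ → (σ 0).Adm → (U.subst σ).Adm →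
    List.Forall₂ (fun f q => HasType Γ f ((premR q).subst σ)) fs Qs →
    HasType Γ (mk (σ 0) fs) (.arr (σ 0) (U.subst σ))
  sel_mk : ∀ {Γ fs x} {σ : ℕ → Ty}, CtxAdm Γ → (σ 0).Adm → (U.subst σ).Adm →
    List.Forall₂ (fun f q => HasType Γ f ((premR q).subst σ)) fs Qs → HasType Γ x (σ 0) →
    ∀ j (h : j < Qs.length) (h' : j < fs.length),
      EpsEq Γ (sel j (.app (mk (σ 0) fs) x)) (.app (tappVars fs[j] Qs[j].1) x)
        (Qs[j].2.subst (Ty.sconsL (tvars Qs[j].1) σ))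

/-- `ĉⱼ = ΛY⃗ⱼ. λx. selⱼ (out_U x)`. -/
def cTm (U : Ty) (sel : ℕ → Tm → Tm) (m j : ℕ) : Tm :=
  tlamN m (.lam ((nuTy U).shift m) (sel j (outTm (U.rename (upr fun n => n + m)) (.var 0))))

namespace Selectors

variable {Qs : List (ℕ × Ty)} {U : Ty} {sel : ℕ → Tm → Tm} {mk : Ty → List Tm → Tm}

/-- Only `U` is renamed: the selectors are assumed uniformly in the substitution `σ`, so the
premises `Qs` can stay as they are. -/
theorem cTm_tshift (S : Selectors Qs U sel mk) (V : Ty) {j : ℕ} (hj : j < Qs.length) (k : ℕ) :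
    (cTm V sel Qs[j].1 j).tshift k = cTm (V.rename (upr fun n => n + k)) sel Qs[j].1 j := by
  simp only [cTm, Tm.tshift, tlamN_tsubst, Tm.tsubst, S.sel_tsubst j hj, outTm_tsubst]
  have e : ∀ m n, Ty.up^[m] (fun n => Ty.var (n + k)) (n + m) = .var (n + k + m) := fun m n => by
    rw [Ty.iter_up_add]; rfl
  congr 2
  · simp only [← nuTy_shift, shift_eq_subst, Ty.subst_subst, Ty.subst, e]
  · congr 2
    simp only [Ty.rename_eq_subst, ← Ty.up_ren, Ty.subst_subst, Ty.up_comp, Ty.subst, e]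

/-- Here and below `U` is renamed by an arbitrary `ρ` that keeps `X`; one statement thus covers the
original context, the context with the bound `X`, and further weakenings. -/
theorem outTm_var (S : Selectors Qs U sel mk) (ρ : ℕ → ℕ) (hU : (nuTy (U.rename (upr ρ))).Adm)
    {j : ℕ} (hj : j < Qs.length) (Γ : List Ty) (m : ℕ) :
    HasType ((nuTy (U.rename (upr ρ))).shift m :: Γ)
      (sel j (outTm ((U.rename (upr ρ)).rename (upr fun n => n + m)) (.var 0)))
      (Qs[j].2.subst (Ty.sconsL (tvars Qs[j].1)
        (Ty.scons ((nuTy (U.rename (upr ρ))).shift m) fun n => .var (ρ n + m)))) := by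
  have h1 : EpsEq ((nuTy (U.rename (upr ρ))).shift m :: Γ) (.var 0) (.var 0)
      ((nuTy (U.rename (upr ρ))).shift m) := .refl (.var_zero (hU.shift m))
  rw [nuTy_shift] at h1
  have h2 := h1.outTm
  rw [rename_upr_rename_upr, rename_upr_inst, ← rename_upr_rename_upr] at h2
  have h3 := (S.sel_congr hj h2).hasType.1
  rw [nuTy_shift]
  exact h3

end Selectors

theorem premR_shift (q : ℕ × Ty) (σ : ℕ → Ty) (m : ℕ) :
    ((premR q).subst σ).shift m = (premR q).subst fun n => (σ n).shift m := by
  simp only [shift_eq_subst, Ty.subst_subst]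

/-- A renaming under `m + 1` binders touches neither `X` nor `Y⃗`, so it can be moved into the two
substitutions without changing the term. -/
theorem fmap_shift_up (m : ℕ) (A E F : Ty) (ρ : ℕ → ℕ) (t : Tm) :
    fmap (A.rename (upr^[m + 1] ρ)) m (single m E) (single m F) t =
      fmap A m (Ty.up^[m] (Ty.scons E fun n => .var (ρ n)))
        (Ty.up^[m] (Ty.scons F fun n => .var (ρ n))) t := by
  have e : ∀ E n, single m E (upr^[m + 1] ρ n) = Ty.up^[m] (Ty.scons E fun n => .var (ρ n)) n := by
    intro E n
    rw [← iter_up_succ_single, Ty.iter_up_ren]; rfl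
  refine fmap_rename (fun n _ => ?_) (fun n _ => e E n) (fun n _ => e F n) fun _ => rfl
  rcases lt_or_ge n (m + 1) with h | h
  · rw [iter_upr_lt _ h]
  · obtain ⟨k, rfl⟩ := Nat.exists_eq_add_of_le' h
    rw [iter_upr_add]; omega

theorem unfoldVar_tshift (V : Ty) (d : Tm) (m : ℕ) : (unfoldVar V d).tshift m =
    unfoldVar (V.rename (upr fun n => n + m)) (d.tshift m) := by
  rw [Tm.tshift, unfoldVar, Tm.tsubst, shift_tsubst, unfoldTm_tsubst, Ty.up_ren,
    ← Ty.rename_eq_subst]; rfl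

theorem unfoldVar_subst_up (V : Ty) (d : Tm) (s : ℕ → Tm) :
    (unfoldVar V d).subst (Tm.up s) = unfoldVar V (d.subst s) := by
  simp only [unfoldVar, Tm.subst, unfoldTm_subst, Tm.shift, Tm.rename_eq_subst,
    Tm.subst_subst, Tm.up, Tm.scons]

theorem scons_shift (G : Ty) (ρ : ℕ → ℕ) (m : ℕ) :
    (fun n => (Ty.scons G (fun n => .var (ρ n)) n).shift m) =
      Ty.scons (G.shift m) fun n => .var (ρ n + m) := by
  funext n; cases n <;> rfl

namespace Selectors

variable {Qs : List (ℕ × Ty)} {U : Ty} {sel : ℕ → Tm → Tm} {mk : Ty → List Tm → Tm}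

theorem hasType_cTm (S : Selectors Qs U sel mk) {ρ : ℕ → ℕ}
    (hU : (nuTy (U.rename (upr ρ))).Adm) {j : ℕ} (hj : j < Qs.length) (hQ : (premR Qs[j]).Adm) :
    HasType [] (cTm (U.rename (upr ρ)) sel Qs[j].1 j)
      ((premR Qs[j]).subst (Ty.scons (nuTy (U.rename (upr ρ))) fun n => .var (ρ n))) := by
  have h1 := hQ.subst (adm_scons hU (σ := fun n => .var (ρ n)) fun _ => trivial)
  rw [premR_subst] at h1 ⊢
  have h2 := S.outTm_var ρ hU hj [] Qs[j].1
  rw [sconsL_tvars_scons] at h2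
  exact .tlamN h1 (.lam h1.of_allN.1 h2)

theorem cTm_app (S : Selectors Qs U sel mk) {ρ : ℕ → ℕ} (hU : (nuTy (U.rename (upr ρ))).Adm)
    {j : ℕ} (hj : j < Qs.length) (hQ : (premR Qs[j]).Adm) {Γ : List Ty} {J : ℕ} {a : Tm}
    (ha : HasType Γ a ((nuTy (U.rename (upr ρ))).shift Qs[j].1)) :
    EpsEq Γ (.app (tappVars (((cTm (U.rename (upr ρ)) sel Qs[j].1 j).tshift Qs[j].1).shift J)
        Qs[j].1) a)
      (sel j (outTm ((U.rename (upr ρ)).rename (upr fun n => n + Qs[j].1)) a))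
      (Qs[j].2.subst (Ty.up^[Qs[j].1] (Ty.scons (nuTy (U.rename (upr ρ))) fun n => .var (ρ n)))) := by
  have h1 := S.hasType_cTm hU hj hQ
  rw [(h1.tshift _).shift_closed]
  rw [premR_subst] at h1
  have h2 := (tappVars_tlamN h1).append Γ
  have h3 := S.outTm_var ρ hU hj Γ Qs[j].1
  rw [sconsL_tvars_scons] at h3
  have h4 := (h2.app (.refl ha)).trans (.beta h3 ha)
  rw [Tm.plug, S.sel_subst, outTm_subst] at h4
  exact h4

/-- `unfold_U(d) x ≃ x` for the destructors `ĉ`. -/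
theorem unfoldVar_cTm (S : Selectors Qs U sel mk) {ρ : ℕ → ℕ}
    (hU : (nuTy (U.rename (upr ρ))).Adm) (hQ : ∀ q ∈ Qs, (premR q).Adm) :
    EpsEq [nuTy (U.rename (upr ρ))] (unfoldVar (U.rename (upr ρ)) (mk (nuTy (U.rename (upr ρ)))
      (List.ofFn fun j : Fin Qs.length => cTm (U.rename (upr ρ)) sel Qs[j].1 j))) (.var 0)
      (nuTy (U.rename (upr ρ))) := by
  set β := nuTy (U.rename (upr ρ)) with hβ
  set σ : ℕ → Ty := Ty.scons β fun n => .var (ρ n) with hσ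
  set cs := List.ofFn fun j : Fin Qs.length => cTm (U.rename (upr ρ)) sel Qs[j].1 j with hcs
  have hσA : ∀ n, (σ n).Adm := adm_scons hU fun _ => trivial
  have hUσ : (U.subst σ).Adm := by
    rw [hσ, ← rename_upr_inst]; exact (adm_of_nuTy hU).1.inst hU
  have hc : List.Forall₂ (fun f q => HasType [] f ((premR q).subst σ)) cs Qs := by
    refine List.forall₂_iff_get.2 ⟨by simp [hcs], fun k h₁ h₂ => ?_⟩
    simp only [List.get_eq_getElem, hcs, List.getElem_ofFn]
    exact S.hasType_cTm hU h₂ (hQ _ (List.getElem_mem _))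
  have hd : HasType [] (mk β cs) (.arr β (U.subst σ)) :=
    S.mk_type (σ := σ) (by simp [CtxAdm]) hU hUσ hc
  have hΓ : CtxAdm [β] := by simpa [CtxAdm] using hU
  have hx : HasType [β] (.var 0) β := .var_zero hU
  refine unfoldVar_eq_self (by simp [CtxAdm]) hU (by rw [rename_upr_inst]; exact hd) ?_
  rw [hd.shift_closed, rename_upr_inst]
  have ho := ((EpsEq.refl hx).outTm).hasType.1
  rw [rename_upr_inst] at ho
  -- By joint monicity, `d x` and `out_U x` are compared under each selector; on both sides the
  -- component is that of `out_U x`, since `ĉⱼ` is defined by selecting from it.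
  refine S.sel_ext hΓ hUσ (.app (hd.of_closed _) hx) ho fun j hj => ?_
  have hj' : j < (cs.map fun f => f.tshift Qs[j].1).length := by simpa [hcs] using hj
  have hc' : List.Forall₂ (fun f q => HasType (shiftC Qs[j].1 [β]) f
      ((premR q).subst fun n => (σ n).shift Qs[j].1)) (cs.map fun f => f.tshift Qs[j].1) Qs := by
    refine List.forall₂_map_left_iff.2 (hc.imp fun f q hf => ?_)
    have := (hf.tshift Qs[j].1).of_closed (shiftC Qs[j].1 [β])
    rwa [premR_shift] at this
  have hm := S.sel_mk (Γ := shiftC Qs[j].1 [β]) (fs := cs.map fun f => f.tshift Qs[j].1)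
    (x := .var 0) (σ := fun n => (σ n).shift Qs[j].1) (hΓ.shiftC _) (hU.shift _)
    (by
      have := hUσ.shift Qs[j].1
      simp only [shift_eq_subst, Ty.subst_subst] at this ⊢
      exact this) hc' (hx.tshift _) j hj hj'
  rw [sconsL_tvars_comp_shift] at hm
  have e1 : Tm.tshift Qs[j].1 (.app (mk β cs) (.var 0)) =
      .app (mk ((σ 0).shift Qs[j].1) (cs.map fun f => f.tshift Qs[j].1)) (.var 0) := by
    simp only [Tm.tshift, Tm.tsubst, S.mk_tsubst]
    rw [← shift_eq_subst]; rfl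
  rw [e1]
  refine hm.trans ?_
  have h2 := S.cTm_app hU hj (hQ _ (List.getElem_mem _)) (J := 0) (hx.tshift Qs[j].1)
  simp only [hcs, List.getElem_map, List.getElem_ofFn]
  rw [Tm.shift_zero] at h2
  refine h2.congr_right ?_
  rw [Tm.tshift, Tm.tshift, outTm_tsubst, Ty.up_ren, ← Ty.rename_eq_subst]

/-- The premise of the `ε`-rule. -/
theorem act_unfoldVar (S : Selectors Qs U sel mk) {ρ : ℕ → ℕ}
    (hU : (nuTy (U.rename (upr ρ))).Adm) (hQ : ∀ q ∈ Qs, (premR q).Adm)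
    (hpos : ∀ q ∈ Qs, Pos q.1 q.2) {Γ : List Ty} {G : Ty} {fs : List Tm} (hΓ : CtxAdm Γ)
    (hG : G.Adm)
    (hf : List.Forall₂ (fun f q => HasType Γ f
      ((premR q).subst (Ty.scons G fun n => .var (ρ n)))) fs Qs)
    {j : ℕ} (hj : j < Qs.length) (hj' : j < fs.length) :
    EpsEq (G.shift Qs[j].1 :: shiftC Qs[j].1 Γ)
      ((act (Qs[j].2.rename (upr^[Qs[j].1 + 1] ρ)) Qs[j].1 G (nuTy (U.rename (upr ρ)))
        (unfoldVar (U.rename (upr ρ)) (mk G fs))).plug 1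
          (.app (tappVars ((fs[j].tshift Qs[j].1).shift 1) Qs[j].1) (.var 0)))
      (.app (tappVars (((cTm (U.rename (upr ρ)) sel Qs[j].1 j).tshift Qs[j].1).shift 1) Qs[j].1)
        ((unfoldVar (U.rename (upr ρ)) (mk G fs)).tshift Qs[j].1))
      ((Qs[j].2.rename (upr^[Qs[j].1 + 1] ρ)).subst
        (single Qs[j].1 (nuTy (U.rename (upr ρ))))) := by
  set m := Qs[j].1 with hm
  have hβ : (nuTy (U.rename (upr fun n => ρ n + m))).Adm := by
    have := hU.shift m
    rwa [nuTy_shift, rename_upr_rename_upr] at this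
  have eβ : (nuTy (U.rename (upr ρ))).shift m = nuTy (U.rename (upr fun n => ρ n + m)) := by
    rw [nuTy_shift, rename_upr_rename_upr]
  have hσ : ∀ n, (Ty.scons G (fun n => .var (ρ n)) n).Adm := adm_scons hG fun _ => trivial
  have hUσ : (U.subst (Ty.scons G fun n => .var (ρ n))).Adm := by
    rw [← rename_upr_inst]; exact (adm_of_nuTy hU).1.inst hG
  have hUσ' : (U.subst (Ty.scons (G.shift m) fun n => .var (ρ n + m))).Adm := by
    rw [← rename_upr_inst]; exact (adm_of_nuTy hβ).1.inst (hG.shift m)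
  have hd := S.mk_type hΓ hG hUσ hf
  have hv : HasType (G :: Γ) (unfoldVar (U.rename (upr ρ)) (mk G fs)) (nuTy (U.rename (upr ρ))) :=
    HasType.unfoldVar hU hG (by rw [rename_upr_inst]; exact hd)
  have hΔ : CtxAdm (G.shift m :: shiftC m Γ) := (hΓ.shiftC m).cons (hG.shift m)
  have hx : HasType (G.shift m :: shiftC m Γ) (.var 0) (G.shift m) := .var_zero (hG.shift m)
  let fs' := (fs.map fun f => f.tshift m).map fun f => f.shift 1
  have hf' : List.Forall₂ (fun f q => HasType (G.shift m :: shiftC m Γ) f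
      ((premR q).subst (Ty.scons (G.shift m) fun n => .var (ρ n + m)))) fs' Qs := by
    refine List.forall₂_map_left_iff.2 (List.forall₂_map_left_iff.2 (hf.imp fun f q hf => ?_))
    have := (hf.tshift m).shift_one (G.shift m)
    rwa [premR_shift, scons_shift] at this
  have hd' : HasType (G.shift m :: shiftC m Γ) (mk (G.shift m) fs') (.arr (G.shift m)
      (U.subst (Ty.scons (G.shift m) fun n => .var (ρ n + m)))) :=
    S.mk_type hΔ (hG.shift m) hUσ' hf'
  have hj2 : j < fs'.length := by simpa [fs'] using hj'
  have h1 := S.sel_mk hΔ (hG.shift m) hUσ' hf' hx j hj hj2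
  have h2 := S.cTm_app hU hj (hQ _ (List.getElem_mem _)) (J := 1) (hv.tshift m)
  have ed : unfoldVar (U.rename (upr fun n => ρ n + m)) ((mk G fs).tshift m) =
      .app (unfoldTm (U.rename (upr fun n => ρ n + m)) (mk (G.shift m) fs')) (.var 0) := by
    rw [unfoldVar, unfoldTm_shift, Tm.tshift, S.mk_tsubst, ← shift_eq_subst, Tm.shift,
      Tm.rename_eq_subst, S.mk_subst]
    simp only [fs', Tm.shift, Tm.rename_eq_subst]; rfl
  have h3 := outTm_unfoldTm hΔ hβ (hG.shift m) (by rw [rename_upr_inst]; exact hd') hx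
  have ef := fmap_shift_up 0 U (G.shift m) (nuTy (U.rename (upr fun n => ρ n + m)))
    (fun n => ρ n + m) (unfoldVar (U.rename (upr fun n => ρ n + m)) (mk (G.shift m) fs'))
  simp only [Function.iterate_succ, Function.iterate_zero, Function.comp_apply, id] at ef
  rw [rename_upr_inst, ef] at h3
  -- Destructing the unfolding gives the action of `U` on `d x`; naturality turns its `j`-th
  -- component into the action of `Aⱼ` on the component of `d x`, which `h1` identifies as `fⱼ Y⃗ⱼ
  -- x`.
  have h4 := (S.sel_congr hj h3).trans (S.sel_fmap hj h3.hasType.2)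
  have hA := (hQ _ (List.getElem_mem hj)).of_premR
  have hv' : HasType (G.shift m :: G.shift m :: shiftC m Γ)
      (unfoldVar (U.rename (upr fun n => ρ n + m)) (mk (G.shift m) fs'))
      (nuTy (U.rename (upr fun n => ρ n + m))) :=
    HasType.unfoldVar hβ (hG.shift m) (by rw [rename_upr_inst]; exact hd')
  have h5 := HasType.fmap (i := m) (b := true) (Γ := G.shift m :: shiftC m Γ)
    (t := unfoldVar (U.rename (upr fun n => ρ n + m)) (mk (G.shift m) fs')) hA
    (hpos _ (List.getElem_mem hj))
    (adm_sconsL (adm_tvars (m := m)) (adm_scons (hG.shift m) (σ := fun n => .var (ρ n + m)) fun _ => trivial))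
    (adm_sconsL (adm_tvars (m := m)) (adm_scons hβ (σ := fun n => .var (ρ n + m)) fun _ => trivial))
    (fun n hn => sconsL_ne _ _ hn) (by
      simp only [cond_true, Ty.sconsL_self (length_tvars _)]; exact hv')
  have h6 := h4.trans ((EpsEq.refl h5).plug_zero hΔ h1)
  rw [← eβ, sconsL_tvars_scons, sconsL_tvars_scons] at h6
  rw [unfoldVar_tshift, rename_upr_rename_upr, ed] at h2
  have h7 := (h2.trans h6).symm
  have el : (unfoldVar (U.rename (upr fun n => ρ n + m)) (Tm.tshift m (mk G fs))).subst
      (Tm.up fun n => .var (n + 1)) =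
      unfoldVar (U.rename (upr fun n => ρ n + m)) (mk (G.shift m) fs') := by
    rw [unfoldVar_subst_up, Tm.tshift, S.mk_tsubst, ← shift_eq_subst, S.mk_subst]
    simp only [fs', Tm.shift, Tm.rename_eq_subst]; rfl
  rw [act, fmap_shift_up, fmap_plug, unfoldVar_tshift, rename_upr_rename_upr, el, ed,
    Ty.rename_eq_subst Qs[j].2, ← Ty.iter_up_ren, Ty.subst_subst, iter_up_succ_single]
  simp only [fs', List.getElem_map] at h7
  exact h7

end Selectors

theorem unfoldVar_tsubst (V : Ty) (d : Tm) (θ : ℕ → Ty) :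
    (unfoldVar V d).tsubst θ = unfoldVar (V.subst (Ty.up θ)) (d.tsubst θ) := by
  rw [unfoldVar, Tm.tsubst, shift_tsubst, unfoldTm_tsubst]; rfl

theorem rename_upr_succ_subst_up_single (U E : Ty) :
    (U.rename (upr fun n => n + 1)).subst (Ty.up (single 0 E)) = U := by
  rw [Ty.rename_eq_subst, ← Ty.up_ren, Ty.subst_subst, Ty.up_comp]
  simp only [Ty.subst]
  exact (congrArg U.subst Ty.up_var).trans (Ty.subst_var U)

theorem vars_map_sconsL (es : List Tm) (θ : ℕ → Ty) :
    (vars es.length).map (fun f => (f.tsubst θ).subst (Tm.sconsL es .var)) = es := by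
  refine Eq.trans (List.map_congr_left fun f hf => ?_) (map_subst_sconsL es)
  simp only [vars, List.mem_map] at hf
  obtain ⟨n, _, rfl⟩ := hf; rfl

/-- Negativity of `B` is the case `b = false` of `isEpsIso_of`: the unfolding goes from `X` to `β`,
and its action on `B` goes from `β` back to `X`. -/
theorem Selectors.isEpsIso {Qs : List (ℕ × Ty)} {U B : Ty} {sel : ℕ → Tm → Tm}
    {mk : Ty → List Tm → Tm} (S : Selectors Qs U sel mk) (hs : SignR Qs B)
    (hU : (univR Qs B).Adm) (hβ : (nuTy U).Adm) :
    IsEpsIso (univR Qs B) (B.inst (nuTy U))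
      (apps (.tapp (.var 0) (nuTy U)) (List.ofFn fun j : Fin Qs.length => cTm U sel Qs[j].1 j))
      (.tlam (lams (Qs.map premR) ((fmap B 0 (Ty.scons ((nuTy U).shift 1) fun n => .var (n + 1))
        Ty.var (unfoldVar (U.rename (upr fun n => n + 1)) (mk (.var 0) (vars Qs.length)))).plug 0
          (.var (Qs.map premR).length)))) := by
  have hQ := hU.of_univR.1
  have hP : ∀ P ∈ Qs.map premR, P.Adm := fun P hP => by
    obtain ⟨q, hq, rfl⟩ := List.mem_map.1 hP; exact hQ q hq
  have eβ : ∀ k, (nuTy U).shift k = nuTy (U.rename (upr fun n => n + k)) := nuTy_shift U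
  have hβk : ∀ k, (nuTy (U.rename (upr fun n => n + k))).Adm := fun k => eβ k ▸ hβ.shift k
  have e0 : U.rename (upr fun n => n) = U := by
    rw [Ty.rename_eq_subst, ← Ty.up_ren]
    exact (congrArg U.subst Ty.up_var).trans (Ty.subst_var U)
  have hσv : Ty.scons (.var 0) (fun n => .var (n + 1)) = Ty.var := by funext n; cases n <;> rfl
  have hvars : ∀ Γ, List.Forall₂ (fun f q => HasType ((Qs.map premR).reverse ++ Γ) f
      ((premR q).subst (Ty.scons (.var 0) fun n => .var (n + 1)))) (vars Qs.length) Qs := by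
    intro Γ
    have := forall₂_vars (Qs.map premR) Γ hP
    rw [List.forall₂_map_right_iff, List.length_map] at this
    simpa only [hσv, Ty.subst_var] using this
  have hUσ : (U.subst (Ty.scons (.var 0) fun n => .var (n + 1))).Adm := by
    rw [hσv, Ty.subst_var]; exact (adm_of_nuTy hβ).1
  have hΓP : ∀ {Γ}, CtxAdm Γ → CtxAdm ((Qs.map premR).reverse ++ Γ) := fun hΓ =>
    CtxAdm.append (fun P h => hP P (List.mem_reverse.1 h)) hΓ
  have hd : ∀ {Γ}, CtxAdm Γ → HasType ((Qs.map premR).reverse ++ Γ) (mk (.var 0) (vars Qs.length))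
      (.arr (.var 0) (U.subst (Ty.scons (.var 0) fun n => .var (n + 1)))) := fun {Γ} hΓ =>
    S.mk_type (σ := Ty.scons (.var 0) fun n => .var (n + 1)) (hΓP hΓ) trivial hUσ (hvars Γ)
  have hv : ∀ {Γ}, CtxAdm Γ → HasType (.var 0 :: ((Qs.map premR).reverse ++ Γ))
      (unfoldVar (U.rename (upr fun n => n + 1)) (mk (.var 0) (vars Qs.length)))
      ((nuTy U).shift 1) := fun hΓ => by
    rw [eβ]
    exact HasType.unfoldVar (hβk 1) trivial (by rw [rename_upr_inst]; exact hd hΓ)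
  refine isEpsIso_of (b := false) hU hs.2 hβ ?_ ?_ (fun k => ?_) ?_
  · refine List.forall₂_iff_get.2 ⟨by simp, fun k h₁ h₂ => ?_⟩
    simp only [List.get_eq_getElem, List.getElem_ofFn, List.getElem_map]
    have hk : k < Qs.length := by simpa using h₂
    have := S.hasType_cTm (ρ := fun n => n) (by rwa [e0]) hk (hQ _ (List.getElem_mem hk))
    rw [e0] at this
    exact this
  · have := hv (Γ := []) (by simp [CtxAdm])
    rw [List.append_nil] at this
    exact this
  · have e1 := vars_map_sconsL (List.ofFn fun j : Fin Qs.length => cTm U sel Qs[j].1 j)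
      (single 0 (nuTy U))
    rw [List.length_ofFn] at e1
    have h1 := S.unfoldVar_cTm (hβk k) hQ
    rw [unfoldVar_tsubst, rename_upr_succ_subst_up_single, S.mk_tsubst, unfoldVar_subst_up,
      S.mk_subst, List.map_map, Function.comp_def, e1, unfoldVar_tshift, Tm.tshift, S.mk_tsubst,
      eβ]
    refine (EpsEq.congr_right h1.symm ?_).symm
    congr 2
    · rw [← eβ, shift_eq_subst]; rfl
    · refine List.ext_getElem (by simp) fun j h₁ h₂ => ?_
      simp only [List.getElem_map, List.getElem_ofFn]
      exact (S.cTm_tshift U (by simpa using h₁) k).symm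
  · have hΓ : CtxAdm [(univR Qs B).shift 1] := by simpa [CtxAdm] using hU.shift 1
    let Qs' := Qs.map (subR fun n => .var (n + 1))
    have hl : ∀ j : Fin Qs'.length, j.1 < Qs.length := fun j => by simpa [Qs'] using j.2
    have hlv : ∀ j : Fin Qs'.length, j.1 < (vars Qs.length).length := fun j => by
      rw [length_vars]; exact hl j
    have hsub := hs.subst fun n => .var (n + 1)
    rw [Ty.up_ren, ← Ty.rename_eq_subst] at hsub
    have hx : HasType ((Qs.map premR).reverse ++ [(univR Qs B).shift 1]) (.var Qs.length)
        (univR Qs' (B.rename (upr fun n => n + 1))) := by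
      have e : (univR Qs B).shift 1 = univR Qs' (B.rename (upr fun n => n + 1)) := by
        rw [shift_eq_subst, univR_subst, Ty.up_ren, ← Ty.rename_eq_subst]
      rw [← e]
      refine .var ?_ (hU.shift 1)
      rw [List.getElem?_append_right (by simp)]; simp
    have eq : ∀ (j : Fin Qs'.length) E, (premR (Qs'.get j)).inst E =
        (premR (Qs[j.1]'(hl j))).subst (Ty.scons E fun n => .var (n + 1)) := fun j E => by
      simp only [Qs', List.get_eq_getElem, List.getElem_map]
      rw [← premR_subst_up, subst_up_inst]
    -- The ε-rule is used along the unfolding from `X`, with the abstracted `fⱼ` as coalgebra, to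
    -- `β`, with the destructors `ĉⱼ`.
    have h1 := EpsEq.epsR Qs' (B.rename (upr fun n => n + 1)) (.var 0) ((nuTy U).shift 1)
      (.var Qs.length)
      (unfoldVar (U.rename (upr fun n => n + 1)) (mk (.var 0) (vars Qs.length)))
      (fun j => (vars Qs.length)[j.1]'(hlv j))
      (fun j => cTm (U.rename (upr fun n => n + 1)) sel (Qs[j.1]'(hl j)).1 j)
      hsub trivial (hβ.shift 1) hx (hv hΓ)
      (fun j => by
        rw [eq]; exact (List.forall₂_iff_get.1 (hvars _)).2 j (hlv j) (hl j))
      (fun j => by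
        rw [eq, eβ]
        exact (S.hasType_cTm (hβk 1) (hl j) (hQ _ (List.getElem_mem _))).of_closed _)
      fun j => by
        have := S.act_unfoldVar (G := .var 0) (hβk 1) hQ hs.1 (hΓP hΓ) trivial (hvars _) (hl j) (hlv j)
        simp only [Qs', List.get_eq_getElem, List.getElem_map, subR, Ty.iter_up_ren,
          ← Ty.rename_eq_subst]
        rw [eβ]
        exact this
    have ec : List.ofFn (fun j : Fin Qs'.length =>
        cTm (U.rename (upr fun n => n + 1)) sel (Qs[j.1]'(hl j)).1 j) =
        (List.ofFn fun j : Fin Qs.length => cTm U sel Qs[j].1 j).map fun e => e.tshift 1 := by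
      refine List.ext_getElem (by simp [Qs']) fun j h₁ h₂ => ?_
      simp only [List.getElem_map, List.getElem_ofFn]
      exact (S.cTm_tshift U (by simpa using h₂) 1).symm
    have ev : List.ofFn (fun j : Fin Qs'.length => (vars Qs.length)[j.1]'(hlv j)) =
        vars Qs.length := List.ext_getElem (by simp [Qs', length_vars]) fun j h₁ h₂ => by simp
    rw [ec, ev] at h1
    rw [show B.rename (upr fun n => n + 1) = B.rename (upr Nat.succ) from rfl, act_rename_up,
      show (B.rename (upr Nat.succ)).inst (.var 0) = B by
        rw [Ty.rename_eq_subst, ← Ty.up_ren]; exact inst_var_zero B] at h1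
    rw [List.length_map]
    exact h1

/-! ### Comparison of the conditional fixpoints, and the components of `d`. -/

theorem beta_eq_nuTy {Qs : List (ℕ × Ty)} {U : Ty} (h : occ 0 U = occR Qs) :
    beta Qs U = nuTy U := by rw [beta, nuTy, h]

theorem outB_eq_outTm {Qs : List (ℕ × Ty)} {U : Ty} (h : occ 0 U = occR Qs) (m : ℕ) (x : Tm) :
    outB Qs U m x = outTm (U.rename (upr fun n => n + m)) x := by
  rw [outB, outTm, Ty.rename_eq_subst, ← Ty.up_ren, occ_subst_up, h]

theorem tshift_tsubst_sconsL (t : Tm) (m : ℕ) :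
    (t.tshift m).tsubst (Ty.sconsL (tvars m) Ty.var) = t := by
  rw [tshift_tsubst]
  have e : (fun n => Ty.sconsL (tvars m) Ty.var (n + m)) = Ty.var := by
    funext n; simpa [length_tvars] using Ty.sconsL_add (tvars m) Ty.var n
  rw [e, tsubst_var]

theorem tvars_map_sconsL (m : ℕ) :
    (tvars m).map (fun C => C.subst (Ty.sconsL (tvars m) Ty.var)) = tvars m := by
  refine (List.map_congr_left fun C hC => ?_).trans (List.map_id _)
  obtain ⟨i, hi, rfl⟩ := List.mem_map.1 hC
  exact (Ty.sconsL_tvars m _ i).trans (if_pos (by simpa using hi))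

/-- `f Y⃗ z`, in context `Γ, z`. -/
def appVars (m : ℕ) (f : Tm) : Tm := .app (tappVars ((f.tshift m).shift 1) m) (.var 0)

theorem appVars_subst (m : ℕ) (f : Tm) (s : ℕ → Tm) :
    (appVars m f).subst (fun n => (Tm.up s n).tshift m) = appVars m (f.subst s) := by
  simp only [appVars, Tm.subst, tappVars_eq, tapps_subst, Tm.shift_subst, subst_tshift]
  simp only [Tm.up, Tm.scons, Tm.shift, Tm.subst_rename, tshift_rename]; rfl

theorem appVars_tsubst (m : ℕ) (f : Tm) (θ : ℕ → Ty) :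
    (appVars m f).tsubst (Ty.up^[m] θ) = appVars m (f.tsubst θ) := by
  simp only [appVars, Tm.tsubst, tappVars_eq, tapps_tsubst, tvars_map_iter_up, shift_tsubst,
    tshift_tsubst, Ty.iter_up_add]
  simp only [Tm.tshift, tsubst_tsubst, shift_eq_subst]

theorem appVars_plug (m : ℕ) (f x : Tm) :
    (appVars m f).subst (fun n => (Tm.scons x (fun n => .var (n + 0)) n).tshift m) =
      .app (tappVars (f.tshift m) m) (x.tshift m) := by
  simp only [appVars, Tm.subst, tappVars_eq, tapps_subst, Tm.shift_subst, Tm.scons]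
  congr 2
  exact Tm.subst_var _

theorem app_tappVars_tsubst (m : ℕ) (f x : Tm) :
    (Tm.app (tappVars (f.tshift m) m) (x.tshift m)).tsubst (Ty.sconsL (tvars m) Ty.var) =
      .app (tappVars f m) x := by
  simp only [Tm.tsubst, tappVars_eq, tapps_tsubst, tvars_map_sconsL, tshift_tsubst_sconsL]

theorem HasType.appVars {Γ : List Ty} {q : ℕ × Ty} {f : Tm} {σ : ℕ → Ty} (hG : (σ 0).Adm)
    (hf : HasType Γ f ((premR q).subst σ)) :
    HasType (shiftC q.1 (σ 0 :: Γ)) (appVars q.1 f) (q.2.subst (Ty.up^[q.1] σ)) := by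
  rw [premR_subst] at hf
  exact .app (HasType.tapps_tvars hf [(σ 0).shift q.1] rfl) (.var_zero (hG.shift q.1))

theorem tappVars_tlamN_tvars {Γ : List Ty} {t : Tm} {A : Ty} {m : ℕ} {σ : ℕ → Ty}
    (h : HasType Γ (tlamN m t) ((allN m A).subst σ)) :
    EpsEq Γ (tappVars (tlamN m t) m) (t.tsubst (Ty.sconsL (tvars m) Ty.var))
      (A.subst (Ty.sconsL (tvars m) σ)) := by
  have := tapps_tlamN (θ := Ty.var) (length_tvars m) (by rwa [tsubst_var]) adm_tvars
  rwa [tsubst_var] at this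

/-! #### `U = ∏ⱼ ∀Y⃗ⱼ. Aⱼ` -/

/-- The default number `0` of quantifiers is used only for an index out of range; a total function
of `j` is what `Selectors` asks for. -/
def selProdAll (Qs : List (ℕ × Ty)) (j : ℕ) (w : Tm) : Tm :=
  tappVars (proj Qs.length j w) ((Qs.map Prod.fst).getD j 0)

theorem selProdAll_eq {Qs : List (ℕ × Ty)} {j : ℕ} (h : j < Qs.length) (w : Tm) :
    selProdAll Qs j w = tappVars (proj Qs.length j w) Qs[j].1 := by
  simp [selProdAll, List.getD_eq_getElem?_getD, h]

theorem tyU_subst (Qs : List (ℕ × Ty)) (σ : ℕ → Ty) :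
    (tyU Qs).subst σ = prodN (Qs.map fun q => (allN q.1 q.2).subst σ) := by
  rw [tyU, prodN_subst, List.map_map]; rfl

/-- `λz. ⟨ΛY⃗ⱼ. fⱼ Y⃗ⱼ z⟩ⱼ` -/
def mkProdAll (Qs : List (ℕ × Ty)) (G : Ty) (fs : List Tm) : Tm :=
  .lam G (tuple (List.zipWith (fun q f => tlamN q.1 (appVars q.1 f)) Qs fs))

theorem selProdAll_congr {Qs : List (ℕ × Ty)} {Γ : List Ty} {w w' : Tm} {σ : ℕ → Ty} {j : ℕ}
    (h : j < Qs.length) (hw : EpsEq Γ w w' ((tyU Qs).subst σ)) :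
    EpsEq Γ (selProdAll Qs j w) (selProdAll Qs j w')
      (Qs[j].2.subst (Ty.sconsL (tvars Qs[j].1) σ)) := by
  rw [tyU_subst] at hw
  have h1 := hw.proj (j := j) (by simpa using h)
  simp only [List.length_map, List.getElem_map] at h1
  rw [selProdAll_eq h, selProdAll_eq h]
  exact h1.tapps (length_tvars _) adm_tvars

theorem forall₂_appVars {Qs : List (ℕ × Ty)} {Γ : List Ty} {fs : List Tm} {σ : ℕ → Ty}
    (hG : (σ 0).Adm) (hU : ((tyU Qs).subst σ).Adm)
    (hf : List.Forall₂ (fun f q => HasType Γ f ((premR q).subst σ)) fs Qs) :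
    List.Forall₂ (HasType (σ 0 :: Γ))
      (List.zipWith (fun q f => tlamN q.1 (appVars q.1 f)) Qs fs)
      (Qs.map fun q => (allN q.1 q.2).subst σ) := by
  rw [tyU_subst] at hU
  have hU := adm_prodN.1 hU
  refine List.forall₂_iff_get.2 ⟨by simp [hf.length_eq], fun j h₁ h₂ => ?_⟩
  have h3 := hU _ (List.getElem_mem h₂)
  have hj : j < Qs.length := by simpa using h₂
  simp only [List.get_eq_getElem, List.getElem_zipWith, List.getElem_map, allN_subst] at h3 ⊢
  exact .tlamN h3 (HasType.appVars hG
    ((List.forall₂_iff_get.1 hf).2 j (by rw [hf.length_eq]; exact hj) hj))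

/-- A selector projects and then instantiates `Y⃗ⱼ`. Joint monicity is extensionality of tuples
followed by η for the quantifiers of each component. -/
theorem selectors_prodAll (Qs : List (ℕ × Ty)) :
    Selectors Qs (tyU Qs) (selProdAll Qs) (mkProdAll Qs) where
  occ := by
    simp only [tyU, occ_prodN, List.any_map, Function.comp_def, occ_allN, Nat.zero_add, occR]
  sel_subst j w s := by simp only [selProdAll, tappVars_eq, tapps_subst, proj_subst]
  sel_tsubst j h w θ := by
    simp only [selProdAll_eq h, tappVars_eq, tapps_tsubst, tvars_map_iter_up, proj_tsubst]
  sel_congr h hw := selProdAll_congr h hw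
  sel_fmap {Γ σ τ t a j} h hw := by
    have h1 := proj_fmap_prodN (j := j) hw (by simpa using h)
    simp only [List.length_map, List.getElem_map] at h1
    rw [selProdAll_eq h, selProdAll_eq h]
    have h2 := tapps_fmap_allN (length_tvars Qs[j].1) h1.hasType.2 adm_tvars
    rw [Nat.zero_add] at h2
    exact (h1.tapps (length_tvars _) adm_tvars).trans h2
  sel_ext {Γ w w' σ} hΓ hU hw hw' h := by
    rw [tyU_subst] at hU hw hw' ⊢
    refine tuple_ext hw hw' fun j hj => ?_
    have hj' : j < Qs.length := by simpa using hj
    have h1 := h j hj'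
    have h2 := hw.proj hj
    have h3 := hw'.proj hj
    have h4 := adm_prodN.1 hU _ (List.getElem_mem hj)
    simp only [List.length_map, List.getElem_map, allN_subst] at h2 h3 h4 ⊢
    refine (tlamN_eta h2).trans ((EpsEq.tlamN h4 ?_).trans (tlamN_eta h3).symm)
    rw [selProdAll_eq hj', selProdAll_eq hj'] at h1
    simpa only [Tm.tshift, proj_tsubst] using h1
  mk_subst G fs s := by
    simp only [mkProdAll, Tm.subst, tuple_subst, List.map_zipWith, List.zipWith_map_right,
      tlamN_subst, appVars_subst]
  mk_tsubst G fs θ := by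
    simp only [mkProdAll, Tm.tsubst, tuple_tsubst, List.map_zipWith, List.zipWith_map_right,
      tlamN_tsubst, appVars_tsubst]
  mk_type {Γ fs σ} _ hG hU hf := by
    refine .lam hG ?_
    rw [tyU_subst]
    exact HasType.tuple (forall₂_appVars hG hU hf)
  sel_mk {Γ fs x σ} hΓ hG hU hf hx j h h' := by
    have hF := forall₂_appVars hG hU hf
    have hT := HasType.tuple hF
    rw [← tyU_subst] at hT
    have h1 := selProdAll_congr h (EpsEq.beta hT hx)
    refine h1.trans ?_
    rw [Tm.plug, tuple_subst, selProdAll_eq h]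
    have hF' : List.Forall₂ (HasType Γ) ((List.zipWith (fun q f =>
        tlamN q.1 (appVars q.1 f)) Qs fs).map fun t =>
          t.subst (Tm.scons x fun n => .var (n + 0))) (Qs.map fun q => (allN q.1 q.2).subst σ) :=
      List.forall₂_map_left_iff.2 (hF.imp fun _ _ ht => ht.plug_zero hx)
    have h2 := proj_tuple hF' (j := j) (by simpa using h) (by simpa using ⟨h, h'⟩)
    simp only [List.length_map, List.getElem_map, List.getElem_zipWith, tlamN_subst,
      appVars_plug] at h2
    have h3 := tappVars_tlamN_tvars h2.hasType.2
    rw [app_tappVars_tsubst] at h3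
    exact (h2.tapps (length_tvars _) adm_tvars).trans h3

/-! #### `U = ∀Y⃗. ∏ⱼ Aⱼ` -/

/-- `λz. ΛY⃗. ⟨fⱼ Y⃗ z⟩ⱼ` -/
def mkAllProd (m : ℕ) (G : Ty) (fs : List Tm) : Tm :=
  .lam G (tlamN m (tuple (fs.map (appVars m))))

def selAllProd (m n j : ℕ) (w : Tm) : Tm := proj n j (tappVars w m)

theorem selAllProd_congr {m : ℕ} {As : List Ty} {Γ : List Ty} {w w' : Tm} {σ : ℕ → Ty} {j : ℕ}
    (h : j < As.length) (hw : EpsEq Γ w w' ((tyUc m As).subst σ)) :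
    EpsEq Γ (selAllProd m As.length j w) (selAllProd m As.length j w')
      (As[j].subst (Ty.sconsL (tvars m) σ)) := by
  have h1 := hw.tapps (length_tvars m) adm_tvars
  rw [prodN_subst] at h1
  have h2 := h1.proj (j := j) (by simpa using h)
  simp only [List.length_map, List.getElem_map] at h2
  exact h2

theorem forall₂_appVars_common {m : ℕ} {As Γ : List Ty} {fs : List Tm} {σ : ℕ → Ty}
    (hG : (σ 0).Adm)
    (hf : List.Forall₂ (fun f q => HasType Γ f ((premR q).subst σ)) fs (common m As)) :
    List.Forall₂ (HasType (shiftC m (σ 0 :: Γ))) (fs.map (appVars m))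
      (As.map fun A => A.subst (Ty.up^[m] σ)) := by
  rw [common, List.forall₂_map_right_iff] at hf
  rw [List.forall₂_map_left_iff, List.forall₂_map_right_iff]
  exact hf.imp fun f A h => HasType.appVars (q := (m, A)) hG h

/-- A selector instantiates `Y⃗` and then projects, so joint monicity uses η for the quantifiers
before extensionality of tuples. The common list `Y⃗` is what makes a single instantiation serve all
components. -/
theorem selectors_allProd (m : ℕ) (As : List Ty) :
    Selectors (common m As) (tyUc m As) (selAllProd m As.length) (mkAllProd m) where
  occ := by
    simp only [tyUc, occ_prodN, occ_allN, Nat.zero_add, occR, common, List.any_map,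
      Function.comp_def]
  sel_subst j w s := by simp only [selAllProd, tappVars_eq, tapps_subst, proj_subst]
  sel_tsubst j h w θ := by
    simp only [common, List.getElem_map, selAllProd, tappVars_eq, tapps_tsubst, tvars_map_iter_up,
      proj_tsubst]
  sel_congr {Γ w w' σ j} h hw := by
    simp only [common, List.getElem_map]
    exact selAllProd_congr (by simpa [common] using h) hw
  sel_fmap {Γ σ τ t a j} h hw := by
    have hj : j < As.length := by simpa [common] using h
    have h1 := tapps_fmap_allN (length_tvars m) hw adm_tvars
    rw [Nat.zero_add] at h1
    have h2 := proj_fmap_prodN h1.hasType.2 hj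
    rw [prodN_subst] at h1
    have h3 := h1.proj (j := j) (by simpa using hj)
    simp only [List.length_map, List.getElem_map] at h3
    simp only [common, List.getElem_map]
    exact h3.trans h2
  sel_ext {Γ w w' σ} hΓ hU hw hw' h := by
    rw [tyUc, allN_subst] at hU hw hw' ⊢
    refine (tlamN_eta hw).trans ((EpsEq.tlamN hU ?_).trans (tlamN_eta hw').symm)
    have h1 := HasType.tappVars (hw.tshift m)
    have h2 := HasType.tappVars (hw'.tshift m)
    rw [prodN_subst] at h1 h2 ⊢
    refine tuple_ext h1 h2 fun j hj => ?_
    have hj' : j < As.length := by simpa using hj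
    have h3 := h j (by simpa [common] using hj')
    simp only [common, List.getElem_map] at h3
    simp only [List.length_map, List.getElem_map]
    exact h3
  mk_subst G fs s := by
    simp only [mkAllProd, Tm.subst, tuple_subst, List.map_map, Function.comp_def, tlamN_subst,
      appVars_subst]
  mk_tsubst G fs θ := by
    simp only [mkAllProd, Tm.tsubst, tuple_tsubst, List.map_map, Function.comp_def, tlamN_tsubst,
      appVars_tsubst]
  mk_type {Γ fs σ} _ hG hU hf := by
    refine .lam hG ?_
    rw [tyUc, allN_subst] at hU ⊢
    refine .tlamN hU ?_
    rw [prodN_subst]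
    exact HasType.tuple (forall₂_appVars_common hG hf)
  sel_mk {Γ fs x σ} hΓ hG hU hf hx j h h' := by
    have hj : j < As.length := by simpa [common] using h
    have hT := HasType.tuple (forall₂_appVars_common hG hf)
    rw [← prodN_subst] at hT
    have hb : HasType (σ 0 :: Γ) (tlamN m (tuple (fs.map (appVars m)))) ((tyUc m As).subst σ) := by
      rw [tyUc, allN_subst] at hU ⊢
      exact .tlamN hU hT
    have h1 := EpsEq.beta hb hx
    rw [Tm.plug, tlamN_subst, tuple_subst, List.map_map] at h1
    simp only [Function.comp_def, appVars_plug] at h1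
    have h2 := (h1.tapps (length_tvars m) adm_tvars).trans (tappVars_tlamN_tvars h1.hasType.2)
    rw [tuple_tsubst, List.map_map] at h2
    simp only [Function.comp_def, app_tappVars_tsubst] at h2
    rw [prodN_subst] at h2
    have h3 := h2.proj (j := j) (by simpa using hj)
    simp only [List.length_map, List.getElem_map] at h3
    have hF : List.Forall₂ (HasType Γ) (fs.map fun f => .app (tappVars f m) x)
        (As.map fun A => A.subst (Ty.sconsL (tvars m) σ)) := by
      rw [common, List.forall₂_map_right_iff] at hf
      rw [List.forall₂_map_left_iff, List.forall₂_map_right_iff]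
      refine hf.imp fun f A hf => ?_
      have h4 := HasType.tapps (A := .arr (.var m) A) (length_tvars m) hf adm_tvars
      have e : Ty.sconsL (tvars m) σ m = σ 0 := by rw [Ty.sconsL_tvars]; simp
      simp only [Ty.subst, e] at h4
      exact .app h4 hx
    have h4 := proj_tuple hF (j := j) (by simpa using hj) (by simpa using h')
    simp only [List.length_map, List.getElem_map] at h4
    simp only [common, List.getElem_map]
    exact h3.trans h4

/-! #### The terms of the schema -/

theorem cHat_eq_cTm (Qs : List (ℕ × Ty)) :
    cHat Qs = fun j : Fin Qs.length => cTm (tyU Qs) (selProdAll Qs) Qs[j].1 j := by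
  funext j
  have h := (selectors_prodAll Qs).occ
  simp only [cHat, cTm, beta_eq_nuTy h, outB_eq_outTm h, selProdAll_eq j.2, List.get_eq_getElem,
    Fin.getElem_fin]

theorem cHatc_eq_cTm (m : ℕ) (As : List Ty) :
    cHatc m As = fun j : Fin (common m As).length => cTm (tyUc m As) (selAllProd m As.length) (common m As)[j].1 j := by
  funext j
  have h := (selectors_allProd m As).occ
  simp only [cHatc, cTm, beta_eq_nuTy h, outB_eq_outTm h, selAllProd, Fin.getElem_fin]
  simp only [common, List.getElem_map]

/-- The weakening by one variable accounts for the argument of the unfolding, in whose context `d`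
is written. -/
theorem mkProdAll_vars (Qs : List (ℕ × Ty)) :
    (mkProdAll Qs (.var 0) (vars Qs.length)).shift 1 = dTerm Qs := by
  rw [Tm.shift, Tm.rename_eq_subst, (selectors_prodAll Qs).mk_subst, mkProdAll, dTerm]
  congr 2
  refine List.ext_getElem (by simp [length_vars]) fun j h₁ h₂ => ?_
  simp only [List.getElem_zipWith, List.getElem_map, getElem_vars, List.getElem_ofFn, appVars,
    List.get_eq_getElem]
  rfl

theorem mkAllProd_vars (m : ℕ) (As : List Ty) :
    (mkAllProd m (.var 0) (vars (common m As).length)).shift 1 = dTermc m As := by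
  rw [Tm.shift, Tm.rename_eq_subst, (selectors_allProd m As).mk_subst, mkAllProd, dTermc]
  congr 3
  refine List.ext_getElem (by simp [length_vars, common]) fun j h₁ h₂ => ?_
  simp only [List.getElem_map, getElem_vars, List.getElem_ofFn, appVars]
  simp only [common, List.length_map]
  rfl

/-- The schema `≡_{X-}`, for any of the two forms of `U⟨X⟩`. -/
theorem Selectors.isEpsIso_univR {Qs : List (ℕ × Ty)} {U : Ty} {sel : ℕ → Tm → Tm}
    {mk : Ty → List Tm → Tm} (S : Selectors Qs U sel mk) {B : Ty} (hs : SignR Qs B)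
    (hU : (univR Qs B).Adm) (hβ : (beta Qs U).Adm) {c : Fin Qs.length → Tm} {d : Tm}
    (hc : c = fun j : Fin Qs.length => cTm U sel Qs[j].1 j)
    (hd : (mk (.var 0) (vars Qs.length)).shift 1 = d) :
    IsEpsIso (univR Qs B) (B.inst (beta Qs U)) (uTerm Qs U c) (vTerm Qs U d B) := by
  have h := S.isEpsIso hs hU (by rwa [← beta_eq_nuTy S.occ])
  have ho : Ty.occ 0 (U.rename (upr Nat.succ)) = occR Qs := by
    rw [Ty.rename_eq_subst, ← Ty.up_ren, occ_subst_up, S.occ]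
  have e : Tm.app (if occR Qs then .unfoldn (U.rename (upr Nat.succ)) d else d) (.var 0) =
      unfoldVar (U.rename (upr Nat.succ)) (mk (.var 0) (vars Qs.length)) := by
    rw [unfoldVar, unfoldTm_shift, unfoldTm, hd, ho]
  rw [uTerm, vTerm, beta_eq_nuTy S.occ, hc, e]
  rwa [List.length_map] at h

end Yoneda

/-! ### The isomorphism schemas. -/

theorem mainTheorem10 :
    (∀ (Ps : List (ℕ × List Yoneda.Ty)) (B : Yoneda.Ty), Yoneda.Ty.SignL Ps B →
      (Yoneda.Ty.univL Ps B).Adm → (Yoneda.alpha Ps).Adm →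
      Yoneda.IsEpsIso (Yoneda.Ty.univL Ps B) (B.inst (Yoneda.alpha Ps))
        (Yoneda.sTerm Ps) (Yoneda.tTerm Ps B)) ∧
    (∀ (Qs : List (ℕ × Yoneda.Ty)) (B : Yoneda.Ty), Yoneda.Ty.SignR Qs B →
      (Yoneda.Ty.univR Qs B).Adm → (Yoneda.beta Qs (Yoneda.tyU Qs)).Adm →
      Yoneda.IsEpsIso (Yoneda.Ty.univR Qs B) (B.inst (Yoneda.beta Qs (Yoneda.tyU Qs)))
        (Yoneda.uTerm Qs (Yoneda.tyU Qs) (Yoneda.cHat Qs))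
        (Yoneda.vTerm Qs (Yoneda.tyU Qs) (Yoneda.dTerm Qs) B)) ∧
    (∀ (m : ℕ) (As : List Yoneda.Ty) (B : Yoneda.Ty), Yoneda.Ty.SignR (Yoneda.common m As) B →
      (Yoneda.Ty.univR (Yoneda.common m As) B).Adm →
      (Yoneda.beta (Yoneda.common m As) (Yoneda.tyUc m As)).Adm →
      Yoneda.IsEpsIso (Yoneda.Ty.univR (Yoneda.common m As) B)
        (B.inst (Yoneda.beta (Yoneda.common m As) (Yoneda.tyUc m As)))
        (Yoneda.uTerm (Yoneda.common m As) (Yoneda.tyUc m As) (Yoneda.cHatc m As))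
        (Yoneda.vTerm (Yoneda.common m As) (Yoneda.tyUc m As) (Yoneda.dTermc m As) B)) :=
  ⟨fun _ _ hs hU hα => Yoneda.isEpsIso_univL hs hU hα,
    fun Qs _ hs hU hβ => (Yoneda.selectors_prodAll Qs).isEpsIso_univR hs hU hβ
      (Yoneda.cHat_eq_cTm Qs) (Yoneda.mkProdAll_vars Qs),
    fun m As _ hs hU hβ => (Yoneda.selectors_allProd m As).isEpsIso_univR hs hU hβ
      (Yoneda.cHatc_eq_cTm m As) (Yoneda.mkAllProd_vars m As)⟩
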